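/- **Setting.** Let $d\ge 1$ and let $F:\mathbb R^d\to\mathbb R^d$ be continuously differentiable, monotone, $L_1$-Lipschitz ($L_1>0$), with $L_2$-Lipschitz Jacobian (operator norm). Three problem classes are considered: (E) the equation $F(z)=0$; (Min) $\min f$, where $F=\nabla f$; (MM) $\min_x\max_y f(x,y)$, where $z=(x,y)\in\mathbb R^m\times\mathbb R^{d-m}$ and $F=(\nabla_x f,-\nabla_y f)$ ($f$ differentiable). For a nonempty compact $D\subset\mathbb R^d$, $\mathrm{Gap}(z;D)$ is $\max_{z'\in D}\langle F(z'),z-z'\rangle$ for (E), $\max_{z'\in D}(f(z)-f(z'))$ for (Min), and $\max_{(x',y')\in D}(f(x,y')-f(x',y))$ for (MM). Let $\mathcal L\subset\mathbb R^{d\times d}$ be a linear subspace containing $I$, with all its elements symmetric for (Min), and all satisfying $JB=B^\top J$, $J=\mathrm{diag}(I_m,-I_{d-m})$, for (MM); $P$ is the Frobenius-orthogonal projection onto $\mathcal L$. **Algorithm (QNPE, monotone case).** Parameters: $\alpha_1,\alpha_2\in(0,\frac12)$, $\beta\in(0,1)$, $\sigma_0\ge\frac{\alpha_2\beta}{5L_1}$,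 $\rho>0$, $p\in(0,1)$, $z_0\in\mathbb R^d$, and $B_0\in\mathcal L$ with $0\preceq B_0\preceq L_1I$ for (Min), and $0\preceq\frac12(B_0+B_0^\top)\preceq L_1I$, $\|B_0\|_{op}\le L_1$ otherwise. *Iteration $k\ge0$.* For $i=0,1,\dots$ put $\eta=\sigma_k\beta^i$ and $\hat z=z_k+\mathsf{LinearSolver}(I+\eta B_k,-\eta F(z_k);\alpha_1)$, and stop at the first $i$ with $\|\hat z-z_k+\eta F(\hat z)\|\le(\alpha_1+\alpha_2)\|\hat z-z_k\|$; call the result $(\eta_k,\hat z_k)$. Put $z_{k+1}=z_k-\eta_kF(\hat z_k)$ and $\sigma_{k+1}=\eta_k/\beta$. If no trial was rejected, $B_{k+1}=B_k$. Otherwise let $\tilde z_k$ be the last rejected point; $B_{k+1}$ results from the Jacobian update below. An iteration uses one evaluation of $F$ at $z_k$ and one per trial. *$\mathsf{LinearSolver}(A,b;r)$* runs, from $s_0=0$, the conjugate residual method if $A$ is symmetric and CGLS otherwise, and returns the first iterate $s_j$ with $\|b-As_j\|\le r\|s_j\|$. *Jacobian update.* Number the iterations that backtrack by $t=0,1,\dots$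 and call "round $t$" the period that ends with the $t$-th of them; one matrix $B$ is used throughout a round. Start with $W_0=\frac1{L_1}(B_0-L_1I)$ and, in round 0, with $B=B_0$ and $\gamma_0=0$, $S_0=0$ (no query). In the iteration $k$ that ends round $t$, let $s=\tilde z_k-z_k$, $u=F(\tilde z_k)-F(z_k)$, $G=\frac1{L_1}P\nabla\ell(B)$ with $\ell(B)=\|u-Bs\|^2/\|s\|^2$, and put $\tilde G=G$ if $\gamma_t\le1$, $\tilde G=G+\max\{0,-\frac1{\gamma_t}\langle G,W_t\rangle\}S_t$ otherwise; then $W_{t+1}=\frac{\sqrt d\,V}{\max\{\sqrt d,\|V\|_F\}}$, where $V=W_t-\rho\tilde G$. At the start of the next iteration, which opens round $t\ge1$, query $(\gamma^{(1)},S^{(1)})=\mathsf{ExtEvec}(\frac12(W_t+W_t^\top);\delta_t,\frac{q_t}2)$ and, except for (Min), $(\gamma^{(2)},S^{(2)})=\mathsf{MaxSvec}(W_t;\delta_t,\frac{q_t}2)$, where $\delta_t=\frac1{2(t+1)^{1/4}}$ and $q_t=\frac p{2.5(t+1)\log^2(t+1)}$. Let $\gamma_t$ be the largest returned $\gamma^{(i)}$,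 $S_t=PS^{(i)}$ for that $i$, and $B=L_1\hat B+L_1I$ with $\hat B=\frac{W_t}{(1+\delta_t)\max\{1,\gamma_t\}}$. *Oracles.* $\mathsf{ExtEvec}(W;\delta,q)$ runs $K=\lceil\frac14\sqrt{2(1+1/\delta)}\log\frac{11d}{q^2}+\frac12\rceil$ Lanczos iterations on $\bar W=\frac12(W+W^\top)$ (fewer if the recurrence breaks down), from a fresh uniformly random unit vector. With the resulting extreme approximate eigenvalues $\hat\lambda_1,\hat\lambda_d$ and unit eigenvectors $u^{(1)},u^{(d)}$, it returns $\gamma=\max\{\hat\lambda_1,-\hat\lambda_d\}$ and $S=0$ if $\gamma\le1$, $S=u^{(1)}u^{(1)\top}$ if $\gamma>1$ and $\hat\lambda_1\ge-\hat\lambda_d$, $S=-u^{(d)}u^{(d)\top}$ otherwise. $\mathsf{MaxSvec}(W;\delta,q)$ does the same with $K=\lceil\frac14\sqrt{2(1+1/\delta)}\log\frac{22d}{q^2}+\frac12\rceil$ on $\begin{bmatrix}0&W\\W^\top&0\end{bmatrix}$; with the approximate largest eigenvalue $\tilde\lambda_1$ and unit eigenvector $(v,v')$ it returns $\gamma=\tilde\lambda_1/3$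 and $S=0$ if $\gamma\le1$, $S=\frac23vv'^\top$ otherwise. All start vectors are independent. **Theorem.** There are an absolute constant $C_0$ and a constant $C$ depending only on $\alpha_1,\alpha_2,\beta$ such that, with probability at least $1-p$, the following holds for all nonempty compact $D$ and all $\varepsilon>0$. There is a least $N\ge1$, denoted $N_\varepsilon$, with $\mathrm{Gap}(\bar z_N;D)\le\varepsilon$, where $\bar z_N=\sum_{k<N}\eta_k\hat z_k/\sum_{k<N}\eta_k$; all line searches and linear solves in the first $N_\varepsilon$ iterations terminate, and during these iterations: (a) at most $3N_\varepsilon+\log_{1/\beta}\bigl(\frac{5\sigma_0L_1}{\alpha_2}\bigr)$ evaluations of $F$ are made; (b) for (E) and (MM), $\mathsf{LinearSolver}$ uses at most $C\Bigl(N_\varepsilon+\frac{L_1\max_{z\in D}\|z_0-z\|^2}{\varepsilon}+\sigma_0L_1\Bigr)$ matrix–vector products, and $\mathsf{ExtEvec}$ and $\mathsf{MaxSvec}$ together use at most $C_0N_\varepsilon^{1.125}\log\bigl(\frac{dN_\varepsilon^2}{p^2}\bigr)$; (c) for (Min), $\mathsf{LinearSolver}$ uses at most $C\Bigl(N_\varepsilon+\sqrt{N_\varepsilon\frac{L_1\max_{z\in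 D}\|z_0-z\|^2}{2\varepsilon}}+\sqrt{\sigma_0L_1}\Bigr)$ matrix–vector products, and $\mathsf{ExtEvec}$ uses at most $C_0N_\varepsilon^{1.125}\log\bigl(\frac{dN_\varepsilon^2}{p^2}\bigr)$. -/

import Mathlib

open MeasureTheory ProbabilityTheory

namespace QNPE

/-! ## Vectors and matrices -/

/-- Euclidean space with coordinates indexed by `ι`. -/
abbrev Vec (ι : Type) [Fintype ι] := EuclideanSpace ℝ ι

/-- Square real matrices of size `d`. -/
abbrev Mat (d : ℕ) := Matrix (Fin d) (Fin d) ℝ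

noncomputable section

variable {ι : Type} [Fintype ι] [DecidableEq ι]

/-- The matrix-vector product. -/
def mulV (A : Matrix ι ι ℝ) (v : Vec ι) : Vec ι := WithLp.toLp 2 (A.mulVec v.ofLp)

/-- The operator norm with respect to the Euclidean norm. -/
def opNorm (A : Matrix ι ι ℝ) : ℝ := ‖Matrix.toEuclideanCLM (𝕜 := ℝ) A‖

/-- The rank-one matrix `u vᵀ`. -/
def outer (u v : Vec ι) : Matrix ι ι ℝ := Matrix.vecMulVec u.ofLp v.ofLp

/-- The symmetric part `(A + Aᵀ) / 2`. -/
def symPart (A : Matrix ι ι ℝ) : Matrix ι ι ℝ := (1 / 2 : ℝ) • (A + A.transpose)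

/-- Matrices as vectors of their entries: the Euclidean structure on the right is the Frobenius
structure on matrices. -/
def vecEquiv (d : ℕ) : Mat d ≃ₗ[ℝ] EuclideanSpace ℝ (Fin d × Fin d) :=
  ((Matrix.ofLinearEquiv ℝ).symm.trans (LinearEquiv.curry ℝ ℝ (Fin d) (Fin d)).symm).trans
    (WithLp.linearEquiv 2 ℝ (Fin d × Fin d → ℝ)).symm

/-- The Frobenius norm. -/
def frobNorm {d : ℕ} (A : Mat d) : ℝ := ‖vecEquiv d A‖

/-- The Frobenius inner product. -/
def frobInner {d : ℕ} (A B : Mat d) : ℝ := inner ℝ (vecEquiv d A) (vecEquiv d B)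

/-- The orthogonal projection (for the Frobenius inner product) onto a linear subspace `L`. -/
def frobProj {d : ℕ} (L : Submodule ℝ (Mat d)) (A : Mat d) : Mat d :=
  (vecEquiv d).symm ((L.map (vecEquiv d).toLinearMap).starProjection (vecEquiv d A))

/-- The first index at which `P` holds, `⊤` if there is none. -/
def firstIndex (P : ℕ → Prop) : ℕ∞ := ⨅ (k : ℕ) (_ : P k), (k : ℕ∞)

/-! ## The three problem classes -/

/-- A nonlinear equation `F z = 0`, a minimization problem `min f`, or a minimax problem
`min_x max_y f (x, y)`, on `ℝ^d`. In the last case `z = (x, y)`, where `x` consists of the first `m`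
coordinates of `z` and `y` of the others. -/
inductive Problem (d : ℕ) where
  | equation (F : Vec (Fin d) → Vec (Fin d))
  | minimization (f : Vec (Fin d) → ℝ)
  | minimax (m : ℕ) (f : Vec (Fin d) → ℝ)

/-- The point `(x, y')`, where `z = (x, y)` and `z' = (x', y')`. -/
def splice {d : ℕ} (m : ℕ) (z z' : Vec (Fin d)) : Vec (Fin d) :=
  WithLp.toLp 2 (fun i => if i.val < m then z i else z' i)

/-- The matrix `J = diag (I, -I)`. -/
def signMatrix (d m : ℕ) : Mat d := Matrix.diagonal (fun i => if i.val < m then 1 else -1)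

namespace Problem

variable {d : ℕ}

/-- The operator whose zero is sought: `F`, `∇ f`, or `(∇_x f, -∇_y f)`. -/
def operator : Problem d → Vec (Fin d) → Vec (Fin d)
  | equation F => F
  | minimization f => fun z => gradient f z
  | minimax m f => fun z => mulV (signMatrix d m) (gradient f z)

/-- `f` is differentiable, where there is an `f`, and the blocks of a minimax problem fit. -/
def WellPosed : Problem d → Prop
  | equation _ => True
  | minimization f => Differentiable ℝ f
  | minimax m f => m ≤ d ∧ Differentiable ℝ f

def IsMinimization : Problem d → Prop
  | equation _ => False
  | minimization _ => True
  | minimax _ _ => False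

/-- The restricted gap of `z` with respect to the set `D`. -/
def gap (P : Problem d) (D : Set (Vec (Fin d))) (z : Vec (Fin d)) : ℝ :=
  match P with
  | equation F => sSup ((fun z' => inner ℝ (F z') (z - z')) '' D)
  | minimization f => sSup ((fun z' => f z - f z') '' D)
  | minimax m f => sSup ((fun z' => f (splice m z z') - f (splice m z' z)) '' D)

/-- The linear structure that a matrix space `L` has to impose: none for equations, symmetry for
minimization, `J`-symmetry for minimax problems. -/
def Structured (P : Problem d) (L : Submodule ℝ (Mat d)) : Prop :=
  match P with
  | equation _ => True
  | minimization _ => ∀ B ∈ L, B.IsSymm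
  | minimax m _ => ∀ B ∈ L, signMatrix d m * B = B.transpose * signMatrix d m

/-- The feasible set of the Jacobian approximations (monotone case). -/
def feasibleSet (P : Problem d) (L : Submodule ℝ (Mat d)) (L₁ : ℝ) : Set (Mat d) :=
  match P with
  | minimization _ => {B | B.PosSemidef ∧ (L₁ • (1 : Mat d) - B).PosSemidef ∧ B ∈ L}
  | _ => {B | (symPart B).PosSemidef ∧ (L₁ • (1 : Mat d) - symPart B).PosSemidef ∧
      opNorm B ≤ L₁ ∧ B ∈ L}

end Problem

/-! ## The linear solver

Conjugate gradients on the normal equations (CGLS) if `A` is not symmetric, conjugate residuals if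
it is. The field `mv` counts the matrix-vector products. -/

structure SolverState (d : ℕ) where
  s : Vec (Fin d)
  r : Vec (Fin d)
  p : Vec (Fin d)
  q : Vec (Fin d)
  γ : ℝ
  mv : ℕ

def cglsInit {d : ℕ} (A : Mat d) (b : Vec (Fin d)) : SolverState d :=
  let v := mulV A.transpose b
  { s := 0, r := b, p := v, q := 0, γ := inner ℝ v v, mv := 1 }

def cglsStep {d : ℕ} (A : Mat d) (st : SolverState d) : SolverState d :=
  let q := mulV A st.p
  let α := st.γ / ‖q‖ ^ 2
  let s' := st.s + α • st.p
  let r' := st.r - α • q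
  let v' := mulV A.transpose r'
  let γ' := ‖v'‖ ^ 2
  let β := γ' / st.γ
  { s := s', r := r', p := v' + β • st.p, q := q, γ := γ', mv := st.mv + 2 }

def crInit {d : ℕ} (A : Mat d) (b : Vec (Fin d)) : SolverState d :=
  let v := mulV A.transpose b
  { s := 0, r := b, p := b, q := v, γ := inner ℝ v b, mv := 1 }

def crStep {d : ℕ} (A : Mat d) (st : SolverState d) : SolverState d :=
  let α := st.γ / ‖st.q‖ ^ 2
  let s' := st.s + α • st.p
  let r' := st.r - α • st.q
  let v' := mulV A r'
  let γ' := inner ℝ v' r'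
  let β := γ' / st.γ
  { s := s', r := r', p := r' + β • st.p, q := v' + β • st.q, γ := γ', mv := st.mv + 1 }

open Classical in
/-- The state of the linear solver after `k` iterations. -/
def solverState {d : ℕ} (A : Mat d) (b : Vec (Fin d)) (k : ℕ) : SolverState d :=
  if A.IsSymm then (crStep A)^[k] (crInit A b) else (cglsStep A)^[k] (cglsInit A b)

/-- The number of iterations of the solver until `‖r_k‖ ≤ ρ ‖s_k‖`; `⊤` if it does not stop. -/
def solverStop {d : ℕ} (A : Mat d) (b : Vec (Fin d)) (ρ : ℝ) : ℕ∞ :=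
  firstIndex (fun k => ‖(solverState A b k).r‖ ≤ ρ * ‖(solverState A b k).s‖)

/-- The output of the linear solver (meaningful if it stops). -/
def linearSolver {d : ℕ} (A : Mat d) (b : Vec (Fin d)) (ρ : ℝ) : Vec (Fin d) :=
  (solverState A b (solverStop A b ρ).toNat).s

open Classical in
/-- The number of matrix-vector products of one call of the linear solver. -/
def solverCost {d : ℕ} (A : Mat d) (b : Vec (Fin d)) (ρ : ℝ) : ℕ∞ :=
  if solverStop A b ρ = ⊤ then ⊤ else ((solverState A b (solverStop A b ρ).toNat).mv : ℕ∞)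

/-! ## The Lanczos method and the eigenvector and singular-vector oracles -/

/-- The quantities `v_{k-1}, v_k, β_k` of the Lanczos recurrence. -/
structure LanczosState (ι : Type) [Fintype ι] where
  vPrev : Vec ι
  v : Vec ι
  β : ℝ

/-- `⟨W v_k - β_k v_{k-1}, v_k⟩`. -/
def LanczosState.alpha (W : Matrix ι ι ℝ) (st : LanczosState ι) : ℝ :=
  inner ℝ (mulV W st.v - st.β • st.vPrev) st.v

def lanczosStep (W : Matrix ι ι ℝ) (st : LanczosState ι) : LanczosState ι :=
  let w := mulV W st.v - st.β • st.vPrev - st.alpha W • st.v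
  { vPrev := st.v, v := ‖w‖⁻¹ • w, β := ‖w‖ }

/-- `lanczosSeq W x k` holds `v_k, v_{k+1}, β_{k+1}`, where `v_0 = 0`, `v_1 = x`, `β_1 = 0`. -/
def lanczosSeq (W : Matrix ι ι ℝ) (x : Vec ι) (k : ℕ) : LanczosState ι :=
  (lanczosStep W)^[k] { vPrev := 0, v := x, β := 0 }

/-- The number of Lanczos steps that are performed: `K`, unless the recurrence breaks down
(`β_{m+1} = 0`, that is, an invariant subspace has been found) at an earlier step `m`. -/
def lanczosDim (W : Matrix ι ι ℝ) (x : Vec ι) (K : ℕ) : ℕ :=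
  sInf {m | 1 ≤ m ∧ (m = K ∨ (lanczosSeq W x m).β = 0)}

/-- The tridiagonal matrix with diagonal `α_1, …, α_m` and off-diagonals `β_2, …, β_m`. -/
def lanczosMatrix (W : Matrix ι ι ℝ) (x : Vec ι) (m : ℕ) : Mat m := Matrix.of fun i j =>
  if i = j then (lanczosSeq W x i).alpha W
  else if i.val + 1 = j.val then (lanczosSeq W x j).β
  else if j.val + 1 = i.val then (lanczosSeq W x i).β
  else 0

/-- The largest eigenvalue. -/
def maxEig {m : ℕ} (T : Mat m) : ℝ := sSup (spectrum ℝ T)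

/-- The smallest eigenvalue. -/
def minEig {m : ℕ} (T : Mat m) : ℝ := sInf (spectrum ℝ T)

open Classical in
/-- A unit eigenvector for the eigenvalue `t`. (The tridiagonal matrices above have simple
eigenvalues, so it is determined up to its sign, which never matters below.) -/
def unitEigenvector {m : ℕ} (T : Mat m) (t : ℝ) : Vec (Fin m) :=
  if h : ∃ z : Vec (Fin m), ‖z‖ = 1 ∧ mulV T z = t • z then h.choose else 0

/-- The linear combination `∑ z_k v_k` of the Lanczos vectors. -/
def lanczosCombine (W : Matrix ι ι ℝ) (x : Vec ι) {m : ℕ} (z : Vec (Fin m)) : Vec ι :=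
  ∑ k : Fin m, z k • (lanczosSeq W x k).v

/-- Approximate largest eigenvalue of `W` after (at most) `K` Lanczos steps started at `x`. -/
def lanczosMaxVal (W : Matrix ι ι ℝ) (x : Vec ι) (K : ℕ) : ℝ :=
  maxEig (lanczosMatrix W x (lanczosDim W x K))

/-- Approximate smallest eigenvalue. -/
def lanczosMinVal (W : Matrix ι ι ℝ) (x : Vec ι) (K : ℕ) : ℝ :=
  minEig (lanczosMatrix W x (lanczosDim W x K))

/-- Approximate eigenvector for the largest eigenvalue. -/
def lanczosMaxVec (W : Matrix ι ι ℝ) (x : Vec ι) (K : ℕ) : Vec ι :=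
  lanczosCombine W x
    (unitEigenvector (lanczosMatrix W x (lanczosDim W x K)) (lanczosMaxVal W x K))

/-- Approximate eigenvector for the smallest eigenvalue. -/
def lanczosMinVec (W : Matrix ι ι ℝ) (x : Vec ι) (K : ℕ) : Vec ι :=
  lanczosCombine W x
    (unitEigenvector (lanczosMatrix W x (lanczosDim W x K)) (lanczosMinVal W x K))

/-- The number of Lanczos iterations in dimension `n`, for accuracy `δ` and failure probability
`q`. -/
def lanczosCount (n : ℕ) (δ q : ℝ) : ℕ :=
  ⌈1 / 4 * Real.sqrt (2 * (1 + 1 / δ)) * Real.log (11 * n / q ^ 2) + 1 / 2⌉₊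

/-- The output `(γ, S)` of an oracle, and the number `mv` of its matrix-vector products. -/
structure OracleOutput (d : ℕ) where
  γ : ℝ
  S : Mat d
  mv : ℕ

/-- The extreme eigenvector oracle, with start vector `x`. Each Lanczos iteration uses one
matrix-vector product. -/
def extEvec {d : ℕ} (W : Mat d) (δ q : ℝ) (x : Vec (Fin d)) : OracleOutput d :=
  let Wbar := symPart W
  let K := lanczosCount d δ q
  let hi := lanczosMaxVal Wbar x K
  let lo := lanczosMinVal Wbar x K
  let γ := max hi (-lo)
  { γ := γ
    S := if γ ≤ 1 then 0
      else if -lo ≤ hi then outer (lanczosMaxVec Wbar x K) (lanczosMaxVec Wbar x K)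
      else -outer (lanczosMinVec Wbar x K) (lanczosMinVec Wbar x K)
    mv := K }

/-- The maximal singular vector oracle, with start vector `x`: the Lanczos method is run on the
symmetric matrix with blocks `0, W, Wᵀ, 0`. A product with that matrix is counted as two
matrix-vector products (one with `W`, one with `Wᵀ`). -/
def maxSvec {d : ℕ} (W : Mat d) (δ q : ℝ) (x : Vec (Fin d ⊕ Fin d)) : OracleOutput d :=
  let Wtil : Matrix (Fin d ⊕ Fin d) (Fin d ⊕ Fin d) ℝ := Matrix.fromBlocks 0 W W.transpose 0
  let K := lanczosCount (2 * d) δ q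
  let u := lanczosMaxVec Wtil x K
  let γ := lanczosMaxVal Wtil x K / 3
  { γ := γ
    S := if γ ≤ 1 then 0
      else (2 / 3 : ℝ) • outer (WithLp.toLp 2 (fun i => u (Sum.inl i)))
        (WithLp.toLp 2 (fun i => u (Sum.inr i)))
    mv := 2 * K }

/-! ## The quasi-Newton proximal extragradient method (monotone case, `μ = 0`) -/

/-- A problem, its constants `L₁, L₂`, and the input of the method: the subspace `L` for the
Jacobian approximations, the line search parameters `α₁, α₂, β`, the initial trial step size `σ₀`,
the step size `ρ` of the Jacobian update, the total failure probability `p`, and the initial point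
and matrix `z₀, B₀`. -/
structure Input (d : ℕ) where
  problem : Problem d
  L₁ : ℝ
  L₂ : ℝ
  L : Submodule ℝ (Mat d)
  α₁ : ℝ
  α₂ : ℝ
  β : ℝ
  σ₀ : ℝ
  ρ : ℝ
  p : ℝ
  z₀ : Vec (Fin d)
  B₀ : Mat d

/-- The random start vectors of one round of the Jacobian update: one for each oracle. -/
abbrev Sample (d : ℕ) :=
  Metric.sphere (0 : Vec (Fin d)) 1 × Metric.sphere (0 : Vec (Fin d ⊕ Fin d)) 1

/-- The uniform distribution on the unit sphere. -/
def uniformSphere (ι : Type) [Fintype ι] : Measure (Metric.sphere (0 : Vec ι) 1) :=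
  ((volume : Measure (Vec ι)).toSphere Set.univ)⁻¹ • (volume : Measure (Vec ι)).toSphere

/-- The distribution of the start vectors of one round. -/
def sampleLaw (d : ℕ) : Measure (Sample d) :=
  (uniformSphere (Fin d)).prod (uniformSphere (Fin d ⊕ Fin d))

/-- `δ_t = 1 / (2 (t + 1) ^ (1 / 4))`. -/
def delta (t : ℕ) : ℝ := 1 / (2 * ((t : ℝ) + 1) ^ (1 / 4 : ℝ))

namespace Input

variable {d : ℕ} (I : Input d)

/-- The assumptions on the problem and on the parameters. -/
structure Valid : Prop where
  wellPosed : I.problem.WellPosed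
  contDiff : ContDiff ℝ 1 I.problem.operator
  monotone : ∀ z z', 0 ≤ inner ℝ (I.problem.operator z - I.problem.operator z') (z - z')
  L₁_pos : 0 < I.L₁
  lipschitz : ∀ z z', ‖I.problem.operator z - I.problem.operator z'‖ ≤ I.L₁ * ‖z - z'‖
  jacobian_lipschitz : ∀ z z',
    ‖fderiv ℝ I.problem.operator z - fderiv ℝ I.problem.operator z'‖ ≤ I.L₂ * ‖z - z'‖
  one_mem : (1 : Mat d) ∈ I.L
  structured : I.problem.Structured I.L
  α₁_mem : I.α₁ ∈ Set.Ioo (0 : ℝ) (1 / 2)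
  α₂_mem : I.α₂ ∈ Set.Ioo (0 : ℝ) (1 / 2)
  β_mem : I.β ∈ Set.Ioo (0 : ℝ) 1
  σ₀_ge : I.α₂ * I.β / (5 * I.L₁) ≤ I.σ₀
  ρ_pos : 0 < I.ρ
  p_mem : I.p ∈ Set.Ioo (0 : ℝ) 1
  B₀_mem : I.B₀ ∈ I.problem.feasibleSet I.L I.L₁

/-- `q_t = p / (2.5 (t + 1) log² (t + 1))`. -/
def failureProb (t : ℕ) : ℝ :=
  I.p / (5 / 2 * ((t : ℝ) + 1) * Real.log ((t : ℝ) + 1) ^ 2)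

/-! ### The backtracking line search at `z` with matrix `B` and initial trial step size `σ` -/

/-- The step size of the `i`-th trial, `i = 0, 1, …`. -/
def trialStep (σ : ℝ) (i : ℕ) : ℝ := σ * I.β ^ i

/-- The matrix `I + η B` passed to the linear solver in the `i`-th trial. -/
def trialMatrix (B : Mat d) (σ : ℝ) (i : ℕ) : Mat d := 1 + I.trialStep σ i • B

/-- The right-hand side `- η F z` passed to the linear solver in the `i`-th trial. -/
def trialRhs (z : Vec (Fin d)) (σ : ℝ) (i : ℕ) : Vec (Fin d) :=
  -(I.trialStep σ i • I.problem.operator z)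

/-- The `i`-th trial point. -/
def trialPoint (B : Mat d) (z : Vec (Fin d)) (σ : ℝ) (i : ℕ) : Vec (Fin d) :=
  z + linearSolver (I.trialMatrix B σ i) (I.trialRhs z σ i) I.α₁

/-- The `i`-th trial is accepted. -/
def Accepted (B : Mat d) (z : Vec (Fin d)) (σ : ℝ) (i : ℕ) : Prop :=
  ‖I.trialPoint B z σ i - z + I.trialStep σ i • I.problem.operator (I.trialPoint B z σ i)‖
    ≤ (I.α₁ + I.α₂) * ‖I.trialPoint B z σ i - z‖

/-- The number of rejected trials; `⊤` if the line search does not stop. -/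
def backtracks (B : Mat d) (z : Vec (Fin d)) (σ : ℝ) : ℕ∞ := firstIndex (I.Accepted B z σ)

open Classical in
/-- The number of matrix-vector products of all calls of the linear solver in the line search. -/
def lineSearchCost (B : Mat d) (z : Vec (Fin d)) (σ : ℝ) : ℕ∞ :=
  if I.backtracks B z σ = ⊤ then ⊤
  else ∑ i ∈ Finset.range ((I.backtracks B z σ).toNat + 1),
    solverCost (I.trialMatrix B σ i) (I.trialRhs z σ i) I.α₁

/-! ### The Jacobian approximation update -/

/-- The oracle query for the matrix `W` in round `t ≥ 1`: both oracles, the one with the larger `γ`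
being used, or the eigenvector oracle alone for minimization problems. -/
def separation (t : ℕ) (W : Mat d) (x : Sample d) : OracleOutput d :=
  let e := extEvec (symPart W) (delta t) (I.failureProb t / 2) x.1.val
  let s := maxSvec W (delta t) (I.failureProb t / 2) x.2.val
  match I.problem with
  | Problem.minimization _ => { γ := e.γ, S := frobProj I.L e.S, mv := e.mv }
  | _ =>
    { γ := max e.γ s.γ
      S := frobProj I.L (if s.γ ≤ e.γ then e.S else s.S)
      mv := e.mv + s.mv }

/-- The gradient at `B` of the loss `‖u - B s‖² / ‖s‖²`. -/
def lossGradient (u s : Vec (Fin d)) (B : Mat d) : Mat d :=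
  (-(2 / ‖s‖ ^ 2)) • outer (u - mulV B s) s

/-- The state of the method at the start of an iteration: the iterate `z_k`, the trial step size
`σ_k`, the index `t` of the current round of the Jacobian update, `W_t`, the oracle answer
`γ_t, S_t`, the current Jacobian approximation `B`, and whether the oracles still have to be queried
for round `t` (that is, whether the preceding iteration backtracked). The last three fields count the
operator evaluations, the matrix-vector products of the linear solver, and those of the oracles. -/
structure State (d : ℕ) where
  z : Vec (Fin d)
  σ : ℝ
  t : ℕ
  W : Mat d
  γ : ℝ
  S : Mat d
  B : Mat d
  pending : Bool
  evals : ℕ∞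
  solverMv : ℕ∞
  oracleMv : ℕ

/-- The initial state. In round `0` there is no oracle query: this is encoded by `γ = 0 ≤ 1`. -/
def initState : State d :=
  { z := I.z₀, σ := I.σ₀, t := 0, W := (1 / I.L₁) • (I.B₀ - I.L₁ • (1 : Mat d)), γ := 0, S := 0,
    B := I.B₀, pending := false, evals := 0, solverMv := 0, oracleMv := 0 }

/-- If the preceding iteration backtracked, start the new round: query the oracles and form the new
Jacobian approximation; otherwise keep it. -/
def refresh (ξ : ℕ → Sample d) (st : State d) : State d :=
  if st.pending then
    let o := I.separation st.t st.W (ξ st.t)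
    let Bhat : Mat d := if o.γ ≤ 1 then (1 / (1 + delta st.t)) • st.W
      else (1 / ((1 + delta st.t) * o.γ)) • st.W
    { st with
      γ := o.γ, S := o.S, B := I.L₁ • Bhat + I.L₁ • (1 : Mat d), pending := false,
      oracleMv := st.oracleMv + o.mv }
  else st

/-- One iteration, for a state whose Jacobian approximation is up to date. -/
def iterate (st : State d) : State d :=
  let F := I.problem.operator
  let n := (I.backtracks st.B st.z st.σ).toNat
  let η := I.trialStep st.σ n
  let zhat := I.trialPoint st.B st.z st.σ n
  let st' : State d := { st with
    z := st.z - η • F zhat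
    σ := η / I.β
    evals := st.evals + (1 + (I.backtracks st.B st.z st.σ + 1))
    solverMv := st.solverMv + I.lineSearchCost st.B st.z st.σ }
  if n = 0 then st'
  else
    let ztil := I.trialPoint st.B st.z st.σ (n - 1)
    let G := (1 / I.L₁) • frobProj I.L (lossGradient (F ztil - F st.z) (ztil - st.z) st.B)
    let Gtil := if st.γ ≤ 1 then G else G + max 0 (-(1 / st.γ) * frobInner G st.W) • st.S
    let V := st.W - I.ρ • Gtil
    { st' with
      t := st.t + 1
      W := (Real.sqrt d / max (Real.sqrt d) (frobNorm V)) • V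
      pending := true }

/-- The state after `k` iterations, when `ξ t` are the start vectors drawn in round `t`. -/
def run (ξ : ℕ → Sample d) (k : ℕ) : State d :=
  (fun st => I.iterate (I.refresh ξ st))^[k] I.initState

/-- The step size `η_k`. -/
def stepSize (ξ : ℕ → Sample d) (k : ℕ) : ℝ :=
  let st := I.refresh ξ (I.run ξ k)
  I.trialStep st.σ (I.backtracks st.B st.z st.σ).toNat

/-- The accepted trial point of iteration `k`. -/
def midpoint (ξ : ℕ → Sample d) (k : ℕ) : Vec (Fin d) :=
  let st := I.refresh ξ (I.run ξ k)
  I.trialPoint st.B st.z st.σ (I.backtracks st.B st.z st.σ).toNat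

/-- The averaged iterate after `N` iterations. -/
def average (ξ : ℕ → Sample d) (N : ℕ) : Vec (Fin d) :=
  (∑ k ∈ Finset.range N, I.stepSize ξ k)⁻¹ •
    ∑ k ∈ Finset.range N, I.stepSize ξ k • I.midpoint ξ k

/-- `N` is the minimum number of iterations after which the averaged iterate is `ε`-accurate. -/
def IsComplexity (ξ : ℕ → Sample d) (D : Set (Vec (Fin d))) (ε : ℝ) (N : ℕ) : Prop :=
  IsLeast {N | 1 ≤ N ∧ I.problem.gap D (I.average ξ N) ≤ ε} N

/-- The maximum over `D` of the squared distance to the initial point. -/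
def maxDistSq (D : Set (Vec (Fin d))) : ℝ := sSup ((fun z => ‖I.z₀ - z‖ ^ 2) '' D)

end Input

end

end QNPE

/-! The theorem counts work up to the first accurate average, so no bound on `N` and no regret
estimate for the Jacobian update is needed. What has to be controlled is the size of the matrices
`B`, the number of rejected trials, the cost of a linear solve and the reliability of the oracles.

Randomness enters only through the oracles. Call a query good if `γ` satisfies `|⟨W y, y⟩| ≤ (1 + δ)
max(1, γ) ‖y‖²` and, outside minimization, `‖W y‖ ≤ 3 (1 + δ) max(1, γ) ‖y‖`. A Lanczos run can fail
to give its bound only if its start vector is almost orthogonal to one eigenvector fixed by `W`. For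
a uniform start vector this has small probability (`uniformSphere_lanczos_le`), and a Chebyshev
estimate in the Krylov space does the rest (`exists_krylov_rayleigh_le`). The matrix `W` of round
`t` depends on earlier samples only, so independence and Fubini bound the failure of round `t` by
`q_t`, and the `q_t` sum to at most `p` (`exists_good_event`). Fubini requires the whole run to be
measurable. The only delicate point there is the chosen eigenvector: the rank-one projection built
from it is measurable by the Lusin–Souslin theorem.

On the good event the argument is deterministic. Every `B` in use is admissible: accretive, of norm
at most `4 L₁`, and symmetric for minimization. Hence `A = I + η B` satisfies `⟨A x, x⟩ ≥ ‖x‖²` and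
`‖A‖ ≤ 1 + 4 L₁ η`. Both solvers minimize the residual over a Krylov space (CGLS is the conjugate
residual recurrence for `A Aᵀ`), and Chebyshev-type polynomials give costs of order `κ / α₁`, or
`√(κ / α₁)` for symmetric `A` (`solver_spec`). A trial with `5 L₁ η ≤ α₂` is always accepted, so all
steps are at least `α₂ β / (5 L₁)`.

The accepted steps are hybrid proximal extragradient steps with relative error below one, so the
distances to any `w` telescope and the gap of the average is at most `max ‖z₀ - z‖² / (2 ∑ η)`. Thus
`N` exists, and minimality of `N` bounds the sum of all step sizes but the last by `max ‖z₀ - z‖² /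
(2 ε)` (`exists_isComplexity`).

The counts follow. Since `σ_{k+1} = η_k / β`, the rejections are read off from the exponent of `β`
in `σ_N`. Within a line search the costs form a geometric series dominated by the first trial size
`σ_k = η_{k-1} / β`, so their sum involves only `σ₀` and the steps before the last; for minimization
the square roots are summed by Cauchy–Schwarz. Each iteration makes at most one oracle query, whose
length is of order `N^{1/8} log(d N² / p²)`. -/

namespace QNPE

/-! ## Chebyshev polynomials in the variable `sin²` -/

section SinPoly

open Polynomial

/-- The polynomials `U_m` with `sin ((2 m + 1) φ) = sin φ * U_m (sin² φ)`. -/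
noncomputable def sinPoly : ℕ → ℝ[X]
  | 0 => 1
  | 1 => 3 - 4 * X
  | m + 2 => (2 - 4 * X) * sinPoly (m + 1) - sinPoly m

/-- The recurrence is `sin (a + 2φ) + sin (a - 2φ) = 2 cos (2φ) sin a` with `cos (2φ) = 1 - 2 sin²
φ`. The hyperbolic version below continues the identity to negative arguments, where the polynomials
grow exponentially in `m`. -/
lemma sin_mul_eval_sinPoly (φ : ℝ) (m : ℕ) :
    Real.sin φ * (sinPoly m).eval (Real.sin φ ^ 2) = Real.sin ((2 * m + 1) * φ) := by
  induction m using Nat.twoStepInduction with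
  | zero => simp [sinPoly]
  | one =>
    have : ((2 * (1 : ℕ) + 1 : ℝ)) * φ = 3 * φ := by push_cast; ring
    rw [this, Real.sin_three_mul]
    simp [sinPoly]; ring
  | more m h1 h2 =>
    have e1 : (2 * ((m + 2 : ℕ) : ℝ) + 1) * φ = (2 * ((m + 1 : ℕ) : ℝ) + 1) * φ + 2 * φ := by
      push_cast; ring
    have e2 : (2 * (m : ℝ) + 1) * φ = (2 * ((m + 1 : ℕ) : ℝ) + 1) * φ - 2 * φ := by
      push_cast; ring
    rw [e2, Real.sin_sub] at h1
    rw [e1, Real.sin_add, ← h2]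
    rw [← h2] at h1
    have h3 : Real.cos (2 * φ) = 1 - 2 * Real.sin φ ^ 2 := by
      rw [Real.cos_two_mul, Real.cos_sq']; ring
    simp only [sinPoly, eval_sub, eval_mul, eval_ofNat, eval_X]
    rw [h3] at h1 ⊢
    linear_combination (-1 : ℝ) * h1

lemma sinh_mul_eval_sinPoly (θ : ℝ) (m : ℕ) :
    Real.sinh θ * (sinPoly m).eval (-Real.sinh θ ^ 2) = Real.sinh ((2 * m + 1) * θ) := by
  induction m using Nat.twoStepInduction with
  | zero => simp [sinPoly]
  | one =>
    have : ((2 * (1 : ℕ) + 1 : ℝ)) * θ = 3 * θ := by push_cast; ring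
    rw [this, Real.sinh_three_mul]
    simp [sinPoly]; ring
  | more m h1 h2 =>
    have e1 : (2 * ((m + 2 : ℕ) : ℝ) + 1) * θ = (2 * ((m + 1 : ℕ) : ℝ) + 1) * θ + 2 * θ := by
      push_cast; ring
    have e2 : (2 * (m : ℝ) + 1) * θ = (2 * ((m + 1 : ℕ) : ℝ) + 1) * θ - 2 * θ := by
      push_cast; ring
    rw [e2, Real.sinh_sub] at h1
    rw [e1, Real.sinh_add, ← h2]
    rw [← h2] at h1
    have h3 : Real.cosh (2 * θ) = 1 + 2 * Real.sinh θ ^ 2 := by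
      rw [Real.cosh_two_mul, Real.cosh_sq]; ring
    simp only [sinPoly, eval_sub, eval_mul, eval_ofNat, eval_X]
    rw [h3] at h1 ⊢
    linear_combination (-1 : ℝ) * h1

lemma natDegree_sinPoly_le (m : ℕ) : (sinPoly m).natDegree ≤ m := by
  induction m using Nat.twoStepInduction with
  | zero => simp [sinPoly]
  | one => simp only [sinPoly]; compute_degree
  | more m h1 h2 =>
    simp only [sinPoly]
    have h3 : (2 - 4 * X : ℝ[X]).natDegree ≤ 1 := by compute_degree
    refine (natDegree_sub_le _ _).trans (max_le (natDegree_mul_le.trans ?_) (by omega))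
    omega

lemma eval_zero_sinPoly (m : ℕ) : (sinPoly m).eval 0 = 2 * m + 1 := by
  induction m using Nat.twoStepInduction with
  | zero => simp [sinPoly]
  | one => simp [sinPoly]; norm_num
  | more m h1 h2 =>
    simp only [sinPoly, eval_sub, eval_mul, eval_ofNat, eval_X, h1, h2]
    push_cast; ring

/-- This, with the value `2 m + 1` at zero, makes `sinPoly m` a good residual polynomial: the weight
`t` comes from the right-hand side being `A x`, so no positive lower bound on the spectrum enters
the rates. -/
lemma mul_eval_sinPoly_sq_le {t : ℝ} (h0 : 0 ≤ t) (h1 : t ≤ 1) (m : ℕ) :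
    t * (sinPoly m).eval t ^ 2 ≤ 1 := by
  have hs : Real.sin (Real.arcsin (√t)) = √t :=
    Real.sin_arcsin (by linarith [Real.sqrt_nonneg t]) (Real.sqrt_le_one.mpr h1)
  have := sin_mul_eval_sinPoly (Real.arcsin √t) m
  rw [hs, Real.sq_sqrt h0] at this
  calc t * (sinPoly m).eval t ^ 2 = (√t * (sinPoly m).eval t) ^ 2 := by
        rw [mul_pow, Real.sq_sqrt h0]
    _ ≤ 1 := by rw [this]; exact Real.sin_sq_le_one _

end SinPoly

/-! ## Polynomials of symmetric operators -/

section Spectral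

open Polynomial

variable {E : Type*} [NormedAddCommGroup E] [InnerProductSpace ℝ E] [FiniteDimensional ℝ E]

lemma inner_aeval_eq_sum {T : E →ₗ[ℝ] E} (hT : T.IsSymmetric) (f : ℝ[X]) (x : E) :
    inner ℝ (aeval T f x) x = ∑ i, f.eval (hT.eigenvalues rfl i) *
      inner ℝ (hT.eigenvectorBasis rfl i) x ^ 2 := by
  set e := hT.eigenvectorBasis rfl
  have hx : aeval T f x = ∑ i, (inner ℝ (e i) x * f.eval (hT.eigenvalues rfl i)) • e i := by
    conv_lhs => rw [← e.sum_repr' x]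
    rw [map_sum]
    refine Finset.sum_congr rfl fun i _ => ?_
    rw [map_smul, Module.End.aeval_apply_of_hasEigenvector (hT.hasEigenvector_eigenvectorBasis rfl i),
      smul_smul]
    rfl
  rw [hx, sum_inner]
  refine Finset.sum_congr rfl fun i _ => ?_
  rw [real_inner_smul_left]; ring

/-- A polynomial that is nonnegative on an interval containing the spectrum of a symmetric operator
gives a nonnegative operator. -/
lemma inner_aeval_nonneg {T : E →ₗ[ℝ] E} (hT : T.IsSymmetric) {a b : ℝ}
    (ha : ∀ x, a * ‖x‖ ^ 2 ≤ inner ℝ (T x) x) (hb : ∀ x, inner ℝ (T x) x ≤ b * ‖x‖ ^ 2)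
    {f : ℝ[X]} (hf : ∀ t, a ≤ t → t ≤ b → 0 ≤ f.eval t) (x : E) :
    0 ≤ inner ℝ (aeval T f x) x := by
  rw [inner_aeval_eq_sum hT]
  refine Finset.sum_nonneg fun i _ => mul_nonneg (hf _ ?_ ?_) (sq_nonneg _)
  · have := ha (hT.eigenvectorBasis rfl i)
    rw [hT.apply_eigenvectorBasis, real_inner_smul_left, real_inner_self_eq_norm_sq,
      OrthonormalBasis.norm_eq_one] at this
    simpa using this
  · have := hb (hT.eigenvectorBasis rfl i)
    rw [hT.apply_eigenvectorBasis, real_inner_smul_left, real_inner_self_eq_norm_sq,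
      OrthonormalBasis.norm_eq_one] at this
    simpa using this

lemma inner_aeval_le {T : E →ₗ[ℝ] E} (hT : T.IsSymmetric) {a b M : ℝ}
    (ha : ∀ x, a * ‖x‖ ^ 2 ≤ inner ℝ (T x) x) (hb : ∀ x, inner ℝ (T x) x ≤ b * ‖x‖ ^ 2)
    {f : ℝ[X]} (hf : ∀ t, a ≤ t → t ≤ b → f.eval t ≤ M) (x : E) :
    inner ℝ (aeval T f x) x ≤ M * ‖x‖ ^ 2 := by
  have := inner_aeval_nonneg hT ha hb (f := C M - f) (fun t h1 h2 => by simpa using hf t h1 h2) x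
  rw [map_sub, LinearMap.sub_apply, inner_sub_left, aeval_C, Module.algebraMap_end_apply,
    real_inner_smul_left, real_inner_self_eq_norm_sq] at this
  linarith

omit [FiniteDimensional ℝ E] in
lemma isSymmetric_aeval {T : E →ₗ[ℝ] E} (hT : T.IsSymmetric) (f : ℝ[X]) :
    (aeval T f).IsSymmetric := by
  induction f using Polynomial.induction_on' with
  | add p q hp hq => rw [map_add]; exact hp.add hq
  | monomial n a =>
    intro x y
    have : ∀ n, ((T ^ n : Module.End ℝ E)).IsSymmetric := fun n => hT.pow n
    simp only [aeval_monomial, Module.End.mul_apply, Module.algebraMap_end_apply]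
    rw [real_inner_smul_left, real_inner_smul_right, this n x y]

end Spectral

/-! ## The conjugate residual recurrence -/

section ConjugateResidual

open Polynomial

variable {E : Type*} [NormedAddCommGroup E] [InnerProductSpace ℝ E]

/-- The residuals `r` and the images `q` of the search directions of the conjugate residual method
for a symmetric operator `H`. -/
structure IsConjugateResidual (H : E →ₗ[ℝ] E) (r q : ℕ → E) : Prop where
  init : q 0 = H (r 0)
  residual : ∀ k, r (k + 1) = r k - (inner ℝ (H (r k)) (r k) / ‖q k‖ ^ 2) • q k
  direction : ∀ k, q (k + 1) =
    H (r (k + 1)) + (inner ℝ (H (r (k + 1))) (r (k + 1)) / inner ℝ (H (r k)) (r k)) • q k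

namespace IsConjugateResidual

variable {H : E →ₗ[ℝ] E} {r q : ℕ → E}

lemma residual_eq_zero (h : IsConjugateResidual H r q) {j k : ℕ} (hjk : j ≤ k) (hj : r j = 0) :
    r k = 0 := by
  induction k, hjk using Nat.le_induction with
  | base => exact hj
  | succ k _ ih => rw [h.residual, ih]; simp

variable (hH : H.IsSymmetric) (hpos : ∀ x, x ≠ 0 → 0 < inner ℝ (H x) x)

include hH hpos in
-- All relations must be proved together. The orthogonality of residuals to earlier `q i` gives
-- `H`-orthogonality of the residuals, because `H (r i)` is a combination of `q i` and `q (i - 1)`.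
-- Conversely `q i` is a multiple of `r i - r (i + 1)`, which turns that into orthogonality of the
-- `q i`. Nonzero residuals keep all denominators positive.
lemma orthogonality (h : IsConjugateResidual H r q) (k : ℕ) (hr : ∀ j < k, r j ≠ 0) :
    inner ℝ (r k) (q k) = inner ℝ (H (r k)) (r k) ∧
    (∀ i < k, inner ℝ (q k) (q i) = 0) ∧ (∀ i < k, inner ℝ (r k) (q i) = 0) ∧
    (∀ i < k, inner ℝ (H (r k)) (r i) = 0) := by
  induction k using Nat.strong_induction_on with
  | _ k ih =>
  cases k with
  | zero => simp [h.init, real_inner_comm]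
  | succ k =>
    have hrk : r k ≠ 0 := hr k (by omega)
    have hγ := fun i (hi : i ≤ k) => hpos (r i) (hr i (by omega))
    have IH := fun i (hi : i ≤ k) => ih i (by omega) (fun j hj => hr j (by omega))
    have hq : ∀ i ≤ k, (0 : ℝ) < ‖q i‖ ^ 2 := by
      intro i hi
      have h1 := (IH i hi).1
      have : q i ≠ 0 := by
        intro h0
        rw [h0, inner_zero_right] at h1
        exact (hγ i hi).ne h1
      positivity
    have hα : ∀ i ≤ k, (0 : ℝ) < inner ℝ (H (r i)) (r i) / ‖q i‖ ^ 2 := fun i hi =>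
      div_pos (hγ i hi) (hq i hi)
    obtain ⟨h1, h2, h3, h4⟩ := IH k le_rfl
    have A : ∀ i < k + 1, inner ℝ (r (k + 1)) (q i) = 0 := by
      intro i hi
      rw [h.residual, inner_sub_left, real_inner_smul_left]
      rcases Nat.lt_succ_iff_lt_or_eq.mp hi with hi | rfl
      · rw [h2 i hi, h3 i hi]; simp
      · rw [h1, real_inner_self_eq_norm_sq, div_mul_cancel₀ _ (hq i le_rfl).ne', sub_self]
    have B : ∀ i < k + 1, inner ℝ (H (r (k + 1))) (r i) = 0 := by
      intro i hi
      rw [hH]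
      cases i with
      | zero => rw [← h.init]; exact A 0 hi
      | succ i =>
        have : H (r (i + 1)) = q (i + 1) -
            (inner ℝ (H (r (i + 1))) (r (i + 1)) / inner ℝ (H (r i)) (r i)) • q i := by
          rw [h.direction i]; abel
        rw [this, inner_sub_right, real_inner_smul_right, A _ hi, A i (by omega)]; simp
    refine ⟨?_, ?_, A, B⟩
    · rw [h.direction, inner_add_right, real_inner_smul_right, A k (by omega), real_inner_comm]
      simp
    · intro i hi
      have hqi : q i = (inner ℝ (H (r i)) (r i) / ‖q i‖ ^ 2)⁻¹ • (r i - r (i + 1)) := by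
        rw [h.residual i, sub_sub_cancel, smul_smul, inv_mul_cancel₀ (hα i (by omega)).ne', one_smul]
      rw [h.direction, inner_add_left, real_inner_smul_left]
      rcases Nat.lt_succ_iff_lt_or_eq.mp hi with hi' | rfl
      · rw [h2 i hi', hqi, real_inner_smul_right, inner_sub_right, B i hi, B (i + 1) (by omega)]
        simp
      · conv_lhs => enter [1]; rw [hqi]
        rw [real_inner_smul_right, inner_sub_right, B i hi, real_inner_self_eq_norm_sq]
        have := (hγ i le_rfl).ne'
        have := (hq i le_rfl).ne'
        field_simp
        ring

include hH hpos in
/-- The residuals are minimal over the Krylov space. -/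
lemma norm_residual_le (h : IsConjugateResidual H r q) (k : ℕ) (p : ℝ[X])
    (hp : p.natDegree ≤ k) (hp0 : p.eval 0 = 1) : ‖r k‖ ≤ ‖aeval H p (r 0)‖ := by
  -- A zero residual stays zero, so breakdown makes the claim trivial; otherwise the orthogonality
  -- relations hold up to `k`.
  by_cases hr : ∃ j < k, r j = 0
  · obtain ⟨j, hj, hj0⟩ := hr
    rw [h.residual_eq_zero hj.le hj0]; simp
  push Not at hr
  -- Both `p(H) r 0` and `r k` differ from `r 0` by an element of `Q k`, and `r k` is orthogonal to
  -- `Q k`; the claim is then Pythagoras.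
  let Q : ℕ → Submodule ℝ E := fun k => Submodule.span ℝ (q '' Set.Iio k)
  have hQ : ∀ {i j}, i < j → q i ∈ Q j := fun hij => Submodule.subset_span ⟨_, hij, rfl⟩
  have hQm : ∀ {i j}, i ≤ j → Q i ≤ Q j := fun hij =>
    Submodule.span_mono (Set.image_mono (Set.Iio_subset_Iio hij))
  have hHr : ∀ i, H (r i) ∈ Q (i + 1) := by
    intro i
    cases i with
    | zero => rw [← h.init]; exact hQ one_pos
    | succ i =>
      have : H (r (i + 1)) = q (i + 1) -
          (inner ℝ (H (r (i + 1))) (r (i + 1)) / inner ℝ (H (r i)) (r i)) • q i := by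
        rw [h.direction i]; abel
      rw [this]
      exact Submodule.sub_mem _ (hQ (by omega)) (Submodule.smul_mem _ _ (hQ (by omega)))
  have hHQ : ∀ j < k, ∀ v ∈ Q j, H v ∈ Q (j + 1) := by
    intro j hj v hv
    have : Q j ≤ (Q (j + 1)).comap H := by
      refine Submodule.span_le.mpr ?_
      rintro _ ⟨i, hi, rfl⟩
      have hi : i < j := hi
      obtain ⟨h1, -⟩ := h.orthogonality hH hpos i (fun l hl => hr l (by omega))
      have hγ := hpos (r i) (hr i (by omega))
      have hqi : q i ≠ 0 := by
        intro h0
        rw [h0, inner_zero_right] at h1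
        exact hγ.ne h1
      have hα : inner ℝ (H (r i)) (r i) / ‖q i‖ ^ 2 ≠ 0 := by positivity
      have e : q i = (inner ℝ (H (r i)) (r i) / ‖q i‖ ^ 2)⁻¹ • (r i - r (i + 1)) := by
        rw [h.residual i, sub_sub_cancel, smul_smul, inv_mul_cancel₀ hα, one_smul]
      change H (q i) ∈ Q (j + 1)
      rw [e, map_smul, map_sub]
      exact Submodule.smul_mem _ _ (Submodule.sub_mem _ (hQm (by omega) (hHr i))
        (hQm (by omega) (hHr (i + 1))))
    exact this hv
  have hpow : ∀ j, 1 ≤ j → j ≤ k → (H ^ j) (r 0) ∈ Q j := by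
    intro j hj
    induction j, hj using Nat.le_induction with
    | base => intro _; rw [pow_one, ← h.init]; exact hQ one_pos
    | succ j hj ih =>
      intro hjk
      rw [pow_succ', Module.End.mul_apply]
      exact hHQ j (by omega) _ (ih (by omega))
  -- The normalization `p 0 = 1` cancels `r 0` and leaves powers `H ^ i` with `1 ≤ i ≤ k`.
  have hpoly : aeval H p (r 0) - r 0 ∈ Q k := by
    rw [aeval_eq_sum_range' (Nat.lt_succ_of_le hp), Finset.sum_range_succ', LinearMap.add_apply,
      LinearMap.sum_apply]
    rw [← coeff_zero_eq_eval_zero] at hp0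
    rw [hp0]
    simp only [pow_zero, one_smul, Module.End.one_apply, add_sub_cancel_right]
    refine Submodule.sum_mem _ fun i hi => ?_
    rw [LinearMap.smul_apply]
    have := Finset.mem_range.mp hi
    exact Submodule.smul_mem _ _ (hQm (by omega) (hpow (i + 1) (by omega) (by omega)))
  have hrk : ∀ j, r 0 - r j ∈ Q j := by
    intro j
    induction j with
    | zero => simp
    | succ j ih =>
      rw [h.residual j, ← sub_add]
      exact Submodule.add_mem _ (hQm (by omega) ih) (Submodule.smul_mem _ _ (hQ (by omega)))
  have hdiff : aeval H p (r 0) - r k ∈ Q k := by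
    have := Submodule.add_mem _ hpoly (hrk k)
    simpa using this
  have horth : ∀ v ∈ Q k, inner ℝ (r k) v = 0 := by
    intro v hv
    have : Q k ≤ LinearMap.ker (innerₛₗ ℝ (r k)) := by
      refine Submodule.span_le.mpr ?_
      rintro _ ⟨i, hi, rfl⟩
      exact (h.orthogonality hH hpos k hr).2.2.1 i hi
    exact this hv
  have e : aeval H p (r 0) = r k + (aeval H p (r 0) - r k) := by abel
  have h2 : ‖aeval H p (r 0)‖ ^ 2 = ‖r k‖ ^ 2 + ‖aeval H p (r 0) - r k‖ ^ 2 := by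
    conv_lhs => rw [e]
    rw [norm_add_sq_real, horth _ hdiff]; ring
  refine le_of_sq_le_sq ?_ (norm_nonneg _)
  rw [h2]
  nlinarith [sq_nonneg ‖aeval H p (r 0) - r k‖]

end IsConjugateResidual

end ConjugateResidual


/-! ## First indices -/

lemma exists_firstIndex_eq {P : ℕ → Prop} {k : ℕ} (hk : P k) :
    ∃ n : ℕ, firstIndex P = n ∧ P n ∧ n ≤ k ∧ ∀ j < n, ¬ P j := by
  classical
  have hex : ∃ k, P k := ⟨k, hk⟩
  refine ⟨Nat.find hex, ?_, Nat.find_spec hex, Nat.find_min' hex hk, fun j hj => Nat.find_min hex hj⟩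
  refine le_antisymm (iInf₂_le _ (Nat.find_spec hex)) (le_iInf₂ fun j hj => ?_)
  exact_mod_cast Nat.find_min' hex hj

/-! ## Matrices as operators -/

section Operators

variable {ι : Type} [Fintype ι] [DecidableEq ι]

/-- The linear map `v ↦ A v`. -/
noncomputable def mulL (A : Matrix ι ι ℝ) : Vec ι →ₗ[ℝ] Vec ι where
  toFun := mulV A
  map_add' x y := by simp [mulV, Matrix.mulVec_add]
  map_smul' c x := by simp [mulV, Matrix.mulVec_smul]

omit [DecidableEq ι] in
@[simp] lemma mulL_apply (A : Matrix ι ι ℝ) (v : Vec ι) : mulL A v = mulV A v := rfl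

omit [DecidableEq ι] in
lemma inner_eq_dotProduct (x y : Vec ι) : inner ℝ x y = x.ofLp ⬝ᵥ y.ofLp := by
  simp only [PiLp.inner_apply, dotProduct]
  exact Finset.sum_congr rfl fun i _ => by simp [mul_comm]

omit [DecidableEq ι] in
lemma inner_mulV_left (A : Matrix ι ι ℝ) (x y : Vec ι) :
    inner ℝ (mulV A x) y = inner ℝ x (mulV A.transpose y) := by
  rw [inner_eq_dotProduct, inner_eq_dotProduct]
  simp only [mulV]
  rw [Matrix.mulVec_transpose, dotProduct_comm, Matrix.dotProduct_mulVec, dotProduct_comm]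

omit [DecidableEq ι] in
lemma mulL_isSymmetric {A : Matrix ι ι ℝ} (hA : A.IsSymm) : (mulL A).IsSymmetric := fun x y => by
  rw [mulL_apply, mulL_apply, inner_mulV_left, hA.eq]

lemma mulV_one (v : Vec ι) : mulV 1 v = v := by simp [mulV]

omit [DecidableEq ι] in
lemma mulV_add (A B : Matrix ι ι ℝ) (v : Vec ι) : mulV (A + B) v = mulV A v + mulV B v := by
  simp [mulV, Matrix.add_mulVec]

omit [DecidableEq ι] in
lemma mulV_sub (A B : Matrix ι ι ℝ) (v : Vec ι) : mulV (A - B) v = mulV A v - mulV B v := by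
  simp [mulV, Matrix.sub_mulVec]

omit [DecidableEq ι] in
lemma mulV_smul (c : ℝ) (A : Matrix ι ι ℝ) (v : Vec ι) : mulV (c • A) v = c • mulV A v := by
  simp [mulV, Matrix.smul_mulVec]

omit [DecidableEq ι] in
lemma mulV_mul (A B : Matrix ι ι ℝ) (v : Vec ι) : mulV (A * B) v = mulV A (mulV B v) := by
  simp [mulV, Matrix.mulVec_mulVec]

lemma norm_mulV_le (A : Matrix ι ι ℝ) (v : Vec ι) : ‖mulV A v‖ ≤ opNorm A * ‖v‖ := by
  exact (Matrix.toEuclideanCLM (𝕜 := ℝ) A).le_opNorm v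

omit [DecidableEq ι] in
lemma inner_mulV_symPart (A : Matrix ι ι ℝ) (x : Vec ι) :
    inner ℝ (mulV (symPart A) x) x = inner ℝ (mulV A x) x := by
  rw [symPart, mulV_smul, mulV_add, real_inner_smul_left, inner_add_left,
    inner_mulV_left A.transpose, Matrix.transpose_transpose, real_inner_comm (mulV A x) x]
  ring

omit [DecidableEq ι] in
lemma posSemidef_inner_nonneg {A : Matrix ι ι ℝ} (hA : A.PosSemidef) (x : Vec ι) :
    0 ≤ inner ℝ (mulV A x) x := by
  have := hA.dotProduct_mulVec_nonneg x.ofLp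
  rw [inner_eq_dotProduct, dotProduct_comm]
  simpa [mulV] using this

end Operators

/-! ## The linear solver -/

section Solver

variable {d : ℕ}

lemma crStep_iterate (A : Mat d) (b : Vec (Fin d)) (k : ℕ) :
    (crStep A)^[k + 1] (crInit A b) = crStep A ((crStep A)^[k] (crInit A b)) :=
  Function.iterate_succ_apply' _ _ _

lemma cglsStep_iterate (A : Mat d) (b : Vec (Fin d)) (k : ℕ) :
    (cglsStep A)^[k + 1] (cglsInit A b) = cglsStep A ((cglsStep A)^[k] (cglsInit A b)) :=
  Function.iterate_succ_apply' _ _ _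

lemma cr_invariants {A : Mat d} (hA : A.IsSymm) (b : Vec (Fin d)) (k : ℕ) :
    let st := (crStep A)^[k] (crInit A b)
    st.r = b - mulV A st.s ∧ st.q = mulV A st.p ∧ st.γ = inner ℝ (mulV A st.r) st.r ∧
      st.mv = 1 + k := by
  induction k with
  | zero => simp [crInit, hA.eq, ← mulL_apply]
  | succ k ih =>
    obtain ⟨h1, h2, h3, h4⟩ := ih
    simp only [crStep_iterate]
    set st := (crStep A)^[k] (crInit A b)
    refine ⟨?_, ?_, ?_, ?_⟩
    · simp only [crStep]
      rw [h1, h2, ← mulL_apply, ← mulL_apply, ← mulL_apply, map_add, map_smul]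
      abel
    · simp only [crStep]
      rw [h2, ← mulL_apply, ← mulL_apply, ← mulL_apply, map_add, map_smul]
    · simp only [crStep]
    · simp only [crStep]; omega

lemma cgls_invariants (A : Mat d) (b : Vec (Fin d)) (k : ℕ) :
    let st := (cglsStep A)^[k] (cglsInit A b)
    st.r = b - mulV A st.s ∧ st.γ = ‖mulV A.transpose st.r‖ ^ 2 ∧ st.mv = 1 + 2 * k := by
  induction k with
  | zero => simp [cglsInit, ← mulL_apply]
  | succ k ih =>
    obtain ⟨h1, h2, h3⟩ := ih
    simp only [cglsStep_iterate]
    set st := (cglsStep A)^[k] (cglsInit A b)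
    refine ⟨?_, ?_, ?_⟩
    · simp only [cglsStep]
      rw [h1, ← mulL_apply, ← mulL_apply, ← mulL_apply, map_add, map_smul]
      abel
    · simp only [cglsStep]
    · simp only [cglsStep]; omega

lemma cr_isConjugateResidual {A : Mat d} (hA : A.IsSymm) (b : Vec (Fin d)) :
    IsConjugateResidual (mulL A) (fun k => ((crStep A)^[k] (crInit A b)).r)
      (fun k => ((crStep A)^[k] (crInit A b)).q) where
  init := by simp [crInit, hA.eq]
  residual k := by
    obtain ⟨-, -, h3, -⟩ := cr_invariants hA b k
    simp only [crStep_iterate, mulL_apply, ← h3]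
    simp only [crStep]
  direction k := by
    obtain ⟨-, -, h3, -⟩ := cr_invariants hA b k
    simp only [crStep_iterate, mulL_apply, ← h3]
    simp only [crStep]

lemma inner_gram (A : Mat d) (x : Vec (Fin d)) :
    inner ℝ (mulV (A * A.transpose) x) x = ‖mulV A.transpose x‖ ^ 2 := by
  rw [mulV_mul, inner_mulV_left, real_inner_self_eq_norm_sq]

/-- With `q = A p` in place of the direction `p`, the CGLS coefficients become those for `H = A Aᵀ`,
since `⟨H r, r⟩ = ‖Aᵀ r‖²`. One minimality lemma then covers both solvers. -/
lemma cgls_isConjugateResidual (A : Mat d) (b : Vec (Fin d)) :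
    IsConjugateResidual (mulL (A * A.transpose)) (fun k => ((cglsStep A)^[k] (cglsInit A b)).r)
      (fun k => mulV A ((cglsStep A)^[k] (cglsInit A b)).p) where
  init := by simp [cglsInit, mulV_mul]
  residual k := by
    obtain ⟨-, h3, -⟩ := cgls_invariants A b k
    simp only [cglsStep_iterate, mulL_apply, inner_gram, ← h3]
    simp only [cglsStep]
  direction k := by
    obtain ⟨-, h3, -⟩ := cgls_invariants A b k
    obtain ⟨-, h4, -⟩ := cgls_invariants A b (k + 1)
    simp only [mulL_apply, inner_gram, ← h3, ← h4]
    simp only [cglsStep_iterate, cglsStep, mulV_mul]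
    rw [← mulL_apply A, map_add, map_smul]
    rfl

variable {A : Mat d} {κ : ℝ}

lemma norm_le_norm_mulV (hlow : ∀ x, ‖x‖ ^ 2 ≤ inner ℝ (mulV A x) x) (x : Vec (Fin d)) :
    ‖x‖ ≤ ‖mulV A x‖ := by
  by_contra! hlt
  have h1 := hlow x
  have h2 := real_inner_le_norm (mulV A x) x
  have : 0 < ‖x‖ := (norm_nonneg _).trans_lt hlt
  nlinarith

lemma exists_mulV_eq (hlow : ∀ x, ‖x‖ ^ 2 ≤ inner ℝ (mulV A x) x) (b : Vec (Fin d)) :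
    ∃ s, mulV A s = b := by
  have hinj : Function.Injective (mulL A) := by
    rw [← LinearMap.ker_eq_bot, LinearMap.ker_eq_bot']
    intro x hx
    have := norm_le_norm_mulV hlow x
    rw [← mulL_apply, hx, norm_zero] at this
    exact norm_le_zero_iff.mp this
  exact (LinearMap.injective_iff_surjective.mp hinj) b

lemma norm_sq_aeval {H : Vec (Fin d) →ₗ[ℝ] Vec (Fin d)} (hH : H.IsSymmetric) (p : Polynomial ℝ)
    (x : Vec (Fin d)) :
    ‖Polynomial.aeval H p x‖ ^ 2 = inner ℝ (Polynomial.aeval H (p ^ 2) x) x := by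
  rw [← real_inner_self_eq_norm_sq, ← isSymmetric_aeval hH, ← Module.End.mul_apply, ← map_mul, sq]

open Polynomial in
-- The test polynomial is `(sinPoly m (t / κ) / (2 m + 1))²`, of degree `2 m`. The initial residual
-- `A x` contributes a factor `t`, and `t * sinPoly m (t / κ)² ≤ κ` on `[0, κ]`.
lemma cr_rate (hA : A.IsSymm) (hlow : ∀ x, ‖x‖ ^ 2 ≤ inner ℝ (mulV A x) x)
    (hup : ∀ x, ‖mulV A x‖ ≤ κ * ‖x‖) (hκ : 0 < κ) (x : Vec (Fin d)) (m : ℕ) :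
    ‖((crStep A)^[2 * m] (crInit A (mulV A x))).r‖ ≤ κ / (2 * m + 1) ^ 2 * ‖x‖ := by
  have hsymm := mulL_isSymmetric hA
  have hm : (0 : ℝ) < 2 * m + 1 := by positivity
  have hpos : ∀ x, x ≠ 0 → 0 < inner ℝ (mulL A x) x := fun x hx =>
    lt_of_lt_of_le (by positivity) (hlow x)
  let u : ℝ[X] := (sinPoly m).comp (C κ⁻¹ * X)
  let p : ℝ[X] := C ((2 * m + 1 : ℝ) ^ 2)⁻¹ * u ^ 2
  have hu : u.natDegree ≤ m := by
    refine natDegree_comp_le.trans ?_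
    have h1 := natDegree_sinPoly_le m
    have h2 : (C κ⁻¹ * X : ℝ[X]).natDegree ≤ 1 := by compute_degree
    nlinarith
  have hpd : p.natDegree ≤ 2 * m :=
    (natDegree_C_mul_le _ _).trans (natDegree_pow_le.trans (by omega))
  have hp0 : p.eval 0 = 1 := by
    simp only [p, u, eval_mul, eval_C, eval_pow, eval_comp, eval_X, mul_zero, eval_zero_sinPoly]
    field_simp
  have h := (cr_isConjugateResidual hA (mulV A x)).norm_residual_le hsymm hpos (2 * m) p hpd hp0
  refine h.trans ?_
  have e : aeval (mulL A) p ((crStep A)^[0] (crInit A (mulV A x))).r = aeval (mulL A) (p * X) x := by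
    simp [crInit]
  simp only [e]
  refine abs_le_of_sq_le_sq' ?_ (by positivity) |>.2
  rw [norm_sq_aeval hsymm, mul_pow _ ‖x‖]
  refine inner_aeval_le (a := 0) (b := κ) hsymm (fun x => ?_) (fun x => ?_) (fun t h0 h1 => ?_) x
  · rw [zero_mul]; exact (sq_nonneg _).trans (hlow x)
  · have h1 := real_inner_le_norm (mulV A x) x
    have h2 := mul_le_mul_of_nonneg_right (hup x) (norm_nonneg x)
    simp only [mulL_apply]
    nlinarith
  · have h3 := mul_eval_sinPoly_sq_le (t := κ⁻¹ * t) (by positivity)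
      (by rw [inv_mul_le_iff₀ hκ]; linarith) m
    simp only [p, u, eval_pow, eval_mul, eval_C, eval_comp, eval_X]
    set w := eval (κ⁻¹ * t) (sinPoly m)
    have h4 : 0 ≤ t * w ^ 2 := by positivity
    have h5 : t * w ^ 2 ≤ κ := by
      rw [mul_assoc, inv_mul_le_iff₀ hκ] at h3; linarith
    have : (((2 * m + 1 : ℝ) ^ 2)⁻¹ * w ^ 2 * t) = (t * w ^ 2) / (2 * m + 1) ^ 2 := by
      field_simp
    rw [this]
    gcongr

open Polynomial in
-- Here the spectrum of `A Aᵀ` lies in `[0, κ²]`. The residual `A x` contributes only the square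
-- root of the spectral variable, so the polynomial is used to the first power and the rate is `1 /
-- (2 m + 1)` instead of its square.
lemma cgls_rate (hlow : ∀ x, ‖x‖ ^ 2 ≤ inner ℝ (mulV A x) x)
    (hup : ∀ x, ‖mulV A x‖ ≤ κ * ‖x‖) (hκ : 0 < κ) (x : Vec (Fin d)) (m : ℕ) :
    ‖((cglsStep A)^[m] (cglsInit A (mulV A x))).r‖ ≤ κ / (2 * m + 1) * ‖x‖ := by
  have hsymm : (mulL (A * A.transpose)).IsSymmetric :=
    mulL_isSymmetric (Matrix.isSymm_mul_transpose_self A)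
  have hsymm' : (mulL (A.transpose * A)).IsSymmetric :=
    mulL_isSymmetric (Matrix.isSymm_transpose_mul_self A)
  have hm : (0 : ℝ) < 2 * m + 1 := by positivity
  have hlow' : ∀ x, ‖x‖ ^ 2 ≤ inner ℝ (mulV A.transpose x) x := fun x => by
    rw [inner_mulV_left, Matrix.transpose_transpose, real_inner_comm]; exact hlow x
  have hpos : ∀ x, x ≠ 0 → 0 < inner ℝ (mulL (A * A.transpose) x) x := fun x hx => by
    rw [mulL_apply, inner_gram]
    have := norm_le_norm_mulV hlow' x
    have : 0 < ‖x‖ := norm_pos_iff.mpr hx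
    have : 0 < ‖mulV A.transpose x‖ := by linarith
    positivity
  let u : ℝ[X] := (sinPoly m).comp (C (κ ^ 2)⁻¹ * X)
  let p : ℝ[X] := C (2 * m + 1 : ℝ)⁻¹ * u
  have hu : u.natDegree ≤ m := by
    refine natDegree_comp_le.trans ?_
    have h1 := natDegree_sinPoly_le m
    have h2 : (C (κ ^ 2)⁻¹ * X : ℝ[X]).natDegree ≤ 1 := by compute_degree
    nlinarith
  have hpd : p.natDegree ≤ m := (natDegree_C_mul_le _ _).trans hu
  have hp0 : p.eval 0 = 1 := by
    simp only [p, u, eval_mul, eval_C, eval_comp, eval_X, mul_zero, eval_zero_sinPoly]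
    field_simp
  have h := (cgls_isConjugateResidual A (mulV A x)).norm_residual_le hsymm hpos m p hpd hp0
  refine h.trans ?_
  -- The intertwining `f(A Aᵀ) A = A f(Aᵀ A)` lets the polynomial act on `x` itself, where the
  -- factor `Aᵀ A` becomes available.
  have hcomm : ∀ (f : ℝ[X]) (y : Vec (Fin d)), aeval (mulL (A * A.transpose)) f (mulV A y) =
      mulV A (aeval (mulL (A.transpose * A)) f y) := by
    intro f y
    induction f using Polynomial.induction_on' with
    | add p q hp hq =>
      rw [map_add, map_add, LinearMap.add_apply, LinearMap.add_apply, hp, hq, ← mulL_apply A,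
        ← mulL_apply A, ← mulL_apply A, map_add]
    | monomial n a =>
      rw [aeval_monomial, aeval_monomial, Module.End.mul_apply, Module.End.mul_apply,
        Module.algebraMap_end_apply, Module.algebraMap_end_apply, ← mulL_apply A, ← mulL_apply A,
        map_smul]
      congr 1
      induction n with
      | zero => simp
      | succ n ih => rw [pow_succ', pow_succ', Module.End.mul_apply, ih]; simp [mulV_mul]
  have e : aeval (mulL (A * A.transpose)) p ((cglsStep A)^[0] (cglsInit A (mulV A x))).r =
      mulV A (aeval (mulL (A.transpose * A)) p x) := by
    rw [← hcomm]; simp [cglsInit]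
  simp only [e]
  refine abs_le_of_sq_le_sq' ?_ (by positivity) |>.2
  have e2 : ‖mulV A (aeval (mulL (A.transpose * A)) p x)‖ ^ 2 =
      inner ℝ (aeval (mulL (A.transpose * A)) (p ^ 2 * X) x) x := by
    have h1 := inner_gram A.transpose (aeval (mulL (A.transpose * A)) p x)
    rw [Matrix.transpose_transpose] at h1
    rw [← h1, ← mulL_apply, ← isSymmetric_aeval hsymm' p]
    congr 1
    rw [show p ^ 2 * X = p * (X * p) by ring, map_mul _ p (X * p), map_mul _ X p, aeval_X]
    rfl
  rw [e2, mul_pow _ ‖x‖]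
  refine inner_aeval_le (a := 0) (b := κ ^ 2) hsymm' (fun x => ?_) (fun x => ?_)
    (fun t h0 h1 => ?_) x
  · have h1 := inner_gram A.transpose x
    rw [Matrix.transpose_transpose] at h1
    rw [mulL_apply, h1]; simp
  · have h1 := inner_gram A.transpose x
    rw [Matrix.transpose_transpose] at h1
    rw [mulL_apply, h1, ← mul_pow]
    exact pow_le_pow_left₀ (norm_nonneg _) (hup x) 2
  · have h3 := mul_eval_sinPoly_sq_le (t := (κ ^ 2)⁻¹ * t) (by positivity)
      (by rw [inv_mul_le_iff₀ (by positivity)]; linarith) m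
    simp only [p, u, eval_pow, eval_mul, eval_C, eval_comp, eval_X]
    set w := eval ((κ ^ 2)⁻¹ * t) (sinPoly m)
    have h5 : t * w ^ 2 ≤ κ ^ 2 := by
      rw [mul_assoc, inv_mul_le_iff₀ (by positivity)] at h3; linarith
    have : ((2 * m + 1 : ℝ)⁻¹ * w) ^ 2 * t = (t * w ^ 2) / (2 * m + 1) ^ 2 := by
      field_simp
    rw [this, div_pow]
    gcongr

/-- The rates are relative to the solution `x`, the stopping test to the iterate `s`. Accretivity
gives `‖x - s‖` at most the residual, hence `‖s‖ ≥ ‖x‖ / 2`. -/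
lemma norm_residual_le_of_le (hlow : ∀ x, ‖x‖ ^ 2 ≤ inner ℝ (mulV A x) x) {α : ℝ} (h0 : 0 < α)
    (h1 : α < 1 / 2) {x s : Vec (Fin d)} (h : ‖mulV A x - mulV A s‖ ≤ α / 2 * ‖x‖) :
    ‖mulV A x - mulV A s‖ ≤ α * ‖s‖ := by
  have h2 := norm_le_norm_mulV hlow (x - s)
  rw [← mulL_apply, map_sub, mulL_apply, mulL_apply] at h2
  have h3 := norm_sub_norm_le x s
  have h4 := norm_nonneg x
  have h5 : ‖x‖ / 2 ≤ ‖s‖ := by nlinarith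
  nlinarith

/-- The linear solver stops with the required accuracy. Its cost is at most of the order of the
condition number, and of the order of the root of the condition number for symmetric matrices. -/
theorem solver_spec (hlow : ∀ x, ‖x‖ ^ 2 ≤ inner ℝ (mulV A x) x)
    (hup : ∀ x, ‖mulV A x‖ ≤ κ * ‖x‖) (hκ : 1 ≤ κ) {α : ℝ} (h0 : 0 < α) (h1 : α < 1 / 2)
    (b : Vec (Fin d)) :
    ‖b - mulV A (linearSolver A b α)‖ ≤ α * ‖linearSolver A b α‖ ∧
      ∃ K : ℕ, solverCost A b α = K ∧ (K : ℝ) ≤ 3 + 2 * (κ / α) ∧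
        (A.IsSymm → (K : ℝ) ≤ 3 + 2 * √(κ / α)) := by
  obtain ⟨x, rfl⟩ := exists_mulV_eq hlow b
  have hκ0 : 0 < κ := by linarith
  have hκα : 1 ≤ κ / α := by rw [le_div_iff₀ h0]; linarith
  have hinv : ∀ k, (solverState A (mulV A x) k).r =
      mulV A x - mulV A (solverState A (mulV A x) k).s := by
    intro k
    unfold solverState
    split_ifs with hA
    · exact (cr_invariants hA _ k).1
    · exact (cgls_invariants A _ k).1
  -- The cost is bounded for all `j ≤ k` since the solver may stop before `k`.
  suffices ∃ k, ‖(solverState A (mulV A x) k).r‖ ≤ α / 2 * ‖x‖ ∧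
      ∀ j ≤ k, ((solverState A (mulV A x) j).mv : ℝ) ≤ 3 + 2 * (κ / α) ∧
        (A.IsSymm → ((solverState A (mulV A x) j).mv : ℝ) ≤ 3 + 2 * √(κ / α)) by
    obtain ⟨k, hk, hcost⟩ := this
    have hk' : ‖(solverState A (mulV A x) k).r‖ ≤ α * ‖(solverState A (mulV A x) k).s‖ := by
      rw [hinv] at hk ⊢
      exact norm_residual_le_of_le hlow h0 h1 hk
    obtain ⟨n, hn, hPn, hnk, -⟩ := exists_firstIndex_eq
      (P := fun k => ‖(solverState A (mulV A x) k).r‖ ≤ α * ‖(solverState A (mulV A x) k).s‖) hk'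
    have hsolve : solverStop A (mulV A x) α = n := hn
    refine ⟨?_, (solverState A (mulV A x) n).mv, ?_, hcost n hnk⟩
    · rw [linearSolver, hsolve, ENat.toNat_natCast, ← hinv]
      exact hPn
    · rw [solverCost, hsolve]; simp
  by_cases hA : A.IsSymm
  · have hs : ∀ k, solverState A (mulV A x) k = (crStep A)^[k] (crInit A (mulV A x)) := fun k => by
      rw [solverState, if_pos hA]
    -- With this `m`, `2 m` iterations reach `κ / (2 m + 1)² ≤ α / 2` and cost `1 + 2 m` products.
    let m := ⌈√(κ / α)⌉₊
    have hm : √(κ / α) ≤ m := Nat.le_ceil _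
    have hm' : (m : ℝ) < √(κ / α) + 1 := Nat.ceil_lt_add_one (Real.sqrt_nonneg _)
    refine ⟨2 * m, ?_, fun j hj => ?_⟩
    · rw [hs]
      refine (cr_rate hA hlow hup hκ0 x m).trans ?_
      refine mul_le_mul_of_nonneg_right ?_ (norm_nonneg _)
      rw [div_le_div_iff₀ (by positivity) two_pos]
      have h2 : κ / α ≤ (m : ℝ) ^ 2 := by
        rw [← Real.sq_sqrt (by positivity : 0 ≤ κ / α)]
        exact pow_le_pow_left₀ (Real.sqrt_nonneg _) hm 2
      rw [div_le_iff₀ h0] at h2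
      nlinarith [(Nat.cast_nonneg m : (0 : ℝ) ≤ m)]
    · have h3 : ((solverState A (mulV A x) j).mv : ℝ) ≤ 3 + 2 * √(κ / α) := by
        rw [hs, (cr_invariants hA _ j).2.2.2]
        have : (j : ℝ) ≤ 2 * m := by exact_mod_cast hj
        push_cast; linarith
      refine ⟨h3.trans ?_, fun _ => h3⟩
      have : √(κ / α) ≤ κ / α := Real.sqrt_le_iff.mpr ⟨by positivity, by nlinarith⟩
      linarith
  · have hs : ∀ k, solverState A (mulV A x) k = (cglsStep A)^[k] (cglsInit A (mulV A x)) :=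
      fun k => by rw [solverState, if_neg hA]
    -- Here `m` iterations reach `κ / (2 m + 1) ≤ α / 2`, again for `1 + 2 m` products, two per
    -- iteration.
    let m := ⌈κ / α⌉₊
    have hm : κ / α ≤ m := Nat.le_ceil _
    have hm' : (m : ℝ) < κ / α + 1 := Nat.ceil_lt_add_one (by positivity)
    refine ⟨m, ?_, fun j hj => ⟨?_, fun h => absurd h hA⟩⟩
    · rw [hs]
      refine (cgls_rate hlow hup hκ0 x m).trans ?_
      refine mul_le_mul_of_nonneg_right ?_ (norm_nonneg _)
      rw [div_le_div_iff₀ (by positivity) two_pos]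
      rw [div_le_iff₀ h0] at hm
      nlinarith
    · rw [hs, (cgls_invariants A _ j).2.2]
      have : (j : ℝ) ≤ m := by exact_mod_cast hj
      push_cast; linarith

end Solver


/-! ## Extreme eigenvalues -/

section ExtremeEigenvalues

variable {m : ℕ} {T : Mat m}

lemma inner_mulV_eq_sum (hT : T.IsHermitian) (z : Vec (Fin m)) :
    inner ℝ (mulV T z) z = ∑ i, hT.eigenvalues i * inner ℝ (hT.eigenvectorBasis i) z ^ 2 := by
  set e := hT.eigenvectorBasis
  have hz : mulV T z = ∑ i, (inner ℝ (e i) z * hT.eigenvalues i) • e i := by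
    conv_lhs => rw [← e.sum_repr' z]
    rw [← mulL_apply, map_sum]
    refine Finset.sum_congr rfl fun i _ => ?_
    rw [map_smul, mulL_apply, mul_smul]
    congr 1
    exact congrArg (WithLp.toLp 2) (hT.mulVec_eigenvectorBasis i)
  rw [hz, sum_inner]
  refine Finset.sum_congr rfl fun i _ => ?_
  rw [real_inner_smul_left]; ring

lemma finite_spectrum (T : Mat m) : (spectrum ℝ T).Finite := T.finite_real_spectrum

lemma eigenvalues_mem (hT : T.IsHermitian) (i : Fin m) : hT.eigenvalues i ∈ spectrum ℝ T := by
  rw [hT.spectrum_real_eq_range_eigenvalues]; exact Set.mem_range_self i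

lemma spectrum_nonempty (hm : 0 < m) (hT : T.IsHermitian) : (spectrum ℝ T).Nonempty :=
  ⟨_, eigenvalues_mem hT ⟨0, hm⟩⟩

lemma sum_inner_eigenvectorBasis_sq (hT : T.IsHermitian) (z : Vec (Fin m)) :
    ∑ i, inner ℝ (hT.eigenvectorBasis i) z ^ 2 = ‖z‖ ^ 2 := by
  have := hT.eigenvectorBasis.sum_sq_norm_inner_right z
  simpa using this

lemma inner_mulV_le_maxEig (hT : T.IsHermitian) (z : Vec (Fin m)) :
    inner ℝ (mulV T z) z ≤ maxEig T * ‖z‖ ^ 2 := by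
  rw [inner_mulV_eq_sum hT, ← sum_inner_eigenvectorBasis_sq hT, Finset.mul_sum]
  gcongr with i
  exact le_csSup (finite_spectrum T).bddAbove (eigenvalues_mem hT i)

lemma minEig_le_inner_mulV (hT : T.IsHermitian) (z : Vec (Fin m)) :
    minEig T * ‖z‖ ^ 2 ≤ inner ℝ (mulV T z) z := by
  rw [inner_mulV_eq_sum hT, ← sum_inner_eigenvectorBasis_sq hT, Finset.mul_sum]
  gcongr with i
  exact csInf_le (finite_spectrum T).bddBelow (eigenvalues_mem hT i)

lemma exists_eigenvector_of_mem (hT : T.IsHermitian) {t : ℝ} (ht : t ∈ spectrum ℝ T) :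
    ∃ z : Vec (Fin m), ‖z‖ = 1 ∧ mulV T z = t • z := by
  rw [hT.spectrum_real_eq_range_eigenvalues] at ht
  obtain ⟨i, rfl⟩ := ht
  exact ⟨hT.eigenvectorBasis i, hT.eigenvectorBasis.norm_eq_one i,
    congrArg (WithLp.toLp 2) (hT.mulVec_eigenvectorBasis i)⟩

lemma exists_eigenvector_maxEig (hm : 0 < m) (hT : T.IsHermitian) :
    ∃ z : Vec (Fin m), ‖z‖ = 1 ∧ mulV T z = maxEig T • z :=
  exists_eigenvector_of_mem hT ((spectrum_nonempty hm hT).csSup_mem (finite_spectrum T))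

lemma exists_eigenvector_minEig (hm : 0 < m) (hT : T.IsHermitian) :
    ∃ z : Vec (Fin m), ‖z‖ = 1 ∧ mulV T z = minEig T • z :=
  exists_eigenvector_of_mem hT ((spectrum_nonempty hm hT).csInf_mem (finite_spectrum T))

/-- Writing the bound as a family of inequalities continuous in `T` shows that sublevel sets are
closed; measurability of the Ritz values rests on this. -/
lemma maxEig_le_iff (hm : 0 < m) (hT : T.IsHermitian) {c : ℝ} :
    maxEig T ≤ c ↔ ∀ z : Vec (Fin m), inner ℝ (mulV T z) z ≤ c * ‖z‖ ^ 2 := by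
  refine ⟨fun h z => (inner_mulV_le_maxEig hT z).trans (by gcongr), fun h => ?_⟩
  obtain ⟨z, hz, hTz⟩ := exists_eigenvector_maxEig hm hT
  have := h z
  rwa [hTz, real_inner_smul_left, real_inner_self_eq_norm_sq, hz, one_pow, mul_one, mul_one] at this

lemma le_minEig_iff (hm : 0 < m) (hT : T.IsHermitian) {c : ℝ} :
    c ≤ minEig T ↔ ∀ z : Vec (Fin m), c * ‖z‖ ^ 2 ≤ inner ℝ (mulV T z) z := by
  refine ⟨fun h z => le_trans (by gcongr) (minEig_le_inner_mulV hT z), fun h => ?_⟩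
  obtain ⟨z, hz, hTz⟩ := exists_eigenvector_minEig hm hT
  have := h z
  rwa [hTz, real_inner_smul_left, real_inner_self_eq_norm_sq, hz, one_pow, mul_one, mul_one] at this

lemma unitEigenvector_spec {t : ℝ} (h : ∃ z : Vec (Fin m), ‖z‖ = 1 ∧ mulV T z = t • z) :
    ‖unitEigenvector T t‖ = 1 ∧ mulV T (unitEigenvector T t) = t • unitEigenvector T t := by
  rw [unitEigenvector, dif_pos h]
  exact h.choose_spec

/-- A symmetric matrix attains its largest absolute Rayleigh quotient at an eigenvector. -/
lemma exists_dominant_eigenvector {ι : Type} [Fintype ι] [DecidableEq ι] [Nonempty ι]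
    {A : Matrix ι ι ℝ} (hA : A.IsSymm) :
    ∃ (Λ : ℝ) (e : Vec ι), 0 ≤ Λ ∧ ‖e‖ = 1 ∧ (mulV A e = Λ • e ∨ mulV A e = -Λ • e) ∧
      ∀ y, |inner ℝ (mulV A y) y| ≤ Λ * ‖y‖ ^ 2 := by
  have hs := mulL_isSymmetric hA
  have : Nontrivial (Vec ι) := inferInstance
  have hn : 0 < Module.finrank ℝ (Vec ι) := Module.finrank_pos
  obtain ⟨i, -, hi⟩ := Finset.exists_max_image Finset.univ (fun i => |hs.eigenvalues rfl i|)
    ⟨⟨0, hn⟩, Finset.mem_univ _⟩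
  refine ⟨|hs.eigenvalues rfl i|, hs.eigenvectorBasis rfl i, abs_nonneg _,
    OrthonormalBasis.norm_eq_one _ _, ?_, fun y => ?_⟩
  · have := hs.apply_eigenvectorBasis rfl i
    rw [mulL_apply] at this
    rcases abs_choice (hs.eigenvalues rfl i) with h | h
    · left; rw [this, h]; rfl
    · right; rw [this, h, neg_neg]; rfl
  · have h1 := inner_aeval_eq_sum hs Polynomial.X y
    have h2 : ∑ i, inner ℝ (hs.eigenvectorBasis rfl i) y ^ 2 = ‖y‖ ^ 2 := by
      have := (hs.eigenvectorBasis rfl).sum_sq_norm_inner_right y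
      simpa using this
    rw [Polynomial.aeval_X, mulL_apply] at h1
    rw [h1, ← h2, Finset.mul_sum]
    refine (Finset.abs_sum_le_sum_abs _ _).trans (Finset.sum_le_sum fun j _ => ?_)
    rw [abs_mul, abs_of_nonneg (sq_nonneg (inner ℝ _ y)), Polynomial.eval_X]
    exact mul_le_mul_of_nonneg_right (hi j (Finset.mem_univ _)) (sq_nonneg _)

end ExtremeEigenvalues

/-! ## The Lanczos recurrence -/

section Lanczos

variable {ι : Type} [Fintype ι] [DecidableEq ι] {W : Matrix ι ι ℝ} {x : Vec ι}

omit [DecidableEq ι] in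
lemma lanczosSeq_succ (W : Matrix ι ι ℝ) (x : Vec ι) (k : ℕ) :
    lanczosSeq W x (k + 1) = lanczosStep W (lanczosSeq W x k) :=
  Function.iterate_succ_apply' _ _ _

omit [DecidableEq ι] in
lemma lanczos_recurrence (W : Matrix ι ι ℝ) (x : Vec ι) (k : ℕ) :
    mulV W (lanczosSeq W x k).v = (lanczosSeq W x k).β • (lanczosSeq W x k).vPrev +
      (lanczosSeq W x k).alpha W • (lanczosSeq W x k).v +
      (lanczosSeq W x (k + 1)).β • (lanczosSeq W x (k + 1)).v := by
  rw [lanczosSeq_succ]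
  simp only [lanczosStep]
  set st := lanczosSeq W x k
  set w := mulV W st.v - st.β • st.vPrev - st.alpha W • st.v with hw
  have : ‖w‖ • ‖w‖⁻¹ • w = w := by
    by_cases h : ‖w‖ = 0
    · rw [norm_eq_zero.mp h]; simp
    · rw [smul_smul, mul_inv_cancel₀ h, one_smul]
  rw [this, hw]; abel

omit [DecidableEq ι] in
lemma lanczosSeq_vPrev_succ (W : Matrix ι ι ℝ) (x : Vec ι) (k : ℕ) :
    (lanczosSeq W x (k + 1)).vPrev = (lanczosSeq W x k).v := by
  rw [lanczosSeq_succ]; rfl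

omit [DecidableEq ι] in
-- By symmetry `⟨v_j, W v_k⟩ = ⟨W v_j, v_k⟩`, and `W v_j` lies in the span of `v_{j-1}, v_j,
-- v_{j+1}`. So only `j = k - 1` and `j = k` can give nonzero products, and these are what the
-- recurrence subtracts.
lemma lanczos_orthonormal (hW : W.IsSymm) (hx : ‖x‖ = 1) (k : ℕ)
    (hβ : ∀ j, 1 ≤ j → j ≤ k → (lanczosSeq W x j).β ≠ 0) :
    (∀ i ≤ k, ‖(lanczosSeq W x i).v‖ = 1) ∧
      ∀ i j, i < j → j ≤ k → inner ℝ (lanczosSeq W x i).v (lanczosSeq W x j).v = 0 := by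
  induction k with
  | zero =>
    refine ⟨fun i hi => ?_, fun i j hij hj => by omega⟩
    rw [Nat.le_zero.mp hi]; exact hx
  | succ k ih =>
    obtain ⟨hn, ho⟩ := ih fun j h1 h2 => hβ j h1 (by omega)
    have hβk := hβ (k + 1) (by omega) le_rfl
    have key : ∀ j ≤ k, inner ℝ (lanczosSeq W x j).v (lanczosSeq W x (k + 1)).v = 0 := by
      intro j hj
      suffices inner ℝ (lanczosSeq W x j).v
          ((lanczosSeq W x (k + 1)).β • (lanczosSeq W x (k + 1)).v) = 0 by
        rw [real_inner_smul_right] at this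
        exact (mul_eq_zero.mp this).resolve_left hβk
      have hrec : (lanczosSeq W x (k + 1)).β • (lanczosSeq W x (k + 1)).v =
          mulV W (lanczosSeq W x k).v - (lanczosSeq W x k).β • (lanczosSeq W x k).vPrev -
            (lanczosSeq W x k).alpha W • (lanczosSeq W x k).v := by
        rw [lanczos_recurrence W x k]; abel
      rw [hrec]
      rcases hj.lt_or_eq with hj | rfl
      · obtain ⟨l, rfl⟩ : ∃ l, k = l + 1 := ⟨k - 1, by omega⟩
        have hsym : inner ℝ (lanczosSeq W x j).v (mulV W (lanczosSeq W x (l + 1)).v) =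
            inner ℝ (mulV W (lanczosSeq W x j).v) (lanczosSeq W x (l + 1)).v := by
          rw [inner_mulV_left, hW.eq]
        rw [inner_sub_right, inner_sub_right, real_inner_smul_right, real_inner_smul_right,
          lanczosSeq_vPrev_succ, ho j (l + 1) hj le_rfl, hsym, lanczos_recurrence W x j,
          inner_add_left, inner_add_left, real_inner_smul_left, real_inner_smul_left,
          real_inner_smul_left, ho j (l + 1) hj le_rfl]
        have hprev : inner ℝ (lanczosSeq W x j).vPrev (lanczosSeq W x (l + 1)).v = 0 := by
          cases j with
          | zero => exact inner_zero_left _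
          | succ j => rw [lanczosSeq_vPrev_succ]; exact ho j (l + 1) (by omega) le_rfl
        rw [hprev]
        -- For `j = l`, the direct predecessor, the two terms with the coefficient `β` cancel; for
        -- smaller `j` every term vanishes.
        rcases (Nat.lt_succ_iff.mp hj).lt_or_eq with hjl | rfl
        · rw [ho (j + 1) (l + 1) (by omega) le_rfl, ho j l hjl (by omega)]; simp
        · rw [real_inner_self_eq_norm_sq, real_inner_self_eq_norm_sq, hn _ le_rfl,
            hn j (by omega)]
          ring
      · rw [inner_sub_right, real_inner_smul_right, real_inner_self_eq_norm_sq, hn j le_rfl,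
          real_inner_comm]
        simp [LanczosState.alpha]
    refine ⟨fun i hi => ?_, fun i j hij hj => ?_⟩
    · rcases hi.lt_or_eq with hi | rfl
      · exact hn i (by omega)
      · rw [lanczosSeq_succ] at hβk ⊢
        simp only [lanczosStep] at hβk ⊢
        rw [norm_smul, norm_inv, norm_norm, inv_mul_cancel₀ hβk]
    · rcases hj.lt_or_eq with hj | rfl
      · exact ho i j hij (by omega)
      · exact key i (by omega)

omit [DecidableEq ι] in
lemma lanczosDim_spec (W : Matrix ι ι ℝ) (x : Vec ι) {K : ℕ} (hK : 1 ≤ K) :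
    1 ≤ lanczosDim W x K ∧ (lanczosDim W x K = K ∨ (lanczosSeq W x (lanczosDim W x K)).β = 0) ∧
      lanczosDim W x K ≤ K ∧
      ∀ j, 1 ≤ j → j < lanczosDim W x K → (lanczosSeq W x j).β ≠ 0 := by
  have hmem : K ∈ {m | 1 ≤ m ∧ (m = K ∨ (lanczosSeq W x m).β = 0)} := ⟨hK, Or.inl rfl⟩
  have h := Nat.sInf_mem ⟨K, hmem⟩
  refine ⟨h.1, h.2, Nat.sInf_le hmem, fun j h1 h2 h3 => ?_⟩
  exact absurd (Nat.sInf_le (s := {m | 1 ≤ m ∧ (m = K ∨ (lanczosSeq W x m).β = 0)})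
    ⟨h1, Or.inr h3⟩) (not_le.mpr h2)

omit [DecidableEq ι] in
lemma lanczosMatrix_isHermitian (W : Matrix ι ι ℝ) (x : Vec ι) (m : ℕ) :
    (lanczosMatrix W x m).IsHermitian := by
  ext i j
  rw [Matrix.conjTranspose_apply, star_trivial]
  simp only [lanczosMatrix, Matrix.of_apply]
  by_cases h : i = j
  · subst h; simp
  · have h' : ¬ j = i := fun h' => h h'.symm
    rw [if_neg h, if_neg h']
    by_cases h1 : i.val + 1 = j.val
    · have h2 : ¬ j.val + 1 = i.val := by omega
      simp [h1, h2]
    · simp [h1]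

section

variable {m : ℕ} (hW : W.IsSymm) (hx : ‖x‖ = 1)
  (hβ : ∀ j, 1 ≤ j → j < m → (lanczosSeq W x j).β ≠ 0)

include hW hx hβ

omit [DecidableEq ι] in
lemma inner_lanczos (i j : ℕ) (hi : i < m) (hj : j < m) :
    inner ℝ (lanczosSeq W x i).v (lanczosSeq W x j).v = if i = j then 1 else 0 := by
  obtain ⟨hn, ho⟩ := lanczos_orthonormal hW hx (m - 1) fun j h1 h2 => hβ j h1 (by omega)
  rcases lt_trichotomy i j with h | rfl | h
  · rw [if_neg h.ne, ho i j h (by omega)]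
  · rw [if_pos rfl, real_inner_self_eq_norm_sq, hn i (by omega), one_pow]
  · rw [if_neg h.ne', real_inner_comm, ho j i h (by omega)]

omit [DecidableEq ι] in
lemma inner_mulV_lanczos_of_lt (i j : ℕ) (hij : i < j) (hj : j < m) :
    inner ℝ (mulV W (lanczosSeq W x i).v) (lanczosSeq W x j).v =
      if i + 1 = j then (lanczosSeq W x j).β else 0 := by
  have ho := inner_lanczos hW hx hβ
  have hprev : inner ℝ (lanczosSeq W x i).vPrev (lanczosSeq W x j).v = 0 := by
    cases i with
    | zero => exact inner_zero_left _
    | succ i => rw [lanczosSeq_vPrev_succ, ho i j (by omega) hj, if_neg (by omega)]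
  rw [lanczos_recurrence, inner_add_left, inner_add_left, real_inner_smul_left,
    real_inner_smul_left, real_inner_smul_left, hprev, ho i j (by omega) hj, if_neg (by omega),
    ho (i + 1) j (by omega) hj]
  split_ifs with h
  · rw [h]; ring
  · ring

omit [DecidableEq ι] in
-- The tridiagonal matrix is the compression of `W` to the Krylov space, so its Rayleigh quotients
-- are those of `W` on combinations of Lanczos vectors.
lemma lanczosMatrix_apply (i j : Fin m) :
    lanczosMatrix W x m i j = inner ℝ (mulV W (lanczosSeq W x i).v) (lanczosSeq W x j).v := by
  simp only [lanczosMatrix, Matrix.of_apply]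
  rcases lt_trichotomy i j with h | rfl | h
  · rw [inner_mulV_lanczos_of_lt hW hx hβ i j h j.2, if_neg h.ne]
    have : ¬ j.val + 1 = i.val := by have : i.val < j.val := h; omega
    simp [this]
  · have hprev : inner ℝ (lanczosSeq W x i).vPrev (lanczosSeq W x i).v = 0 := by
      rcases Nat.eq_zero_or_eq_succ_pred i.val with h | h
      · rw [h]; exact inner_zero_left _
      · have hi := i.2
        rw [h, lanczosSeq_vPrev_succ, inner_lanczos hW hx hβ _ _ (by omega) (by omega),
          if_neg (by omega)]
    rw [if_pos rfl, LanczosState.alpha, inner_sub_left, real_inner_smul_left, hprev]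
    ring
  · have hji : j.val < i.val := h
    have e : inner ℝ (mulV W (lanczosSeq W x i).v) (lanczosSeq W x j).v =
        inner ℝ (mulV W (lanczosSeq W x j).v) (lanczosSeq W x i).v := by
      rw [inner_mulV_left, hW.eq, real_inner_comm]
    rw [e, inner_mulV_lanczos_of_lt hW hx hβ j i h i.2, if_neg h.ne', if_neg (by omega)]

omit [DecidableEq ι] in
lemma inner_lanczosCombine (z y : Vec (Fin m)) :
    inner ℝ (lanczosCombine W x z) (lanczosCombine W x y) = inner ℝ z y := by
  simp only [lanczosCombine, sum_inner, inner_sum, real_inner_smul_left, real_inner_smul_right]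
  rw [inner_eq_dotProduct, dotProduct]
  refine Finset.sum_congr rfl fun i _ => ?_
  rw [Finset.sum_eq_single i]
  · rw [inner_lanczos hW hx hβ _ _ i.2 i.2]; simp [mul_comm]
  · intro j _ hj
    rw [inner_lanczos hW hx hβ _ _ j.2 i.2, if_neg (fun h => hj (Fin.ext h))]; simp
  · simp

omit [DecidableEq ι] in
lemma inner_mulV_lanczosCombine (z : Vec (Fin m)) :
    inner ℝ (mulV W (lanczosCombine W x z)) (lanczosCombine W x z) =
      inner ℝ (mulV (lanczosMatrix W x m) z) z := by
  have e : mulV W (lanczosCombine W x z) = ∑ i : Fin m, z i • mulV W (lanczosSeq W x i).v := by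
    rw [← mulL_apply, lanczosCombine, map_sum]
    exact Finset.sum_congr rfl fun i _ => by rw [map_smul, mulL_apply]
  have e2 : ∀ i, (mulV (lanczosMatrix W x m) z).ofLp i = ∑ j, lanczosMatrix W x m i j * z j :=
    fun _ => rfl
  rw [e, inner_eq_dotProduct (mulV _ z)]
  simp only [lanczosCombine, sum_inner, inner_sum, real_inner_smul_left, real_inner_smul_right,
    dotProduct, e2, Finset.sum_mul]
  refine Finset.sum_congr rfl fun i _ => Finset.sum_congr rfl fun j _ => ?_
  rw [lanczosMatrix_apply hW hx hβ, inner_mulV_left, hW.eq,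
    real_inner_comm (mulV W (lanczosSeq W x i).v)]
  ring

end

omit [DecidableEq ι] in
/-- The Lanczos vectors span the Krylov space. -/
lemma exists_lanczosCombine_eq {T : Vec ι →ₗ[ℝ] Vec ι} {a b : ℝ}
    (hT : ∀ y, T y = a • y + b • mulV W y) {K : ℕ} (hK : 1 ≤ K) {p : Polynomial ℝ}
    (hp : p.natDegree < K) :
    ∃ z : Vec (Fin (lanczosDim W x K)), Polynomial.aeval T p x = lanczosCombine W x z := by
  obtain ⟨hm1, hm2, hmK, -⟩ := lanczosDim_spec W x hK
  set m := lanczosDim W x K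
  let v : ℕ → Vec ι := fun i => (lanczosSeq W x i).v
  let Q : ℕ → Submodule ℝ (Vec ι) := fun k => Submodule.span ℝ (v '' Set.Iio k)
  have hQ : ∀ {i j}, i < j → v i ∈ Q j := fun hij => Submodule.subset_span ⟨_, hij, rfl⟩
  have hQm : ∀ {i j}, i ≤ j → Q i ≤ Q j := fun hij =>
    Submodule.span_mono (Set.image_mono (Set.Iio_subset_Iio hij))
  have hWv : ∀ {i j : ℕ}, i < j → ((lanczosSeq W x (i + 1)).β = 0 ∨ i + 1 < j) →
      T (v i) ∈ Q j := by
    intro i j hij hb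
    rw [hT]
    refine Submodule.add_mem _ (Submodule.smul_mem _ _ (hQ hij)) (Submodule.smul_mem _ _ ?_)
    simp only [v]
    rw [lanczos_recurrence]
    refine Submodule.add_mem _ (Submodule.add_mem _ (Submodule.smul_mem _ _ ?_)
      (Submodule.smul_mem _ _ (hQ hij))) ?_
    · cases i with
      | zero => exact Submodule.zero_mem _
      | succ i => rw [lanczosSeq_vPrev_succ]; exact hQ (by omega)
    · rcases hb with hb | hb
      · rw [hb, zero_smul]; exact Submodule.zero_mem _
      · exact Submodule.smul_mem _ _ (hQ hb)
  -- Membership in `Q (j + 1)` drives the induction. Membership in `Q m` follows from it if `m = K`;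
  -- after a breakdown `Q m` is invariant under `T`.
  have hpow : ∀ j < K, (T ^ j) x ∈ Q m ⊓ Q (j + 1) := by
    intro j
    induction j with
    | zero => intro _; exact ⟨hQ (i := 0) hm1, hQ (i := 0) one_pos⟩
    | succ j ih =>
      intro hj
      obtain ⟨h1, h2⟩ := ih (by omega)
      rw [pow_succ', Module.End.mul_apply]
      have h3 : T ((T ^ j) x) ∈ Q (j + 1 + 1) := by
        have : Q (j + 1) ≤ (Q (j + 1 + 1)).comap T := by
          refine Submodule.span_le.mpr ?_
          rintro _ ⟨i, hi, rfl⟩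
          have hi : i < j + 1 := hi
          exact hWv (by omega) (Or.inr (by omega))
        exact this h2
      refine ⟨?_, h3⟩
      rcases hm2 with hm2 | hm2
      · exact hQm (by omega) h3
      · have : Q m ≤ (Q m).comap T := by
          refine Submodule.span_le.mpr ?_
          rintro _ ⟨i, hi, rfl⟩
          have hi : i < m := hi
          refine hWv hi ?_
          rcases Nat.lt_or_ge (i + 1) m with h | h
          · exact Or.inr h
          · left; rwa [show i + 1 = m by omega]
        exact this h1
  have hmem : Polynomial.aeval T p x ∈ Q m := by
    rw [Polynomial.aeval_eq_sum_range' hp, LinearMap.sum_apply]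
    exact Submodule.sum_mem _ fun i hi =>
      Submodule.smul_mem _ _ (hpow i (Finset.mem_range.mp hi)).1
  let V : Vec (Fin m) →ₗ[ℝ] Vec ι :=
    { toFun := fun z => lanczosCombine W x z
      map_add' := fun z y => by simp [lanczosCombine, add_smul, Finset.sum_add_distrib]
      map_smul' := fun c z => by simp [lanczosCombine, mul_smul, Finset.smul_sum] }
  have hrange : Q m ≤ LinearMap.range V := by
    refine Submodule.span_le.mpr ?_
    rintro _ ⟨i, hi, rfl⟩
    have hi : i < m := hi
    refine ⟨EuclideanSpace.single ⟨i, hi⟩ 1, ?_⟩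
    change lanczosCombine W x _ = _
    rw [lanczosCombine, Finset.sum_eq_single ⟨i, hi⟩]
    · simp [v]
    · intro j _ hj; simp [hj]
    · simp
  obtain ⟨z, hz⟩ := hrange hmem
  exact ⟨z, hz.symm⟩

/-! ### Convergence of the Lanczos method -/

omit [DecidableEq ι] in
/-- If `e` is in the kernel of `0 ≤ T ≤ 1` and the component of `x` along `e` is not too small, then
the Krylov space of `x` contains a vector with a small Rayleigh quotient. -/
lemma exists_krylov_rayleigh_le {T : Vec ι →ₗ[ℝ] Vec ι} (hT : T.IsSymmetric)
    (h0 : ∀ y, 0 ≤ inner ℝ (T y) y) (h1 : ∀ y, inner ℝ (T y) y ≤ ‖y‖ ^ 2) {x e : Vec ι}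
    (hx : ‖x‖ = 1) (he : ‖e‖ = 1) (hTe : T e = 0) {θ : ℝ} (hθ : 0 < θ) {ε : ℝ} (hε0 : 0 < ε)
    (hε1 : ε < 1) (hεθ : Real.sinh θ ^ 2 = ε / (1 - ε)) (m : ℕ)
    (hc : 1 ≤ Real.cosh ((2 * m + 1) * θ) * |inner ℝ x e|) :
    ∃ p : Polynomial ℝ, p.natDegree ≤ m ∧ Polynomial.aeval T p x ≠ 0 ∧
      inner ℝ (T (Polynomial.aeval T p x)) (Polynomial.aeval T p x) ≤
        ε * ‖Polynomial.aeval T p x‖ ^ 2 := by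
  open Polynomial in
  have hε2 : 0 < 1 - ε := by linarith
  have hs : 0 < Real.sinh θ := Real.sinh_pos_iff.mpr hθ
  set s := Real.sinh θ
  have hS : 0 < Real.sinh ((2 * m + 1) * θ) := Real.sinh_pos_iff.mpr (by positivity)
  set S := Real.sinh ((2 * m + 1) * θ) with hSdef
  have hcosh : Real.cosh ((2 * m + 1) * θ) ^ 2 = S ^ 2 + 1 := Real.cosh_sq _
  set D := (sinPoly m).eval (-s ^ 2) with hD
  have hsD : s * D = S := sinh_mul_eval_sinPoly θ m
  have hDpos : 0 < D := by
    by_contra! h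
    nlinarith
  -- The affine substitution takes `[ε, 1]` to `[0, 1]` and `0` to `-ε / (1 - ε) = -sinh² θ`, where
  -- `sinPoly m` has the large value `D = S / s`. Division by `D` normalizes `p 0 = 1`.
  let p : ℝ[X] := C D⁻¹ * (sinPoly m).comp (C (1 - ε)⁻¹ * (X - C ε))
  have hpd : p.natDegree ≤ m := by
    refine (natDegree_C_mul_le _ _).trans (natDegree_comp_le.trans ?_)
    have h1 := natDegree_sinPoly_le m
    have h2 : (C (1 - ε)⁻¹ * (X - C ε) : ℝ[X]).natDegree ≤ 1 := by compute_degree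
    nlinarith
  have hpe : ∀ t, p.eval t = D⁻¹ * (sinPoly m).eval ((1 - ε)⁻¹ * (t - ε)) := fun t => by
    simp [p]
  have hp0 : p.eval 0 = 1 := by
    rw [hpe, show (1 - ε)⁻¹ * (0 - ε) = -s ^ 2 by rw [hεθ]; field_simp; ring]
    exact inv_mul_cancel₀ hDpos.ne'
  -- The value `⟨f(T) x, x⟩` is the quadratic form of `T` at `p(T) x` minus `ε ‖p(T) x‖²`, so it
  -- remains to see that it is nonpositive.
  let f : ℝ[X] := p * (X - C ε) * p
  have hf : ∀ t, 0 ≤ t → t ≤ 1 → f.eval t ≤ ε / S ^ 2 := by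
    intro t ht0 ht1
    have e1 : f.eval t = (t - ε) * p.eval t ^ 2 := by simp [f]; ring
    rw [e1]
    rcases le_total t ε with h | h
    · exact (mul_nonpos_of_nonpos_of_nonneg (by linarith) (sq_nonneg _)).trans (by positivity)
    · have h2 := mul_eval_sinPoly_sq_le (t := (1 - ε)⁻¹ * (t - ε))
        (mul_nonneg (by positivity) (by linarith)) (by rw [inv_mul_le_iff₀ hε2]; linarith) m
      rw [hpe]
      set w := (sinPoly m).eval ((1 - ε)⁻¹ * (t - ε))
      rw [mul_assoc, inv_mul_le_iff₀ hε2, mul_one] at h2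
      have e2 : (t - ε) * (D⁻¹ * w) ^ 2 = ((t - ε) * w ^ 2) / D ^ 2 := by field_simp
      rw [e2, ← hsD, mul_pow, hεθ, div_le_div_iff₀ (by positivity) (by positivity)]
      have e3 : ε * D ^ 2 = (1 - ε) * (ε / (1 - ε) * D ^ 2) := by field_simp
      rw [e3]
      exact mul_le_mul_of_nonneg_right h2 (by positivity)
  have hae : ∀ g : ℝ[X], aeval T g e = g.eval 0 • e := fun g => by
    refine Module.End.aeval_apply_of_hasEigenvector ⟨?_, by rintro rfl; simp at he⟩
    rw [Module.End.mem_eigenspace_iff, hTe, zero_smul]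
  set c := inner ℝ x e with hcdef
  refine ⟨p, hpd, ?_, ?_⟩
  · intro h
    have h2 : inner ℝ (aeval T p x) e = c := by
      rw [isSymmetric_aeval hT, hae, hp0, one_smul]
    rw [h, inner_zero_left] at h2
    rw [← h2] at hc
    norm_num at hc
  -- The component along `e` contributes `-ε c²`, the orthogonal part at most `ε (1 - c²) / S²`. The
  -- sum is nonpositive exactly when `(S² + 1) c² ≥ 1`, and `S² + 1 = cosh²` is the hypothesis on
  -- `c`.
  · set y := x - c • e with hy
    have hye : inner ℝ y e = 0 := by
      rw [hy, inner_sub_left, real_inner_smul_left, real_inner_self_eq_norm_sq, he]; simp [hcdef]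
    have hyn : ‖y‖ ^ 2 = 1 - c ^ 2 := by
      rw [hy, norm_sub_sq_real, real_inner_smul_right, norm_smul, he, hx, Real.norm_eq_abs, mul_one,
        sq_abs]
      ring
    have hxy : x = c • e + y := by rw [hy]; abel
    have h2 : inner ℝ (aeval T f x) x = -ε * c ^ 2 + inner ℝ (aeval T f y) y := by
      have hf0 : f.eval 0 = -ε := by simp [f, hp0]
      have hcross : inner ℝ (aeval T f y) e = 0 := by
        rw [isSymmetric_aeval hT, hae, real_inner_smul_right, hye, mul_zero]
      conv_lhs => rw [hxy]
      rw [map_add, map_smul, hae, hf0, inner_add_left, inner_add_right, inner_add_right,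
        real_inner_smul_left, real_inner_smul_left, real_inner_smul_left, real_inner_smul_left,
        real_inner_smul_right, real_inner_smul_right, hcross, real_inner_comm y e, hye,
        real_inner_self_eq_norm_sq, he]
      ring
    have h3 : inner ℝ (aeval T f x) x =
        inner ℝ (T (aeval T p x)) (aeval T p x) - ε * ‖aeval T p x‖ ^ 2 := by
      have e1 : aeval T f x = aeval T p ((T - algebraMap ℝ _ ε) (aeval T p x)) := by
        simp only [f, map_mul, map_sub, aeval_X, aeval_C]
        rfl
      rw [e1, isSymmetric_aeval hT, LinearMap.sub_apply, inner_sub_left,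
        Module.algebraMap_end_apply, real_inner_smul_left, real_inner_self_eq_norm_sq]
    have h4 := inner_aeval_le hT (a := 0) (b := 1) (fun y => by simpa using h0 y)
      (fun y => by simpa using h1 y) hf y
    have h5 : 1 ≤ (S ^ 2 + 1) * c ^ 2 := by
      rw [← hcosh, ← sq_abs c, ← mul_pow]
      exact one_le_pow₀ hc
    have h6 : -ε * c ^ 2 + ε / S ^ 2 * ‖y‖ ^ 2 ≤ 0 := by
      rw [hyn]
      have : ε / S ^ 2 * (1 - c ^ 2) ≤ ε * c ^ 2 := by
        rw [div_mul_eq_mul_div, div_le_iff₀ (by positivity)]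
        nlinarith
      linarith
    linarith

end Lanczos


section LanczosConvergence

variable {ι : Type} [Fintype ι] {W : Matrix ι ι ℝ} {x e : Vec ι}

/-- A Ritz vector with a Rayleigh quotient close to the extreme eigenvalue `s Λ`, `s = ± 1`. -/
lemma exists_ritz (hW : W.IsSymm) (hx : ‖x‖ = 1) (he : ‖e‖ = 1) {Λ s : ℝ} (hΛ : 0 < Λ)
    (hs : s = 1 ∨ s = -1) (hWe : mulV W e = (s * Λ) • e)
    (hbd : ∀ y, |inner ℝ (mulV W y) y| ≤ Λ * ‖y‖ ^ 2) {δ θ : ℝ} (hδ : 0 < δ) (hθ : 0 < θ)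
    (hδθ : Real.sinh θ ^ 2 = δ / (2 + δ)) {K : ℕ} (hK : 1 ≤ K)
    (hc : 1 ≤ Real.cosh ((2 * K - 1) * θ) * |inner ℝ x e|) :
    ∃ z : Vec (Fin (lanczosDim W x K)), 0 < ‖z‖ ∧
      Λ * ‖z‖ ^ 2 ≤ (1 + δ) * (s * inner ℝ (mulV (lanczosMatrix W x (lanczosDim W x K)) z) z) := by
  have hss : s * s = 1 := by rcases hs with rfl | rfl <;> norm_num
  -- `T = (I - s W / Λ) / 2` moves the spectrum into `[0, 1]` and the extreme eigenvector into the
  -- kernel.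
  let T : Vec ι →ₗ[ℝ] Vec ι := (1 / 2 : ℝ) • LinearMap.id + (-(s / (2 * Λ))) • mulL W
  have hT : ∀ y, T y = (1 / 2 : ℝ) • y + (-(s / (2 * Λ))) • mulV W y := fun y => rfl
  have hTs : T.IsSymmetric := by
    intro y z
    rw [hT, hT, inner_add_left, inner_add_right, real_inner_smul_left, real_inner_smul_left,
      real_inner_smul_right, real_inner_smul_right, inner_mulV_left, hW.eq]
  have hTi : ∀ y, inner ℝ (T y) y = ‖y‖ ^ 2 / 2 - s * inner ℝ (mulV W y) y / (2 * Λ) := fun y => by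
    rw [hT, inner_add_left, real_inner_smul_left, real_inner_smul_left, real_inner_self_eq_norm_sq]
    ring
  have hsb : ∀ y, |s * inner ℝ (mulV W y) y| ≤ Λ * ‖y‖ ^ 2 := fun y => by
    rw [abs_mul]
    have : |s| = 1 := by rcases hs with rfl | rfl <;> norm_num
    rw [this, one_mul]; exact hbd y
  have h0 : ∀ y, 0 ≤ inner ℝ (T y) y := fun y => by
    rw [hTi, sub_nonneg, div_le_iff₀ (by positivity)]
    have := (abs_le.mp (hsb y)).2
    linarith
  have h1 : ∀ y, inner ℝ (T y) y ≤ ‖y‖ ^ 2 := fun y => by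
    have h2 := (abs_le.mp (hsb y)).1
    have h3 : -(‖y‖ ^ 2 / 2) ≤ s * inner ℝ (mulV W y) y / (2 * Λ) := by
      rw [le_div_iff₀ (by positivity)]; linarith
    rw [hTi]; linarith
  have hTe : T e = 0 := by
    rw [hT, hWe, smul_smul, ← add_smul]
    have : (1 / 2 : ℝ) + -(s / (2 * Λ)) * (s * Λ) = 0 := by
      have : s / (2 * Λ) * (s * Λ) = s * s / 2 := by field_simp
      rw [neg_mul, this, hss]; ring
    rw [this, zero_smul]
  -- Chosen so that a Rayleigh quotient of `T` below `ε` means one of `s W` above `Λ / (1 + δ)`;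
  -- then `ε / (1 - ε) = δ / (2 + δ)`.
  set ε := δ / (2 * (1 + δ)) with hε
  have hε0 : 0 < ε := by positivity
  have hε1 : ε < 1 := by rw [hε, div_lt_one (by positivity)]; linarith
  have hεθ : Real.sinh θ ^ 2 = ε / (1 - ε) := by
    rw [hδθ, hε, div_eq_div_iff (by positivity) (by rw [← hε]; linarith)]
    field_simp; ring
  have hcast : (2 * ((K - 1 : ℕ) : ℝ) + 1) = 2 * K - 1 := by
    rw [Nat.cast_sub hK]; push_cast; ring
  obtain ⟨p, hp, hy, hle⟩ := exists_krylov_rayleigh_le hTs h0 h1 hx he hTe hθ hε0 hε1 hεθ (K - 1)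
    (by rw [hcast]; exact hc)
  obtain ⟨z, hz⟩ := exists_lanczosCombine_eq (W := W) (x := x) hT hK
    (p := p) (by omega)
  have hβ := (lanczosDim_spec W x hK).2.2.2
  have hn : ‖lanczosCombine W x z‖ ^ 2 = ‖z‖ ^ 2 := by
    rw [← real_inner_self_eq_norm_sq, inner_lanczosCombine hW hx hβ, real_inner_self_eq_norm_sq]
  rw [hz] at hy hle
  have hzpos : 0 < ‖z‖ := by
    have h2 : 0 < ‖lanczosCombine W x z‖ := norm_pos_iff.mpr hy
    by_contra! h3
    have h4 : ‖z‖ = 0 := le_antisymm h3 (norm_nonneg _)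
    rw [h4] at hn
    have : 0 < ‖lanczosCombine W x z‖ ^ 2 := by positivity
    rw [hn] at this
    norm_num at this
  refine ⟨z, hzpos, ?_⟩
  rw [hTi, inner_mulV_lanczosCombine hW hx hβ, hn] at hle
  set R := s * inner ℝ (mulV (lanczosMatrix W x (lanczosDim W x K)) z) z
  have h2 : (1 / 2 - ε) * ‖z‖ ^ 2 ≤ R / (2 * Λ) := by linarith
  have h3 : 1 / 2 - ε = 1 / (2 * (1 + δ)) := by rw [hε]; field_simp; ring
  rw [h3, le_div_iff₀ (by positivity), div_mul_eq_mul_div, div_mul_eq_mul_div,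
    div_le_iff₀ (by positivity)] at h2
  linarith

lemma le_lanczosMaxVal (hW : W.IsSymm) (hx : ‖x‖ = 1) (he : ‖e‖ = 1) {Λ : ℝ} (hΛ : 0 < Λ)
    (hWe : mulV W e = Λ • e)
    (hbd : ∀ y, |inner ℝ (mulV W y) y| ≤ Λ * ‖y‖ ^ 2) {δ θ : ℝ} (hδ : 0 < δ) (hθ : 0 < θ)
    (hδθ : Real.sinh θ ^ 2 = δ / (2 + δ)) {K : ℕ} (hK : 1 ≤ K)
    (hc : 1 ≤ Real.cosh ((2 * K - 1) * θ) * |inner ℝ x e|) :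
    Λ ≤ (1 + δ) * lanczosMaxVal W x K := by
  obtain ⟨z, hz, h⟩ := exists_ritz hW hx he hΛ (Or.inl rfl) (by rw [one_mul]; exact hWe) hbd hδ hθ
    hδθ hK hc
  have h2 := inner_mulV_le_maxEig (lanczosMatrix_isHermitian W x (lanczosDim W x K)) z
  refine le_of_mul_le_mul_right ?_ (pow_pos hz 2)
  refine h.trans ?_
  rw [one_mul, mul_assoc]
  exact mul_le_mul_of_nonneg_left h2 (by positivity)

lemma le_neg_lanczosMinVal (hW : W.IsSymm) (hx : ‖x‖ = 1) (he : ‖e‖ = 1) {Λ : ℝ} (hΛ : 0 < Λ)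
    (hWe : mulV W e = -Λ • e)
    (hbd : ∀ y, |inner ℝ (mulV W y) y| ≤ Λ * ‖y‖ ^ 2) {δ θ : ℝ} (hδ : 0 < δ) (hθ : 0 < θ)
    (hδθ : Real.sinh θ ^ 2 = δ / (2 + δ)) {K : ℕ} (hK : 1 ≤ K)
    (hc : 1 ≤ Real.cosh ((2 * K - 1) * θ) * |inner ℝ x e|) :
    Λ ≤ (1 + δ) * (-lanczosMinVal W x K) := by
  obtain ⟨z, hz, h⟩ := exists_ritz hW hx he hΛ (Or.inr rfl) (by rw [neg_one_mul]; exact hWe) hbd hδ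
    hθ hδθ hK hc
  have h2 := minEig_le_inner_mulV (lanczosMatrix_isHermitian W x (lanczosDim W x K)) z
  refine le_of_mul_le_mul_right ?_ (pow_pos hz 2)
  refine h.trans ?_
  rw [neg_one_mul, mul_assoc, neg_mul]
  exact mul_le_mul_of_nonneg_left (neg_le_neg h2) (by positivity)

end LanczosConvergence

/-! ### The number of Lanczos iterations -/

lemma sinh_le_mul_cosh {u : ℝ} (hu : 0 ≤ u) : Real.sinh u ≤ u * Real.cosh u := by
  have hmono : MonotoneOn (fun u : ℝ => u * Real.cosh u - Real.sinh u) (Set.Ici 0) := by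
    refine monotoneOn_of_deriv_nonneg (convex_Ici 0) (by fun_prop) (by fun_prop) ?_
    intro t ht
    rw [interior_Ici] at ht
    have ht : 0 < t := ht
    have hd : HasDerivAt (fun u : ℝ => u * Real.cosh u - Real.sinh u)
        (1 * Real.cosh t + t * Real.sinh t - Real.cosh t) t :=
      ((hasDerivAt_id t).mul (Real.hasDerivAt_cosh t)).sub (Real.hasDerivAt_sinh t)
    rw [hd.deriv]
    have := mul_nonneg ht.le (Real.sinh_nonneg_iff.mpr ht.le)
    linarith
  have := hmono (Set.mem_Ici.mpr le_rfl) (Set.mem_Ici.mpr hu) hu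
  simp at this
  linarith

/-- The angle with `sinh² θ = δ / (2 + δ)`. -/
noncomputable def lanczosAngle (δ : ℝ) : ℝ := Real.arsinh (√(δ / (2 + δ)))

lemma sinh_lanczosAngle_sq {δ : ℝ} (hδ : 0 < δ) :
    Real.sinh (lanczosAngle δ) ^ 2 = δ / (2 + δ) := by
  rw [lanczosAngle, Real.sinh_arsinh, Real.sq_sqrt (by positivity)]

lemma lanczosAngle_pos {δ : ℝ} (hδ : 0 < δ) : 0 < lanczosAngle δ :=
  Real.arsinh_pos_iff.mpr (Real.sqrt_pos.mpr (by positivity))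

/-- For `u² = δ / (2 (1 + δ))`, the bound `sinh² u ≤ u² (1 + sinh² u)` rearranges to `sinh² u ≤ u² /
(1 - u²) = δ / (2 + δ)`. -/
lemma le_lanczosAngle {δ : ℝ} (hδ : 0 < δ) :
    1 / √(2 * (1 + 1 / δ)) ≤ lanczosAngle δ := by
  set u := 1 / √(2 * (1 + 1 / δ)) with hu
  have hu0 : 0 < u := by positivity
  have hu2 : u ^ 2 = δ / (2 * (1 + δ)) := by
    rw [hu, div_pow, Real.sq_sqrt (by positivity)]; field_simp; ring
  rw [lanczosAngle, ← Real.arsinh_sinh u]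
  refine Real.arsinh_le_arsinh.mpr (Real.le_sqrt_of_sq_le ?_)
  have h1 := pow_le_pow_left₀ (Real.sinh_nonneg_iff.mpr hu0.le) (sinh_le_mul_cosh hu0.le) 2
  rw [mul_pow, Real.cosh_sq, hu2, div_mul_eq_mul_div, le_div_iff₀ (by positivity)] at h1
  rw [le_div_iff₀ (by positivity)]
  nlinarith

lemma one_le_lanczosCount {n : ℕ} (hn : 0 < n) {δ q : ℝ} (hq : 0 < q) (hq1 : q ≤ 1) :
    1 ≤ lanczosCount n δ q := by
  rw [lanczosCount, Nat.one_le_ceil_iff]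
  have hn' : (1 : ℝ) ≤ n := by exact_mod_cast hn
  have : 0 ≤ Real.log (11 * n / q ^ 2) := by
    refine Real.log_nonneg ?_
    rw [le_div_iff₀ (by positivity)]
    nlinarith [pow_le_one₀ hq.le hq1 (n := 2)]
  positivity

/-- The iteration count is designed for this: `(2 K - 1) θ ≥ log (11 n / q²) / 2`, hence the
hyperbolic cosine is at least `√(11 n) / (2 q)`. -/
lemma one_le_cosh_mul {n : ℕ} (hn : 0 < n) {δ q : ℝ} (hδ : 0 < δ) (hq : 0 < q) (hq1 : q ≤ 1)
    {c : ℝ} (hc : 2 * q / √(11 * n) ≤ c) :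
    1 ≤ Real.cosh ((2 * lanczosCount n δ q - 1) * lanczosAngle δ) * c := by
  have hn' : (1 : ℝ) ≤ n := by exact_mod_cast hn
  set K := lanczosCount n δ q with hKdef
  set θ := lanczosAngle δ
  set R := √(2 * (1 + 1 / δ)) with hR
  have hR0 : 0 < R := by positivity
  have hθ := le_lanczosAngle hδ
  set l := Real.log (11 * n / q ^ 2) with hl
  have hl0 : 0 ≤ l := by
    refine Real.log_nonneg ?_
    rw [le_div_iff₀ (by positivity)]
    nlinarith [pow_le_one₀ hq.le hq1 (n := 2)]
  have hK : 1 / 4 * R * l + 1 / 2 ≤ K := by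
    rw [hKdef, lanczosCount]; exact Nat.le_ceil _
  have h0 : 0 ≤ 1 / 4 * R * l := by positivity
  have h1 : l / 2 ≤ (2 * K - 1) * θ := by
    calc l / 2 = (1 / 2 * R * l) * (1 / R) := by field_simp
      _ ≤ (2 * K - 1) * θ := mul_le_mul (by linarith) hθ (by positivity) (by linarith)
  have h2 : Real.exp (l / 2) = √(11 * n) / q := by
    rw [Real.exp_half, hl, Real.exp_log (by positivity), Real.sqrt_div (by positivity),
      Real.sqrt_sq hq.le]
  have h3 : Real.exp (l / 2) / 2 ≤ Real.cosh ((2 * K - 1) * θ) := by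
    rw [Real.cosh_eq]
    have := Real.exp_le_exp.mpr h1
    have := Real.exp_pos (-((2 * K - 1) * θ))
    linarith
  rw [h2] at h3
  calc (1 : ℝ) = (√(11 * n) / q / 2) * (2 * q / √(11 * n)) := by field_simp
    _ ≤ _ := mul_le_mul h3 hc (by positivity) (by positivity)


/-! ## The uniform distribution on the sphere -/

section Sphere

/-- The volume of the unit ball in dimension `k`. -/
noncomputable def ballVol (k : ℕ) : ℝ := √Real.pi ^ k / Real.Gamma (k / 2 + 1)

lemma ballVol_pos (k : ℕ) : 0 < ballVol k :=
  div_pos (pow_pos (Real.sqrt_pos.mpr Real.pi_pos) _) (Real.Gamma_pos_of_pos (by positivity))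

/-- Log-convexity of `Γ` at the midpoint of `k / 2 + 1` and `k / 2 + 2` gives `Γ (k / 2 + 3 / 2) ≤
√(k / 2 + 1) Γ (k / 2 + 1)`. -/
lemma ballVol_le (k : ℕ) : ballVol k ≤ √((k + 2) / (2 * Real.pi)) * ballVol (k + 1) := by
  have hG := Real.Gamma_mul_add_mul_le_rpow_Gamma_mul_rpow_Gamma (s := (k : ℝ) / 2 + 1)
    (t := (k : ℝ) / 2 + 2) (a := 1 / 2) (b := 1 / 2) (by positivity) (by positivity)
    (by norm_num) (by norm_num) (by norm_num)
  have hg : 0 < Real.Gamma ((k : ℝ) / 2 + 1) := Real.Gamma_pos_of_pos (by positivity)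
  have e2 : Real.Gamma ((k : ℝ) / 2 + 2) = ((k : ℝ) / 2 + 1) * Real.Gamma ((k : ℝ) / 2 + 1) := by
    rw [show (k : ℝ) / 2 + 2 = ((k : ℝ) / 2 + 1) + 1 by ring,
      Real.Gamma_add_one (by positivity)]
  rw [e2, ← Real.sqrt_eq_rpow, ← Real.sqrt_eq_rpow, Real.sqrt_mul (by positivity),
    mul_left_comm, Real.mul_self_sqrt hg.le,
    show (1 / 2 * ((k : ℝ) / 2 + 1) + 1 / 2 * ((k : ℝ) / 2 + 2)) = ((k + 1 : ℕ) : ℝ) / 2 + 1 by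
      push_cast; ring] at hG
  have hg' : 0 < Real.Gamma (((k + 1 : ℕ) : ℝ) / 2 + 1) := Real.Gamma_pos_of_pos (by positivity)
  have hpi : 0 < √Real.pi := Real.sqrt_pos.mpr Real.pi_pos
  have e3 : √(((k : ℝ) + 2) / (2 * Real.pi)) = √((k : ℝ) / 2 + 1) / √Real.pi := by
    rw [← Real.sqrt_div (by positivity)]; congr 1; field_simp
  rw [ballVol, ballVol, e3, pow_succ, div_mul_div_comm, div_le_div_iff₀ hg (by positivity)]
  calc √Real.pi ^ k * (√Real.pi * Real.Gamma (((k + 1 : ℕ) : ℝ) / 2 + 1))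
      ≤ √Real.pi ^ k * (√Real.pi * (√((k : ℝ) / 2 + 1) * Real.Gamma ((k : ℝ) / 2 + 1))) := by
        gcongr
    _ = _ := by ring

lemma volume_unitBall_fin (k : ℕ) :
    volume (Metric.ball (0 : EuclideanSpace ℝ (Fin k)) 1) = ENNReal.ofReal (ballVol k) := by
  -- The case `k = 0` is the cross-section of a slab in dimension one.
  rcases Nat.eq_zero_or_pos k with rfl | hk
  · have h1 : Metric.ball (0 : EuclideanSpace ℝ (Fin 0)) 1 = Set.univ := by
      ext y; simp [Subsingleton.elim y 0]
    have h2 : (WithLp.toLp 2 : (Fin 0 → ℝ) → EuclideanSpace ℝ (Fin 0)) ⁻¹' Set.univ = Set.univ :=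
      rfl
    rw [h1, ← (PiLp.volume_preserving_toLp (Fin 0)).measure_preimage
      MeasurableSet.univ.nullMeasurableSet, h2, volume_pi, Measure.pi_univ]
    simp [ballVol]
  · have : Nonempty (Fin k) := ⟨⟨0, hk⟩⟩
    rw [EuclideanSpace.volume_ball]
    simp [ballVol]

variable {ι : Type} [Fintype ι]

/-- In an orthonormal basis whose first vector is `e`, the slab of the ball lies in the cylinder
over the unit ball of dimension `k` with height interval `(-τ, τ)`. -/
lemma volume_slab_le {k : ℕ} (hk : Fintype.card ι = k + 1) {e : Vec ι} (he : ‖e‖ = 1) {τ : ℝ}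
    (hτ : 0 ≤ τ) :
    volume {y : Vec ι | ‖y‖ < 1 ∧ |inner ℝ y e| < τ} ≤ ENNReal.ofReal (2 * τ * ballVol k) := by
  have hfr : Module.finrank ℝ (Vec ι) = Fintype.card (Fin (k + 1)) := by
    rw [finrank_euclideanSpace, Fintype.card_fin, hk]
  obtain ⟨b, hb⟩ := Orthonormal.exists_orthonormalBasis_extension_of_card_eq (𝕜 := ℝ) hfr
    (v := fun _ : Fin (k + 1) => e) (s := {0}) (by
      constructor
      · intro i; exact he
      · intro i j hij
        exact absurd (Subsingleton.elim i j) hij)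
  have hb0 : b 0 = e := hb 0 rfl
  let f : Vec ι → ℝ × (Fin k → ℝ) := fun y =>
    MeasurableEquiv.piFinSuccAbove (fun _ : Fin (k + 1) => ℝ) 0 (WithLp.ofLp (b.repr y))
  have hf : MeasurePreserving f volume volume :=
    (volume_preserving_piFinSuccAbove (fun _ : Fin (k + 1) => ℝ) 0).comp
      ((PiLp.volume_preserving_ofLp (Fin (k + 1))).comp b.measurePreserving_repr)
  have hball : MeasurableSet ((WithLp.toLp 2 : (Fin k → ℝ) → EuclideanSpace ℝ (Fin k)) ⁻¹'
      Metric.ball 0 1) :=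
    (PiLp.volume_preserving_toLp (Fin k)).measurable measurableSet_ball
  have hsub : {y : Vec ι | ‖y‖ < 1 ∧ |inner ℝ y e| < τ} ⊆
      f ⁻¹' (Set.Ioo (-τ) τ ×ˢ ((WithLp.toLp 2 : (Fin k → ℝ) → EuclideanSpace ℝ (Fin k)) ⁻¹'
        Metric.ball 0 1)) := by
    rintro y ⟨h1, h2⟩
    have e0 : b.repr y 0 = inner ℝ y e := by rw [b.repr_apply_apply, hb0, real_inner_comm]
    refine ⟨?_, ?_⟩
    · change b.repr y 0 ∈ Set.Ioo (-τ) τ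
      rw [e0]; exact abs_lt.mp h2
    · change (WithLp.toLp 2 (fun i : Fin k => b.repr y i.succ) : EuclideanSpace ℝ (Fin k)) ∈
        Metric.ball (0 : EuclideanSpace ℝ (Fin k)) 1
      rw [mem_ball_zero_iff]
      have h3 : ‖b.repr y‖ < 1 := by rwa [LinearIsometryEquiv.norm_map]
      refine lt_of_le_of_lt ?_ h3
      rw [EuclideanSpace.norm_eq, EuclideanSpace.norm_eq]
      refine Real.sqrt_le_sqrt ?_
      rw [Fin.sum_univ_succ]
      exact le_add_of_nonneg_left (sq_nonneg _)
  refine (measure_mono hsub).trans ?_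
  rw [hf.measure_preimage (measurableSet_Ioo.prod hball).nullMeasurableSet,
    Measure.volume_eq_prod, Measure.prod_prod, Real.volume_Ioo,
    (PiLp.volume_preserving_toLp (Fin k)).measure_preimage measurableSet_ball.nullMeasurableSet,
    volume_unitBall_fin, ← ENNReal.ofReal_mul (by linarith)]
  apply le_of_eq; congr 1; ring

open Pointwise in
/-- A uniformly random unit vector is unlikely to be almost orthogonal to a given vector. -/
lemma uniformSphere_slab_le [Nonempty ι] {e : Vec ι} (he : ‖e‖ = 1) {τ : ℝ} (hτ : 0 ≤ τ) :
    uniformSphere ι {x | |inner ℝ x.val e| < τ} ≤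
      ENNReal.ofReal (2 * τ * √((Fintype.card ι + 1) / (2 * Real.pi))) := by
  obtain ⟨k, hk⟩ : ∃ k, Fintype.card ι = k + 1 :=
    ⟨Fintype.card ι - 1, by have := Fintype.card_pos (α := ι); omega⟩
  have hmeas : MeasurableSet {x : Metric.sphere (0 : Vec ι) 1 | |inner ℝ x.val e| < τ} := by
    refine measurableSet_lt ?_ measurable_const
    fun_prop
  -- The sphere measure of a set is the dimension times the volume of the cone over it, and scaling
  -- by `r < 1` keeps that cone inside the slab.
  have hsub : Set.Ioo (0 : ℝ) 1 • ((↑) '' {x : Metric.sphere (0 : Vec ι) 1 | |inner ℝ x.val e| < τ})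
      ⊆ {y : Vec ι | ‖y‖ < 1 ∧ |inner ℝ y e| < τ} := by
    rintro _ ⟨r, ⟨hr0, hr1⟩, _, ⟨x, hx, rfl⟩, rfl⟩
    have hx : |inner ℝ x.val e| < τ := hx
    have hxn : ‖x.val‖ = 1 := by simp
    refine ⟨?_, ?_⟩
    · simp only [norm_smul, hxn, mul_one, Real.norm_eq_abs, abs_of_pos hr0]; exact hr1
    · simp only [real_inner_smul_left, abs_mul, abs_of_pos hr0]
      nlinarith [abs_nonneg (inner ℝ x.val e)]
  have hvol : (volume : Measure (Vec ι)).toSphere Set.univ =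
      (k + 1 : ℕ) * ENNReal.ofReal (ballVol (k + 1)) := by
    rw [Measure.toSphere_apply_univ, finrank_euclideanSpace, hk, EuclideanSpace.volume_ball, hk]
    simp [ballVol]
  have hV := ballVol_pos (k + 1)
  unfold uniformSphere
  rw [Measure.smul_apply, Measure.toSphere_apply' _ hmeas, hvol,
    finrank_euclideanSpace, hk, smul_eq_mul]
  have h1 := (measure_mono hsub).trans (volume_slab_le hk he hτ)
  have hne : ((k + 1 : ℕ) : ENNReal) * ENNReal.ofReal (ballVol (k + 1)) ≠ 0 := by
    simp [hV]
  have hnt : ((k + 1 : ℕ) : ENNReal) * ENNReal.ofReal (ballVol (k + 1)) ≠ ⊤ :=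
    ENNReal.mul_ne_top (ENNReal.natCast_ne_top _) ENNReal.ofReal_ne_top
  rw [mul_comm, ← div_eq_mul_inv, ENNReal.div_le_iff hne hnt]
  calc ((k + 1 : ℕ) : ENNReal) * volume _
      ≤ ((k + 1 : ℕ) : ENNReal) * ENNReal.ofReal (2 * τ * ballVol k) := by gcongr
    _ ≤ ((k + 1 : ℕ) : ENNReal) *
        ENNReal.ofReal (2 * τ * √((((k + 1 : ℕ) : ℝ) + 1) / (2 * Real.pi)) * ballVol (k + 1)) := by
        refine mul_le_mul_right (ENNReal.ofReal_le_ofReal ?_) _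
        have h2 := ballVol_le k
        have h3 : (((k + 1 : ℕ) : ℝ) + 1) = k + 2 := by push_cast; ring
        rw [h3, mul_assoc (2 * τ)]
        gcongr
    _ = _ := by
        rw [ENNReal.ofReal_mul (by positivity)]; ring

/-- The failure probability of the Lanczos method. -/
lemma uniformSphere_lanczos_le [Nonempty ι] {e : Vec ι} (he : ‖e‖ = 1) {q : ℝ} (hq : 0 ≤ q) :
    uniformSphere ι {x | |inner ℝ x.val e| < 2 * q / √(11 * Fintype.card ι)} ≤
      ENNReal.ofReal q := by
  have hn : (1 : ℝ) ≤ Fintype.card ι := by exact_mod_cast Fintype.card_pos (α := ι)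
  refine (uniformSphere_slab_le he (by positivity)).trans (ENNReal.ofReal_le_ofReal ?_)
  set n : ℝ := (Fintype.card ι : ℝ)
  have h1 : √((n + 1) / (2 * Real.pi)) ≤ √(n / Real.pi) := by
    refine Real.sqrt_le_sqrt ?_
    rw [div_le_div_iff₀ (by positivity) Real.pi_pos]
    nlinarith [Real.pi_pos]
  -- The constant `11` is justified here: `16 ≤ 11 π`.
  have h2 : 4 * √(n / Real.pi) ≤ √(11 * n) := by
    refine Real.le_sqrt_of_sq_le ?_
    rw [mul_pow, Real.sq_sqrt (by positivity), mul_div_assoc', div_le_iff₀ Real.pi_pos]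
    nlinarith [Real.pi_gt_three]
  have h3 : 0 < √(11 * n) := by positivity
  calc 2 * (2 * q / √(11 * n)) * √((n + 1) / (2 * Real.pi))
      ≤ 2 * (2 * q / √(11 * n)) * √(n / Real.pi) := by gcongr
    _ = q * (4 * √(n / Real.pi)) / √(11 * n) := by ring
    _ ≤ q := by
      rw [div_le_iff₀ h3]
      exact mul_le_mul_of_nonneg_left h2 hq

end Sphere


/-! ## Correctness of the oracles -/

section Oracles

variable {d : ℕ}

lemma symPart_isSymm {ι : Type} (A : Matrix ι ι ℝ) : (symPart A).IsSymm := by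
  unfold symPart Matrix.IsSymm
  rw [Matrix.transpose_smul, Matrix.transpose_add, Matrix.transpose_transpose, add_comm]

lemma symPart_eq_self {ι : Type} {A : Matrix ι ι ℝ} (hA : A.IsSymm) : symPart A = A := by
  unfold symPart
  rw [hA.eq, ← two_smul ℝ, smul_smul]
  norm_num

/-- For a typical start vector, the extreme Ritz values bound the spectrum. -/
lemma exists_forall_lanczos_bound {ι : Type} [Fintype ι] [DecidableEq ι] [Nonempty ι]
    {A : Matrix ι ι ℝ} (hA : A.IsSymm) {δ q : ℝ} (hδ : 0 < δ) (hq : 0 < q) (hq1 : q ≤ 1) :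
    ∃ e : Vec ι, ‖e‖ = 1 ∧ ∀ x : Vec ι, ‖x‖ = 1 →
      2 * q / √(11 * Fintype.card ι) ≤ |inner ℝ x e| →
      ∀ y, |inner ℝ (mulV A y) y| ≤ (1 + δ) * max 1
        (max (lanczosMaxVal A x (lanczosCount (Fintype.card ι) δ q))
          (-lanczosMinVal A x (lanczosCount (Fintype.card ι) δ q))) * ‖y‖ ^ 2 := by
  obtain ⟨Λ, e, hΛ, he, hAe, hbd⟩ := exists_dominant_eigenvector hA
  refine ⟨e, he, fun x hx hc y => (hbd y).trans ?_⟩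
  gcongr
  set K := lanczosCount (Fintype.card ι) δ q
  have hK : 1 ≤ K := one_le_lanczosCount Fintype.card_pos hq hq1
  have hc' := one_le_cosh_mul (Fintype.card_pos (α := ι)) hδ hq hq1 hc
  rcases hΛ.eq_or_lt with h0 | h0
  · rw [← h0]; positivity
  rcases hAe with hAe | hAe
  · refine (le_lanczosMaxVal hA hx he h0 hAe hbd hδ (lanczosAngle_pos hδ) (sinh_lanczosAngle_sq hδ)
      hK hc').trans ?_
    gcongr
    exact (le_max_left _ _).trans (le_max_right _ _)
  · refine (le_neg_lanczosMinVal hA hx he h0 hAe hbd hδ (lanczosAngle_pos hδ)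
      (sinh_lanczosAngle_sq hδ) hK hc').trans ?_
    gcongr
    exact (le_max_right _ _).trans (le_max_right _ _)

lemma extEvec_correct (hd : 0 < d) (W : Mat d) {δ q : ℝ} (hδ : 0 < δ) (hq : 0 < q) (hq1 : q ≤ 1) :
    ∃ e : Vec (Fin d), ‖e‖ = 1 ∧ ∀ x : Vec (Fin d), ‖x‖ = 1 →
      2 * q / √(11 * Fintype.card (Fin d)) ≤ |inner ℝ x e| →
      ∀ y, |inner ℝ (mulV W y) y| ≤
        (1 + δ) * max 1 (extEvec (symPart W) δ q x).γ * ‖y‖ ^ 2 := by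
  have : Nonempty (Fin d) := ⟨⟨0, hd⟩⟩
  obtain ⟨e, he, h⟩ := exists_forall_lanczos_bound (symPart_isSymm W) hδ hq hq1
  refine ⟨e, he, fun x hx hc y => ?_⟩
  have := h x hx hc y
  rw [inner_mulV_symPart, Fintype.card_fin] at this
  simpa only [extEvec, symPart_eq_self (symPart_isSymm W)] using this

/-- The block matrix with blocks `0, W, Wᵀ, 0`. -/
def hermitization (W : Mat d) : Matrix (Fin d ⊕ Fin d) (Fin d ⊕ Fin d) ℝ :=
  Matrix.fromBlocks 0 W W.transpose 0

lemma hermitization_isSymm (W : Mat d) : (hermitization W).IsSymm := by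
  unfold hermitization Matrix.IsSymm
  rw [Matrix.fromBlocks_transpose]; simp

/-- The vector with components `u, v`. -/
noncomputable def pairVec (u v : Vec (Fin d)) : Vec (Fin d ⊕ Fin d) :=
  WithLp.toLp 2 (Sum.elim u.ofLp v.ofLp)

lemma pairVec_eta (y : Vec (Fin d ⊕ Fin d)) : pairVec (WithLp.toLp 2 fun i => y (Sum.inl i))
    (WithLp.toLp 2 fun i => y (Sum.inr i)) = y := by
  ext i; cases i <;> rfl

lemma inner_pairVec (u v u' v' : Vec (Fin d)) :
    inner ℝ (pairVec u v) (pairVec u' v') = inner ℝ u u' + inner ℝ v v' := by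
  simp [inner_eq_dotProduct, pairVec, dotProduct]

lemma norm_pairVec_sq (u v : Vec (Fin d)) : ‖pairVec u v‖ ^ 2 = ‖u‖ ^ 2 + ‖v‖ ^ 2 := by
  rw [← real_inner_self_eq_norm_sq, inner_pairVec, real_inner_self_eq_norm_sq,
    real_inner_self_eq_norm_sq]

lemma mulV_hermitization (W : Mat d) (u v : Vec (Fin d)) :
    mulV (hermitization W) (pairVec u v) = pairVec (mulV W v) (mulV W.transpose u) := by
  simp [mulV, hermitization, pairVec, Matrix.fromBlocks_mulVec, Function.comp_def]

/-- The spectrum of the block matrix is symmetric about zero, so its largest eigenvalue alone is the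
dominant one and equals the operator norm of `W`. Only one Ritz value has to be accurate. -/
lemma maxSvec_correct (hd : 0 < d) (W : Mat d) {δ q : ℝ} (hδ : 0 < δ) (hq : 0 < q)
    (hq1 : q ≤ 1) :
    ∃ e : Vec (Fin d ⊕ Fin d), ‖e‖ = 1 ∧ ∀ x : Vec (Fin d ⊕ Fin d), ‖x‖ = 1 →
      2 * q / √(11 * Fintype.card (Fin d ⊕ Fin d)) ≤ |inner ℝ x e| →
      ∀ y, ‖mulV W y‖ ≤ 3 * (1 + δ) * max 1 (maxSvec W δ q x).γ * ‖y‖ := by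
  have : Nonempty (Fin d) := ⟨⟨0, hd⟩⟩
  have hcard : Fintype.card (Fin d ⊕ Fin d) = 2 * d := by simp; ring
  have hS := hermitization_isSymm W
  obtain ⟨Λ, e', hΛ, he', hAe', hbd⟩ := exists_dominant_eigenvector hS
  obtain ⟨e, he, hAe⟩ : ∃ e : Vec (Fin d ⊕ Fin d), ‖e‖ = 1 ∧ mulV (hermitization W) e = Λ • e := by
    rcases hAe' with h | h
    · exact ⟨e', he', h⟩
    -- Changing the sign of the second component turns an eigenvector for `-Λ` into one for `Λ`.
    · set u : Vec (Fin d) := WithLp.toLp 2 fun i => e' (Sum.inl i)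
      set v : Vec (Fin d) := WithLp.toLp 2 fun i => e' (Sum.inr i)
      have hp : pairVec u v = e' := pairVec_eta e'
      rw [← hp, mulV_hermitization] at h
      refine ⟨pairVec u (-v), ?_, ?_⟩
      · have h1 := norm_pairVec_sq u v
        have h2 := norm_pairVec_sq u (-v)
        rw [norm_neg, ← h1, hp, he'] at h2
        nlinarith [norm_nonneg (pairVec u (-v))]
      · rw [mulV_hermitization]
        ext i
        cases i with
        | inl i =>
          have := congrFun (congrArg WithLp.ofLp h) (Sum.inl i)
          simp only [pairVec, Sum.elim_inl, PiLp.smul_apply, smul_eq_mul] at this ⊢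
          rw [← mulL_apply, map_neg, mulL_apply]
          simp only [PiLp.neg_apply]
          rw [this]; ring
        | inr i =>
          have := congrFun (congrArg WithLp.ofLp h) (Sum.inr i)
          simp only [pairVec, Sum.elim_inr, PiLp.smul_apply, smul_eq_mul] at this ⊢
          rw [this]; simp
  have hop : ∀ y, ‖mulV W y‖ ≤ Λ * ‖y‖ := by
    intro y
    by_cases hz : ‖mulV W y‖ = 0
    · rw [hz]; positivity
    have hWy : 0 < ‖mulV W y‖ := lt_of_le_of_ne (norm_nonneg _) (Ne.symm hz)
    have hy : 0 < ‖y‖ := by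
      refine norm_pos_iff.mpr ?_
      rintro rfl
      rw [← mulL_apply, map_zero, norm_zero] at hz
      exact hz rfl
    -- The test pair has two components of equal norm `‖y‖`, the first parallel to `W y`; its
    -- quadratic form is `2 ‖y‖ ‖W y‖`.
    have h1 := (le_abs_self _).trans (hbd (pairVec ((‖y‖ / ‖mulV W y‖) • mulV W y) y))
    rw [mulV_hermitization, inner_pairVec, norm_pairVec_sq, norm_smul, inner_mulV_left W.transpose,
      Matrix.transpose_transpose, real_inner_smul_left, real_inner_smul_right,
      real_inner_self_eq_norm_sq, Real.norm_eq_abs, abs_of_pos (by positivity),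
      div_mul_cancel₀ _ hWy.ne'] at h1
    have h2 : ‖y‖ / ‖mulV W y‖ * ‖mulV W y‖ ^ 2 = ‖y‖ * ‖mulV W y‖ := by field_simp
    rw [h2] at h1
    nlinarith
  refine ⟨e, he, fun x hx hc y => (hop y).trans ?_⟩
  gcongr
  rw [mul_comm 3, mul_assoc]
  -- The oracle returns a third of the Ritz value, which is where the factor `3` in the norm bound
  -- originates.
  have hγ : max 1 (lanczosMaxVal (hermitization W) x (lanczosCount (2 * d) δ q)) ≤
      3 * max 1 (maxSvec W δ q x).γ := by
    have e1 : (maxSvec W δ q x).γ =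
      lanczosMaxVal (hermitization W) x (lanczosCount (2 * d) δ q) / 3 := rfl
    rw [e1]
    refine max_le ?_ ?_
    · linarith [le_max_left (1 : ℝ) (lanczosMaxVal (hermitization W) x (lanczosCount (2 * d) δ q) / 3)]
    · linarith [le_max_right (1 : ℝ) (lanczosMaxVal (hermitization W) x (lanczosCount (2 * d) δ q) / 3)]
  refine le_trans ?_ (mul_le_mul_of_nonneg_left hγ (by positivity))
  rcases hΛ.eq_or_lt with h0 | h0
  · rw [← h0]; positivity
  have hK : 1 ≤ lanczosCount (2 * d) δ q := one_le_lanczosCount (by omega) hq hq1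
  have hc' := one_le_cosh_mul (Fintype.card_pos (α := Fin d ⊕ Fin d)) hδ hq hq1 hc
  rw [hcard] at hc'
  refine (le_lanczosMaxVal hS hx he h0 hAe hbd hδ (lanczosAngle_pos hδ) (sinh_lanczosAngle_sq hδ)
      hK hc').trans ?_
  gcongr
  exact le_max_right _ _

namespace Input

variable (I : Input d)

/-- The answer of the oracles bounds the matrix as required. -/
def OracleGood (t : ℕ) (W : Mat d) (x : Sample d) : Prop :=
  (∀ y, |inner ℝ (mulV W y) y| ≤
      (1 + delta t) * max 1 (I.separation t W x).γ * ‖y‖ ^ 2) ∧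
    (¬ I.problem.IsMinimization → ∀ y, ‖mulV W y‖ ≤
      3 * (1 + delta t) * max 1 (I.separation t W x).γ * ‖y‖)

end Input

lemma delta_pos (t : ℕ) : 0 < delta t := by unfold delta; positivity

lemma isProbabilityMeasure_uniformSphere (ι : Type) [Fintype ι] [Nonempty ι] :
    IsProbabilityMeasure (uniformSphere ι) := by
  constructor
  unfold uniformSphere
  rw [Measure.smul_apply, smul_eq_mul]
  refine ENNReal.inv_mul_cancel ?_ (measure_ne_top _ _)
  have : Nontrivial (Vec ι) := inferInstance
  rw [Ne, Measure.measure_univ_eq_zero]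
  exact Measure.toSphere_ne_zero _

namespace Input

variable (I : Input d)

lemma separation_γ_ext_le (t : ℕ) (W : Mat d) (x : Sample d) :
    (extEvec (symPart W) (delta t) (I.failureProb t / 2) x.1.val).γ ≤
      (I.separation t W x).γ := by
  unfold separation
  cases I.problem <;> simp

lemma separation_γ_max_le (hmin : ¬ I.problem.IsMinimization) (t : ℕ) (W : Mat d) (x : Sample d) :
    (maxSvec W (delta t) (I.failureProb t / 2) x.2.val).γ ≤ (I.separation t W x).γ := by
  unfold separation
  cases h : I.problem <;> simp_all [Problem.IsMinimization]

/-- The oracles succeed with probability at least `1 - q_t`. -/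
lemma sampleLaw_not_oracleGood_le (hd : 0 < d) (t : ℕ) (hq : 0 < I.failureProb t)
    (hq1 : I.failureProb t ≤ 2) (W : Mat d) :
    sampleLaw d {x | ¬ I.OracleGood t W x} ≤ ENNReal.ofReal (I.failureProb t) := by
  have : Nonempty (Fin d) := ⟨⟨0, hd⟩⟩
  have := isProbabilityMeasure_uniformSphere (Fin d)
  have := isProbabilityMeasure_uniformSphere (Fin d ⊕ Fin d)
  set q := I.failureProb t / 2 with hqdef
  have hq0 : 0 < q := by positivity
  have hq2 : q ≤ 1 := by rw [hqdef]; linarith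
  have hδ := delta_pos t
  obtain ⟨e, he, h1⟩ := extEvec_correct hd W hδ hq0 hq2
  obtain ⟨e', he', h2⟩ := maxSvec_correct hd W hδ hq0 hq2
  set A : Set (Metric.sphere (0 : Vec (Fin d)) 1) :=
    {x | |inner ℝ x.val e| < 2 * q / √(11 * Fintype.card (Fin d))}
  set B : Set (Metric.sphere (0 : Vec (Fin d ⊕ Fin d)) 1) :=
    {x | |inner ℝ x.val e'| < 2 * q / √(11 * Fintype.card (Fin d ⊕ Fin d))}
  -- The vectors `e`, `e'` depend on `W` only, so a bad sample lies in one of two fixed slabs, each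
  -- of probability at most half of `q_t`.
  have hsub : {x | ¬ I.OracleGood t W x} ⊆ A ×ˢ Set.univ ∪ Set.univ ×ˢ B := by
    intro x hx
    by_contra hcon
    simp only [Set.mem_union, Set.mem_prod, Set.mem_univ, and_true, true_and, not_or] at hcon
    obtain ⟨hA, hB⟩ := hcon
    refine hx ⟨fun y => ?_, fun hmin y => ?_⟩
    · refine (h1 x.1.val (by simp) (not_lt.mp hA) y).trans ?_
      gcongr
      exact I.separation_γ_ext_le t W x
    · refine (h2 x.2.val (by simp) (not_lt.mp hB) y).trans ?_
      gcongr
      exact I.separation_γ_max_le hmin t W x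
  refine (measure_mono hsub).trans ((measure_union_le _ _).trans ?_)
  unfold sampleLaw
  rw [Measure.prod_prod, Measure.prod_prod, measure_univ, measure_univ, mul_one, one_mul]
  have h3 := add_le_add (uniformSphere_lanczos_le he hq0.le) (uniformSphere_lanczos_le he' hq0.le)
  refine h3.trans ?_
  rw [← ENNReal.ofReal_add hq0.le hq0.le]
  apply le_of_eq; congr 1; rw [hqdef]; ring

end Input

end Oracles


/-! ## Measurability -/

instance {m n : Type*} : MeasurableSpace (Matrix m n ℝ) :=
  inferInstanceAs (MeasurableSpace (m → n → ℝ))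

instance {m n : Type*} [Countable m] [Countable n] : BorelSpace (Matrix m n ℝ) :=
  inferInstanceAs (BorelSpace (m → n → ℝ))

instance {m n : Type*} [Countable m] [Countable n] : SecondCountableTopology (Matrix m n ℝ) :=
  inferInstanceAs (SecondCountableTopology (m → n → ℝ))

instance {m n : Type*} [Countable m] [Countable n] : PolishSpace (Matrix m n ℝ) :=
  inferInstanceAs (PolishSpace (m → n → ℝ))

/-! ### Measurable vectors, matrices and first indices -/

section Basic

variable {Ω : Type*} [MeasurableSpace Ω] {ι κ : Type} [Fintype ι] [Fintype κ]

omit [Fintype ι] [Fintype κ] in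
lemma measurable_matrix_iff {A : Ω → Matrix ι κ ℝ} :
    Measurable A ↔ ∀ i j, Measurable fun ω => A ω i j := by
  change @Measurable Ω (ι → κ → ℝ) _ _ A ↔ _
  refine ⟨fun h i j => (measurable_pi_apply j).comp ((measurable_pi_apply i).comp h), fun h => ?_⟩
  exact measurable_pi_iff.mpr fun i => measurable_pi_iff.mpr (h i)

omit [Fintype ι] [Fintype κ] in
lemma measurable_entry {A : Ω → Matrix ι κ ℝ} (hA : Measurable A) (i : ι) (j : κ) :
    Measurable fun ω => A ω i j := measurable_matrix_iff.mp hA i j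

lemma measurable_vec_iff {v : Ω → Vec ι} : Measurable v ↔ ∀ i, Measurable fun ω => v ω i := by
  constructor
  · intro h i
    exact (measurable_pi_apply i).comp ((PiLp.volume_preserving_ofLp ι).measurable.comp h)
  · intro h
    have := (PiLp.volume_preserving_toLp ι).measurable.comp (measurable_pi_iff.mpr h)
    exact this

lemma measurable_coord {v : Ω → Vec ι} (hv : Measurable v) (i : ι) :
    Measurable fun ω => v ω i := measurable_vec_iff.mp hv i

lemma measurable_mulV {A : Ω → Matrix ι ι ℝ} {v : Ω → Vec ι} (hA : Measurable A)
    (hv : Measurable v) : Measurable fun ω => mulV (A ω) (v ω) := by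
  refine measurable_vec_iff.mpr fun i => ?_
  have : (fun ω => mulV (A ω) (v ω) i) = fun ω => ∑ j, A ω i j * v ω j := rfl
  rw [this]
  exact Finset.measurable_sum _ fun j _ => (measurable_entry hA i j).mul (measurable_coord hv j)

lemma measurable_outer {u v : Ω → Vec ι} (hu : Measurable u) (hv : Measurable v) :
    Measurable fun ω => outer (u ω) (v ω) :=
  measurable_matrix_iff.mpr fun i j => (measurable_coord hu i).mul (measurable_coord hv j)

omit [Fintype ι] in
lemma measurable_transpose {A : Ω → Matrix ι ι ℝ} (hA : Measurable A) :
    Measurable fun ω => (A ω).transpose :=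
  measurable_matrix_iff.mpr fun i j => measurable_entry hA j i

lemma measurable_symPart {A : Ω → Matrix ι ι ℝ} (hA : Measurable A) :
    Measurable fun ω => symPart (A ω) := by
  have := (hA.add (measurable_transpose hA)).const_smul (1 / 2 : ℝ)
  exact this

/-- Substitution of a measurable natural number into a sequence of measurable functions. -/
lemma measurable_apply_nat {β : Type*} [MeasurableSpace β] {g : ℕ → Ω → β} {n : Ω → ℕ}
    (hg : ∀ k, Measurable (g k)) (hn : Measurable n) : Measurable fun ω => g (n ω) ω := by
  have : Measurable fun p : ℕ × Ω => g p.1 p.2 := measurable_from_prod_countable_right hg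
  exact this.comp (hn.prodMk measurable_id)

lemma measurable_firstIndex {P : Ω → ℕ → Prop} (hP : ∀ k, MeasurableSet {ω | P ω k}) :
    Measurable fun ω => (firstIndex (P ω)).toNat := by
  refine measurable_to_countable' fun n => ?_
  -- Since `⊤` is sent to `0`, the preimage of `0` also contains the points where no index satisfies
  -- `P`.
  have hrep : (fun ω => (firstIndex (P ω)).toNat) ⁻¹' {n} =
      ({ω | P ω n} ∩ ⋂ j ∈ Finset.range n, {ω | P ω j}ᶜ) ∪
        (if n = 0 then ⋂ j, {ω | P ω j}ᶜ else ∅) := by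
    ext ω
    simp only [Set.mem_preimage, Set.mem_singleton_iff, Set.mem_union, Set.mem_inter_iff,
      Set.mem_iInter, Set.mem_compl_iff, Finset.mem_range]
    by_cases hex : ∃ k, P ω k
    · obtain ⟨k, hk⟩ := hex
      obtain ⟨m, hm, hPm, -, hlt⟩ := exists_firstIndex_eq hk
      rw [hm, ENat.toNat_natCast]
      constructor
      · rintro rfl; exact Or.inl ⟨hPm, hlt⟩
      · rintro (⟨h1, h2⟩ | h)
        · rcases lt_trichotomy m n with h | h | h
          · exact absurd hPm (h2 m h)
          · exact h
          · exact absurd h1 (hlt n h)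
        · split_ifs at h with h0
          · exact absurd hPm (Set.mem_iInter.mp h m)
          · exact absurd h (Set.notMem_empty _)
    · have hnone : ∀ k, ¬ P ω k := fun k hk => hex ⟨k, hk⟩
      have htop : firstIndex (P ω) = ⊤ := by
        rw [firstIndex]; simp [hnone]
      rw [htop, ENat.toNat_top]
      constructor
      · rintro rfl
        right
        rw [if_pos rfl]
        exact Set.mem_iInter.mpr hnone
      · rintro (⟨h1, -⟩ | h)
        · exact absurd h1 (hnone n)
        · split_ifs at h with h0
          · exact h0.symm
          · exact absurd h (Set.notMem_empty _)
  rw [hrep]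
  refine MeasurableSet.union ?_ ?_
  · exact (hP n).inter (MeasurableSet.biInter (Set.to_countable _) fun j _ => (hP j).compl)
  · split_ifs
    · exact MeasurableSet.iInter fun j => (hP j).compl
    · exact MeasurableSet.empty

lemma toNat_firstIndex (P : ℕ → Prop) : (firstIndex P).toNat = sInf {k | P k} := by
  by_cases hex : ∃ k, P k
  · obtain ⟨k, hk⟩ := hex
    obtain ⟨m, hm, hPm, -, hlt⟩ := exists_firstIndex_eq hk
    rw [hm, ENat.toNat_natCast]
    refine le_antisymm ?_ (Nat.sInf_le hPm)
    exact not_lt.mp fun h => hlt _ h (Nat.sInf_mem ⟨k, hk⟩)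
  · have hnone : ∀ k, ¬ P k := fun k hk => hex ⟨k, hk⟩
    have : {k | P k} = ∅ := by ext k; simp [hnone]
    rw [this, Nat.sInf_empty, firstIndex]; simp [hnone]

end Basic

/-! ### The linear solver -/

section Solver

variable {Ω : Type*} [MeasurableSpace Ω] {d : ℕ}

/-- All components of a state of the linear solver that enter the computation are measurable. -/
structure MeasurableSolver (st : Ω → SolverState d) : Prop where
  s : Measurable fun ω => (st ω).s
  r : Measurable fun ω => (st ω).r
  p : Measurable fun ω => (st ω).p
  q : Measurable fun ω => (st ω).q
  γ : Measurable fun ω => (st ω).γ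

variable {A : Ω → Mat d} {b : Ω → Vec (Fin d)}

lemma measurableSolver_crStep (hA : Measurable A) {st : Ω → SolverState d}
    (h : MeasurableSolver st) : MeasurableSolver fun ω => crStep (A ω) (st ω) := by
  have hα : Measurable fun ω => (st ω).γ / ‖(st ω).q‖ ^ 2 := h.γ.div (h.q.norm.pow_const 2)
  have hr : Measurable fun ω => (st ω).r - ((st ω).γ / ‖(st ω).q‖ ^ 2) • (st ω).q :=
    h.r.sub (hα.smul h.q)
  have hv := measurable_mulV hA hr
  have hβ := (hv.inner (𝕜 := ℝ) hr).div h.γ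
  exact ⟨h.s.add (hα.smul h.p), hr, hr.add (hβ.smul h.p), hv.add (hβ.smul h.q), hv.inner hr⟩

lemma measurableSolver_cglsStep (hA : Measurable A) {st : Ω → SolverState d}
    (h : MeasurableSolver st) : MeasurableSolver fun ω => cglsStep (A ω) (st ω) := by
  have hq := measurable_mulV hA h.p
  have hα := h.γ.div (hq.norm.pow_const 2)
  have hr := h.r.sub (hα.smul hq)
  have hv := measurable_mulV (measurable_transpose hA) hr
  have hγ := hv.norm.pow_const 2
  have hβ := hγ.div h.γ
  exact ⟨h.s.add (hα.smul h.p), hr, hv.add (hβ.smul h.p), hq, hγ⟩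

lemma measurableSet_isSymm (hA : Measurable A) : MeasurableSet {ω | (A ω).IsSymm} :=
  measurableSet_eq_fun (measurable_transpose hA) hA

lemma measurableSolver_solverState (hA : Measurable A) (hb : Measurable b) (k : ℕ) :
    MeasurableSolver fun ω => solverState (A ω) (b ω) k := by
  have h1 : ∀ k, MeasurableSolver fun ω => (crStep (A ω))^[k] (crInit (A ω) (b ω)) := by
    intro k
    induction k with
    | zero =>
      have hv := measurable_mulV (measurable_transpose hA) hb
      exact ⟨measurable_const, hb, hb, hv, hv.inner hb⟩
    | succ k ih => simp only [crStep_iterate]; exact measurableSolver_crStep hA ih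
  have h2 : MeasurableSolver fun ω => (cglsStep (A ω))^[k] (cglsInit (A ω) (b ω)) := by
    induction k with
    | zero =>
      have hv := measurable_mulV (measurable_transpose hA) hb
      exact ⟨measurable_const, hb, hv, measurable_const, hv.inner hv⟩
    | succ k ih => simp only [cglsStep_iterate]; exact measurableSolver_cglsStep hA ih
  have hS := measurableSet_isSymm hA
  unfold solverState
  constructor <;> simp only [apply_ite]
  · exact Measurable.ite hS (h1 k).s h2.s
  · exact Measurable.ite hS (h1 k).r h2.r
  · exact Measurable.ite hS (h1 k).p h2.p
  · exact Measurable.ite hS (h1 k).q h2.q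
  · exact Measurable.ite hS (h1 k).γ h2.γ

lemma measurable_linearSolver (hA : Measurable A) (hb : Measurable b) (ρ : ℝ) :
    Measurable fun ω => linearSolver (A ω) (b ω) ρ := by
  unfold linearSolver solverStop
  refine measurable_apply_nat (g := fun k ω => (solverState (A ω) (b ω) k).s)
    (fun k => (measurableSolver_solverState hA hb k).s) (measurable_firstIndex fun k => ?_)
  have h := measurableSolver_solverState hA hb k
  exact measurableSet_le h.r.norm (h.s.norm.const_mul ρ)

end Solver

/-! ### The Lanczos method -/

section Lanczos

variable {Ω : Type*} [MeasurableSpace Ω] {ι : Type} [Fintype ι]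
  {W : Ω → Matrix ι ι ℝ} {x : Ω → Vec ι}

lemma measurable_lanczosSeq (hW : Measurable W) (hx : Measurable x) (k : ℕ) :
    (Measurable fun ω => (lanczosSeq (W ω) (x ω) k).vPrev) ∧
    (Measurable fun ω => (lanczosSeq (W ω) (x ω) k).v) ∧
    (Measurable fun ω => (lanczosSeq (W ω) (x ω) k).β) ∧
    (Measurable fun ω => (lanczosSeq (W ω) (x ω) k).alpha (W ω)) := by
  have key : ∀ st : Ω → LanczosState ι, (Measurable fun ω => (st ω).vPrev) →
      (Measurable fun ω => (st ω).v) → (Measurable fun ω => (st ω).β) →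
      Measurable fun ω => (st ω).alpha (W ω) := fun st h1 h2 h3 =>
    ((measurable_mulV hW h2).sub (h3.smul h1)).inner h2
  suffices (Measurable fun ω => (lanczosSeq (W ω) (x ω) k).vPrev) ∧
    (Measurable fun ω => (lanczosSeq (W ω) (x ω) k).v) ∧
    (Measurable fun ω => (lanczosSeq (W ω) (x ω) k).β) from
    ⟨this.1, this.2.1, this.2.2, key _ this.1 this.2.1 this.2.2⟩
  induction k with
  | zero => exact ⟨measurable_const, hx, measurable_const⟩
  | succ k ih =>
    obtain ⟨h1, h2, h3⟩ := ih
    have hw := ((measurable_mulV hW h2).sub (h3.smul h1)).sub ((key _ h1 h2 h3).smul h2)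
    simp only [lanczosSeq_succ]
    exact ⟨h2, hw.norm.inv.smul hw, hw.norm⟩

lemma measurable_lanczosDim (hW : Measurable W) (hx : Measurable x) (K : ℕ) :
    Measurable fun ω => lanczosDim (W ω) (x ω) K := by
  unfold lanczosDim
  simp only [← toNat_firstIndex]
  refine measurable_firstIndex fun m => ?_
  have : MeasurableSet {ω | (lanczosSeq (W ω) (x ω) m).β = 0} :=
    measurableSet_eq_fun (measurable_lanczosSeq hW hx m).2.2.1 measurable_const
  exact (MeasurableSet.const (1 ≤ m)).inter ((MeasurableSet.const (m = K)).union this)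

lemma measurable_lanczosMatrix (hW : Measurable W) (hx : Measurable x) (m : ℕ) :
    Measurable fun ω => lanczosMatrix (W ω) (x ω) m := by
  refine measurable_matrix_iff.mpr fun i j => ?_
  simp only [lanczosMatrix, Matrix.of_apply]
  split_ifs
  · exact (measurable_lanczosSeq hW hx i).2.2.2
  · exact (measurable_lanczosSeq hW hx j).2.2.1
  · exact (measurable_lanczosSeq hW hx i).2.2.1
  · exact measurable_const

lemma continuous_mulV_left (v : Vec ι) : Continuous fun A : Matrix ι ι ℝ => mulV A v := by
  unfold mulV
  exact (PiLp.continuous_toLp 2 _).comp (continuous_id.matrix_mulVec continuous_const)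

lemma measurable_maxEig {m : ℕ} {T : Ω → Mat m} (hT : Measurable T) (hs : ∀ ω, (T ω).IsHermitian) :
    Measurable fun ω => maxEig (T ω) := by
  rcases Nat.eq_zero_or_pos m with rfl | hm
  · have : (fun ω => maxEig (T ω)) = fun _ => maxEig (0 : Mat 0) := by
      funext ω; rw [Subsingleton.elim (T ω) 0]
    rw [this]; exact measurable_const
  refine measurable_of_Iic fun c => ?_
  have h1 : (fun ω => maxEig (T ω)) ⁻¹' Set.Iic c =
      T ⁻¹' {A | ∀ z : Vec (Fin m), inner ℝ (mulV A z) z ≤ c * ‖z‖ ^ 2} := by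
    ext ω; exact maxEig_le_iff hm (hs ω)
  rw [h1]
  refine hT (IsClosed.measurableSet ?_)
  simp only [Set.ofPred_forall]
  exact isClosed_iInter fun z => isClosed_le
    ((continuous_mulV_left z).inner continuous_const) continuous_const

lemma measurable_minEig {m : ℕ} {T : Ω → Mat m} (hT : Measurable T) (hs : ∀ ω, (T ω).IsHermitian) :
    Measurable fun ω => minEig (T ω) := by
  rcases Nat.eq_zero_or_pos m with rfl | hm
  · have : (fun ω => minEig (T ω)) = fun _ => minEig (0 : Mat 0) := by
      funext ω; rw [Subsingleton.elim (T ω) 0]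
    rw [this]; exact measurable_const
  refine measurable_of_Ici fun c => ?_
  have h1 : (fun ω => minEig (T ω)) ⁻¹' Set.Ici c =
      T ⁻¹' {A | ∀ z : Vec (Fin m), c * ‖z‖ ^ 2 ≤ inner ℝ (mulV A z) z} := by
    ext ω; exact le_minEig_iff hm (hs ω)
  rw [h1]
  refine hT (IsClosed.measurableSet ?_)
  simp only [Set.ofPred_forall]
  exact isClosed_iInter fun z => isClosed_le continuous_const
    ((continuous_mulV_left z).inner continuous_const)

lemma measurable_lanczosMaxVal (hW : Measurable W) (hx : Measurable x) (K : ℕ) :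
    Measurable fun ω => lanczosMaxVal (W ω) (x ω) K :=
  measurable_apply_nat (g := fun m ω => maxEig (lanczosMatrix (W ω) (x ω) m))
    (fun m => measurable_maxEig (measurable_lanczosMatrix hW hx m)
      fun _ => lanczosMatrix_isHermitian _ _ _) (measurable_lanczosDim hW hx K)

lemma measurable_lanczosMinVal (hW : Measurable W) (hx : Measurable x) (K : ℕ) :
    Measurable fun ω => lanczosMinVal (W ω) (x ω) K :=
  measurable_apply_nat (g := fun m ω => minEig (lanczosMatrix (W ω) (x ω) m))
    (fun m => measurable_minEig (measurable_lanczosMatrix hW hx m)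
      fun _ => lanczosMatrix_isHermitian _ _ _) (measurable_lanczosDim hW hx K)

/-- The symmetric tridiagonal matrices with nonzero off-diagonal entries. -/
def unreducedTridiagonal (m : ℕ) : Set (Mat m) :=
  {T | T.IsHermitian ∧ (∀ i j : Fin m, i.val + 1 = j.val → T i j ≠ 0) ∧
    ∀ i j : Fin m, i.val + 1 < j.val → T i j = 0}

lemma measurableSet_unreducedTridiagonal (m : ℕ) : MeasurableSet (unreducedTridiagonal m) := by
  unfold unreducedTridiagonal
  simp only [Set.ofPred_and, Set.ofPred_forall]
  have he : ∀ i j : Fin m, Measurable fun T : Mat m => T i j := fun i j =>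
    measurable_entry measurable_id i j
  refine MeasurableSet.inter ?_ (MeasurableSet.inter ?_ ?_)
  · exact measurableSet_eq_fun (measurable_transpose measurable_id) measurable_id
  · exact MeasurableSet.iInter fun i => MeasurableSet.iInter fun j => MeasurableSet.iInter fun _ =>
      (measurableSet_eq_fun (he i j) measurable_const).compl
  · exact MeasurableSet.iInter fun i => MeasurableSet.iInter fun j => MeasurableSet.iInter fun _ =>
      measurableSet_eq_fun (he i j) measurable_const

/-- The eigenvalues of an unreduced tridiagonal matrix are simple: an eigenvector is determined by
its first component. -/
lemma eigenvector_eq_zero {m : ℕ} {T : Mat m} (hT : T ∈ unreducedTridiagonal m) (hm : 0 < m) {t : ℝ}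
    {z : Vec (Fin m)} (hz : mulV T z = t • z) (h0 : z ⟨0, hm⟩ = 0) : z = 0 := by
  obtain ⟨-, hne, hzero⟩ := hT
  have key : ∀ k (hk : k < m), ∀ j (hj : j < m), j ≤ k → z ⟨j, hj⟩ = 0 := by
    intro k
    induction k with
    | zero => intro _ j hj hjk; obtain rfl : j = 0 := by omega
              exact h0
    | succ k ih =>
      intro hk j hj hjk
      rcases hjk.lt_or_eq with h | rfl
      · exact ih (by omega) j hj (by omega)
      -- Row `k` of the eigenvalue equation expresses entry `k + 1` through earlier entries, with a
      -- nonzero coefficient.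
      · have hrow := congrFun (congrArg WithLp.ofLp hz) ⟨k, by omega⟩
        have hrow : ∑ l, T ⟨k, by omega⟩ l * z l = t * z ⟨k, by omega⟩ := hrow
        rw [ih (by omega) k (by omega) le_rfl, mul_zero,
          Finset.sum_eq_single ⟨k + 1, hk⟩] at hrow
        · exact (mul_eq_zero.mp hrow).resolve_left (hne _ _ rfl)
        · intro l _ hl
          rcases Nat.lt_or_ge l.val (k + 1) with h | h
          · rw [ih (by omega) l.val l.2 (by omega), mul_zero]
          · have : l.val ≠ k + 1 := fun h' => hl (Fin.ext h')
            rw [hzero _ _ (by simp only; omega), zero_mul]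
        · intro h; exact absurd (Finset.mem_univ _) h
  ext i
  exact key i.val i.2 i.val i.2 le_rfl

/-- The spectral projection of a simple eigenvalue is characterized by linear equations. -/
lemma eq_outer_of_trace {m : ℕ} {T : Mat m} (hT : T ∈ unreducedTridiagonal m) (hm : 0 < m) {t : ℝ}
    {z : Vec (Fin m)} (hz1 : ‖z‖ = 1) (hz : mulV T z = t • z) {S : Mat m} (hS : S.IsSymm)
    (htr : S.trace = 1) (hTS : T * S = t • S) : S = outer z z := by
  have hz0 : z ⟨0, hm⟩ ≠ 0 := by
    intro h
    rw [eigenvector_eq_zero hT hm hz h, norm_zero] at hz1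
    exact zero_ne_one hz1
  -- Each column of `S` is in the eigenspace, hence a multiple of `z`. Symmetry then makes the
  -- multipliers proportional to `z`, and the trace fixes the remaining scalar.
  have hcol : ∀ j, ∃ c : ℝ, ∀ i, S i j = c * z i := by
    intro j
    set w : Vec (Fin m) := WithLp.toLp 2 fun i => S i j
    have hw : mulV T w = t • w := by
      ext i
      exact congrFun (congrFun hTS i) j
    set c := w ⟨0, hm⟩ / z ⟨0, hm⟩
    have h1 : w - c • z = 0 := by
      refine eigenvector_eq_zero hT hm (t := t) ?_ ?_
      · rw [← mulL_apply, map_sub, map_smul, mulL_apply, mulL_apply, hw, hz, smul_sub, smul_comm]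
      · simp only [PiLp.sub_apply, PiLp.smul_apply, smul_eq_mul, c]
        rw [div_mul_cancel₀ _ hz0, sub_self]
    refine ⟨c, fun i => ?_⟩
    have h2 := congrFun (congrArg WithLp.ofLp h1) i
    simp only [PiLp.sub_apply, PiLp.smul_apply, smul_eq_mul] at h2
    have : w i = S i j := rfl
    rw [← this]
    have h3 : w i - c * z i = 0 := h2
    linarith
  choose c hc using hcol
  have hcz : ∀ j, c j = c ⟨0, hm⟩ / z ⟨0, hm⟩ * z j := by
    intro j
    have h1 : S ⟨0, hm⟩ j = S j ⟨0, hm⟩ := congrFun (congrFun hS j) ⟨0, hm⟩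
    rw [hc, hc] at h1
    field_simp
    linarith
  set a := c ⟨0, hm⟩ / z ⟨0, hm⟩
  have hS' : ∀ i j, S i j = a * (z i * z j) := fun i j => by rw [hc, hcz]; ring
  have ha : a = 1 := by
    have h1 : S.trace = a * ‖z‖ ^ 2 := by
      rw [← real_inner_self_eq_norm_sq, inner_eq_dotProduct, dotProduct, Finset.mul_sum]
      exact Finset.sum_congr rfl fun i _ => hS' i i
    rw [htr, hz1] at h1
    linarith
  ext i j
  rw [hS', ha, one_mul]
  rfl

open Classical in
/-- The spectral projection for the eigenvalue `f T` of an unreduced tridiagonal matrix `T`, zero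
for other matrices. -/
noncomputable def tridiagonalProjection {m : ℕ} (f : Mat m → ℝ) (T : Mat m) : Mat m :=
  if T ∈ unreducedTridiagonal m then outer (unitEigenvector T (f T)) (unitEigenvector T (f T))
  else 0

/-- The eigenvector is a mere choice, but its projection is the unique solution of measurable
equations. The part of the graph over a Borel set `B` is thus a Borel set on which the first
coordinate is injective, and its image is Borel by Lusin–Souslin. The map `f` is precomposed with
`symPart` because its measurability is known on symmetric matrices only. -/
lemma measurable_tridiagonalProjection {m : ℕ} {f : Mat m → ℝ}
    (hf : Measurable fun T => f (symPart T))
    (hev : 0 < m → ∀ T : Mat m, T.IsHermitian → ∃ z : Vec (Fin m), ‖z‖ = 1 ∧ mulV T z = f T • z) :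
    Measurable (tridiagonalProjection f) := by
  rcases Nat.eq_zero_or_pos m with rfl | hm
  · exact measurable_of_subsingleton_codomain _
  have hU := measurableSet_unreducedTridiagonal m
  refine fun B hB => ?_
  set G : Set (Mat m × Mat m) := {p | p.1 ∈ unreducedTridiagonal m ∧ p.2.IsSymm ∧ p.2.trace = 1 ∧
    (p.1 * p.2 = f (symPart p.1) • p.2 ∧ p.2 ∈ B)} with hG
  have h1 : Measurable fun p : Mat m × Mat m => p.1 := measurable_fst
  have h2 : Measurable fun p : Mat m × Mat m => p.2 := measurable_snd
  have hGm : MeasurableSet G := by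
    refine (h1 hU).inter ((measurableSet_isSymm h2).inter (MeasurableSet.inter ?_
      (MeasurableSet.inter ?_ (h2 hB))))
    · refine measurableSet_eq_fun ?_ measurable_const
      exact Finset.measurable_sum _ fun i _ => measurable_entry h2 i i
    · refine measurableSet_eq_fun ?_ ((hf.comp h1).smul h2)
      refine measurable_matrix_iff.mpr fun i j => ?_
      have := Finset.measurable_sum Finset.univ fun k _ =>
        (measurable_entry h1 i k).mul (measurable_entry h2 k j)
      exact this
  have hspec : ∀ {T S : Mat m}, T ∈ unreducedTridiagonal m → S.IsSymm → S.trace = 1 →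
      T * S = f (symPart T) • S → S = tridiagonalProjection f T := by
    intro T S hT hS htr hTS
    have hTs : T.IsSymm := hT.1
    rw [symPart_eq_self hTs] at hTS
    obtain ⟨hz1, hz⟩ := unitEigenvector_spec (hev hm T hT.1)
    rw [tridiagonalProjection, if_pos hT]
    exact eq_outer_of_trace hT hm hz1 hz hS htr hTS
  have hinj : Set.InjOn Prod.fst G := by
    rintro ⟨T, S⟩ ⟨hT, hS, htr, hTS, -⟩ ⟨T', S'⟩ ⟨hT', hS', htr', hTS', -⟩ (rfl : T = T')
    exact Prod.ext rfl ((hspec hT hS htr hTS).trans (hspec hT' hS' htr' hTS').symm)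
  have himg : Prod.fst '' G = unreducedTridiagonal m ∩ tridiagonalProjection f ⁻¹' B := by
    ext T
    constructor
    · rintro ⟨⟨T, S⟩, ⟨hT, hS, htr, hTS, hB⟩, rfl⟩
      refine ⟨hT, ?_⟩
      rw [Set.mem_preimage, ← hspec hT hS htr hTS]; exact hB
    · rintro ⟨hT, hB⟩
      refine ⟨(T, tridiagonalProjection f T), ⟨hT, ?_, ?_, ?_, hB⟩, rfl⟩ <;>
        simp only [tridiagonalProjection, if_pos hT]
      · exact Matrix.ext fun i j => mul_comm _ _
      · obtain ⟨hz1, -⟩ := unitEigenvector_spec (hev hm T hT.1)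
        have h1 : ‖unitEigenvector T (f T)‖ ^ 2 = 1 := by rw [hz1, one_pow]
        rw [← real_inner_self_eq_norm_sq, inner_eq_dotProduct] at h1
        exact h1
      · obtain ⟨-, hz⟩ := unitEigenvector_spec (hev hm T hT.1)
        have hTs : T.IsSymm := hT.1
        rw [symPart_eq_self hTs, outer, Matrix.mul_vecMulVec]
        have hz' : T.mulVec (unitEigenvector T (f T)).ofLp = f T • (unitEigenvector T (f T)).ofLp :=
          congrArg WithLp.ofLp hz
        rw [hz', Matrix.smul_vecMulVec]
  have hmeas : MeasurableSet (Prod.fst '' G) := hGm.image_of_measurable_injOn measurable_fst hinj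
  have hsplit : tridiagonalProjection f ⁻¹' B = Prod.fst '' G ∪
      ((unreducedTridiagonal m)ᶜ ∩ {_T | (0 : Mat m) ∈ B}) := by
    rw [himg]
    ext T
    by_cases hT : T ∈ unreducedTridiagonal m
    · simp [hT]
    · simp [hT, tridiagonalProjection]
  rw [hsplit]
  exact hmeas.union (hU.compl.inter (MeasurableSet.const _))

/-- The rank-one matrix formed with an extreme Ritz vector is a measurable function. -/
lemma measurable_outer_ritz (f : ∀ m, Mat m → ℝ) (hf : ∀ m, Measurable fun T => f m (symPart T))
    (hev : ∀ m, 0 < m → ∀ T : Mat m, T.IsHermitian →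
      ∃ z : Vec (Fin m), ‖z‖ = 1 ∧ mulV T z = f m T • z)
    (hW : Measurable W) (hx : Measurable x) (K : ℕ) :
    Measurable fun ω =>
      let m := lanczosDim (W ω) (x ω) K
      let T := lanczosMatrix (W ω) (x ω) m
      let u := lanczosCombine (W ω) (x ω) (unitEigenvector T (f m T))
      outer u u := by
  -- For `u = ∑ z_i v_i`, the matrix `u uᵀ` depends on `z` only through `z zᵀ`, which removes the
  -- arbitrary sign.
  let g : ℕ → Ω → Matrix ι ι ℝ := fun m ω => ∑ i : Fin m, ∑ j : Fin m,
    tridiagonalProjection (f m) (lanczosMatrix (W ω) (x ω) m) i j •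
      outer (lanczosSeq (W ω) (x ω) i).v (lanczosSeq (W ω) (x ω) j).v
  have hrep : ∀ ω, (let m := lanczosDim (W ω) (x ω) K
      let T := lanczosMatrix (W ω) (x ω) m
      let u := lanczosCombine (W ω) (x ω) (unitEigenvector T (f m T))
      outer u u) = g (lanczosDim (W ω) (x ω) K) ω := by
    intro ω
    have hne : ∀ j, 1 ≤ j → j < lanczosDim (W ω) (x ω) K → (lanczosSeq (W ω) (x ω) j).β ≠ 0 :=
      fun j h1 h2 h3 => absurd (Nat.sInf_le
        (s := {m | 1 ≤ m ∧ (m = K ∨ (lanczosSeq (W ω) (x ω) m).β = 0)}) ⟨h1, Or.inr h3⟩)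
        (not_le.mpr h2)
    simp only [g]
    set m := lanczosDim (W ω) (x ω) K
    have hT : lanczosMatrix (W ω) (x ω) m ∈ unreducedTridiagonal m := by
      refine ⟨lanczosMatrix_isHermitian _ _ _, fun i j hij => ?_, fun i j hij => ?_⟩
      · have h1 : i ≠ j := fun h => by rw [h] at hij; omega
        simp only [lanczosMatrix, Matrix.of_apply, if_neg h1, if_pos hij]
        exact hne j (by omega) j.2
      · have h1 : i ≠ j := fun h => by rw [h] at hij; omega
        have h2 : ¬ i.val + 1 = j.val := by omega
        have h3 : ¬ j.val + 1 = i.val := by omega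
        simp only [lanczosMatrix, Matrix.of_apply, if_neg h1, if_neg h2, if_neg h3]
    set z := unitEigenvector (lanczosMatrix (W ω) (x ω) m) (f m (lanczosMatrix (W ω) (x ω) m))
    have hp : tridiagonalProjection (f m) (lanczosMatrix (W ω) (x ω) m) = outer z z := by
      rw [tridiagonalProjection, if_pos hT]
    rw [hp]
    ext a b
    simp only [Matrix.sum_apply, Matrix.smul_apply, smul_eq_mul]
    simp only [outer, Matrix.vecMulVec_apply, lanczosCombine, WithLp.ofLp_sum, WithLp.ofLp_smul,
      Finset.sum_apply, Pi.smul_apply, smul_eq_mul]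
    rw [Finset.sum_mul_sum]
    refine Finset.sum_congr rfl fun i _ => Finset.sum_congr rfl fun j _ => ?_
    ring
  rw [funext hrep]
  refine measurable_apply_nat (g := g) (fun m => ?_) (measurable_lanczosDim hW hx K)
  refine Finset.measurable_sum _ fun i _ => Finset.measurable_sum _ fun j _ => ?_
  have hc : Measurable fun ω =>
      tridiagonalProjection (f m) (lanczosMatrix (W ω) (x ω) m) i j :=
    measurable_entry ((measurable_tridiagonalProjection (hf m) (hev m)).comp
      (measurable_lanczosMatrix hW hx m)) i j
  exact hc.smul (measurable_outer (measurable_lanczosSeq hW hx i).2.1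
    (measurable_lanczosSeq hW hx j).2.1)

lemma measurable_outer_lanczosMaxVec (hW : Measurable W) (hx : Measurable x) (K : ℕ) :
    Measurable fun ω => outer (lanczosMaxVec (W ω) (x ω) K) (lanczosMaxVec (W ω) (x ω) K) :=
  measurable_outer_ritz (fun _ => maxEig)
    (fun _ => measurable_maxEig (measurable_symPart measurable_id) fun T => symPart_isSymm T)
    (fun _ hm _ hT => exists_eigenvector_maxEig hm hT) hW hx K

lemma measurable_outer_lanczosMinVec (hW : Measurable W) (hx : Measurable x) (K : ℕ) :
    Measurable fun ω => outer (lanczosMinVec (W ω) (x ω) K) (lanczosMinVec (W ω) (x ω) K) :=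
  measurable_outer_ritz (fun _ => minEig)
    (fun _ => measurable_minEig (measurable_symPart measurable_id) fun T => symPart_isSymm T)
    (fun _ hm _ hT => exists_eigenvector_minEig hm hT) hW hx K

end Lanczos


/-! ### Measurability of the oracle answers -/

section OracleMeasurability

variable {Ω : Type*} [MeasurableSpace Ω] {d : ℕ}

lemma measurable_ite_le {β : Type*} [MeasurableSpace β] {γ : Ω → ℝ} {f g : Ω → β} {c : ℝ}
    (hγ : Measurable γ) (hf : Measurable f) (hg : Measurable g) :
    Measurable fun ω => if γ ω ≤ c then f ω else g ω :=
  Measurable.ite (measurableSet_le hγ measurable_const) hf hg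

lemma measurable_extEvec {W : Ω → Mat d} {x : Ω → Vec (Fin d)} (hW : Measurable W)
    (hx : Measurable x) (δ q : ℝ) :
    (Measurable fun ω => (extEvec (W ω) δ q (x ω)).γ) ∧
      Measurable fun ω => (extEvec (W ω) δ q (x ω)).S := by
  have hW' := measurable_symPart hW
  have hhi := measurable_lanczosMaxVal hW' hx (lanczosCount d δ q)
  have hlo := (measurable_lanczosMinVal hW' hx (lanczosCount d δ q)).neg
  have hγ := hhi.max hlo
  refine ⟨hγ, ?_⟩
  simp only [extEvec]
  refine Measurable.ite (measurableSet_le hγ measurable_const) measurable_const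
    (Measurable.ite (measurableSet_le hlo hhi) ?_ ?_)
  · exact measurable_outer_lanczosMaxVec hW' hx _
  · exact (measurable_outer_lanczosMinVec hW' hx _).neg

lemma measurable_hermitization {W : Ω → Mat d} (hW : Measurable W) :
    Measurable fun ω => hermitization (W ω) := by
  refine measurable_matrix_iff.mpr fun i j => ?_
  rcases i with i | i <;> rcases j with j | j
  · exact measurable_const
  · exact measurable_entry hW i j
  · exact measurable_entry hW j i
  · exact measurable_const

lemma measurable_maxSvec {W : Ω → Mat d} {x : Ω → Vec (Fin d ⊕ Fin d)} (hW : Measurable W)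
    (hx : Measurable x) (δ q : ℝ) :
    (Measurable fun ω => (maxSvec (W ω) δ q (x ω)).γ) ∧
      Measurable fun ω => (maxSvec (W ω) δ q (x ω)).S := by
  have hW' := measurable_hermitization hW
  have hγ := (measurable_lanczosMaxVal hW' hx (lanczosCount (2 * d) δ q)).div_const 3
  refine ⟨hγ, ?_⟩
  have ho := measurable_outer_lanczosMaxVec hW' hx (lanczosCount (2 * d) δ q)
  simp only [maxSvec]
  refine Measurable.ite (measurableSet_le hγ measurable_const) measurable_const ?_
  refine measurable_matrix_iff.mpr fun i j => ?_
  exact (measurable_entry ho (Sum.inl i) (Sum.inr j)).const_mul (2 / 3)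

lemma frobProj_add_smul (L : Submodule ℝ (Mat d)) (c : ℝ) (A B : Mat d) :
    frobProj L (A + B) = frobProj L A + frobProj L B ∧ frobProj L (c • A) = c • frobProj L A := by
  simp [frobProj]

lemma measurable_frobProj (L : Submodule ℝ (Mat d)) : Measurable (frobProj L) := by
  let f : Mat d →ₗ[ℝ] Mat d :=
    { toFun := frobProj L
      map_add' := fun A B => (frobProj_add_smul L 0 A B).1
      map_smul' := fun c A => (frobProj_add_smul L c A 0).2 }
  exact (LinearMap.continuous_of_finiteDimensional f).measurable

lemma continuous_vecEquiv : Continuous (vecEquiv d) :=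
  LinearMap.continuous_of_finiteDimensional (vecEquiv d).toLinearMap

lemma measurable_frobNorm : Measurable (frobNorm (d := d)) :=
  continuous_vecEquiv.norm.measurable

lemma measurable_frobInner {A B : Ω → Mat d} (hA : Measurable A) (hB : Measurable B) :
    Measurable fun ω => frobInner (A ω) (B ω) := by
  have h := (continuous_vecEquiv (d := d)).measurable
  exact (h.comp hA).inner (h.comp hB)

namespace Input

variable (I : Input d)

lemma measurable_separation {W : Ω → Mat d} {x : Ω → Sample d} (hW : Measurable W)
    (hx : Measurable x) (t : ℕ) :
    (Measurable fun ω => (I.separation t (W ω) (x ω)).γ) ∧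
      Measurable fun ω => (I.separation t (W ω) (x ω)).S := by
  have he := measurable_extEvec (measurable_symPart hW)
    (measurable_subtype_coe.comp (measurable_fst.comp hx)) (delta t) (I.failureProb t / 2)
  have hs := measurable_maxSvec hW
    (measurable_subtype_coe.comp (measurable_snd.comp hx)) (delta t) (I.failureProb t / 2)
  have hP := measurable_frobProj I.L
  have hmix : (Measurable fun ω => max
      (extEvec (symPart (W ω)) (delta t) (I.failureProb t / 2) (x ω).1.val).γ
      (maxSvec (W ω) (delta t) (I.failureProb t / 2) (x ω).2.val).γ) ∧
      Measurable fun ω => frobProj I.L (if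
        (maxSvec (W ω) (delta t) (I.failureProb t / 2) (x ω).2.val).γ ≤
        (extEvec (symPart (W ω)) (delta t) (I.failureProb t / 2) (x ω).1.val).γ then
        (extEvec (symPart (W ω)) (delta t) (I.failureProb t / 2) (x ω).1.val).S else
        (maxSvec (W ω) (delta t) (I.failureProb t / 2) (x ω).2.val).S) :=
    ⟨he.1.max hs.1, hP.comp (Measurable.ite (measurableSet_le hs.1 he.1) he.2 hs.2)⟩
  unfold separation
  cases I.problem with
  | minimization f => exact ⟨he.1, hP.comp he.2⟩
  | equation F => exact hmix
  | minimax m f => exact hmix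

lemma measurableSet_oracleGood {W : Ω → Mat d} {x : Ω → Sample d} (hW : Measurable W)
    (hx : Measurable x) (t : ℕ) : MeasurableSet {ω | I.OracleGood t (W ω) (x ω)} := by
  have hγ := (I.measurable_separation hW hx t).1
  have hp : Measurable fun ω => (W ω, (I.separation t (W ω) (x ω)).γ) := hW.prodMk hγ
  have hc : ∀ y, Continuous fun p : Mat d × ℝ => mulV p.1 y := fun y =>
    (continuous_mulV_left y).comp continuous_fst
  have h1 : IsClosed {p : Mat d × ℝ | ∀ y, |inner ℝ (mulV p.1 y) y| ≤
      (1 + delta t) * max 1 p.2 * ‖y‖ ^ 2} := by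
    simp only [Set.ofPred_forall]
    exact isClosed_iInter fun y => isClosed_le ((hc y).inner continuous_const).abs (by fun_prop)
  have h2 : IsClosed {p : Mat d × ℝ | ∀ y, ‖mulV p.1 y‖ ≤
      3 * (1 + delta t) * max 1 p.2 * ‖y‖} := by
    simp only [Set.ofPred_forall]
    exact isClosed_iInter fun y => isClosed_le (hc y).norm (by fun_prop)
  refine (hp h1.measurableSet).inter ?_
  by_cases hmin : I.problem.IsMinimization
  · have : {ω | ¬ I.problem.IsMinimization → ∀ y, ‖mulV (W ω) y‖ ≤
        3 * (1 + delta t) * max 1 (I.separation t (W ω) (x ω)).γ * ‖y‖} = Set.univ := by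
      ext ω; simp [hmin]
    have h : MeasurableSet (Set.univ : Set Ω) := MeasurableSet.univ
    rw [← this] at h
    exact h
  · have : {ω | ¬ I.problem.IsMinimization → ∀ y, ‖mulV (W ω) y‖ ≤
        3 * (1 + delta t) * max 1 (I.separation t (W ω) (x ω)).γ * ‖y‖} =
        (fun ω => (W ω, (I.separation t (W ω) (x ω)).γ)) ⁻¹' {p : Mat d × ℝ | ∀ y, ‖mulV p.1 y‖ ≤
      3 * (1 + delta t) * max 1 p.2 * ‖y‖} := by
      ext ω; simp [hmin]
    have h := hp h2.measurableSet
    rw [← this] at h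
    exact h

end Input

end OracleMeasurability

/-! ### The states of the method -/

section StateMeasurability

variable {Ω : Type*} [MeasurableSpace Ω] {d : ℕ}

/-- All components of a state of the method that enter the computation are measurable. -/
structure MeasurableState (st : Ω → Input.State d) : Prop where
  z : Measurable fun ω => (st ω).z
  σ : Measurable fun ω => (st ω).σ
  t : Measurable fun ω => (st ω).t
  W : Measurable fun ω => (st ω).W
  γ : Measurable fun ω => (st ω).γ
  S : Measurable fun ω => (st ω).S
  B : Measurable fun ω => (st ω).B
  pending : Measurable fun ω => (st ω).pending

namespace Input

variable (I : Input d)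

/-- The number of rejected trials in the line search of an iteration. -/
noncomputable def rejections (st : State d) : ℕ := (I.backtracks st.B st.z st.σ).toNat

/-- The part of an iteration that does not concern the Jacobian update. -/
noncomputable def extragradientStep (st : State d) : State d :=
  { st with
    z := st.z - I.trialStep st.σ (I.rejections st) •
      I.problem.operator (I.trialPoint st.B st.z st.σ (I.rejections st))
    σ := I.trialStep st.σ (I.rejections st) / I.β
    evals := st.evals + (1 + (I.backtracks st.B st.z st.σ + 1))
    solverMv := st.solverMv + I.lineSearchCost st.B st.z st.σ }

/-- The gradient step of the Jacobian update. -/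
noncomputable def jacobianStep (st : State d) : Mat d :=
  let ztil := I.trialPoint st.B st.z st.σ (I.rejections st - 1)
  let G := (1 / I.L₁) • frobProj I.L
    (lossGradient (I.problem.operator ztil - I.problem.operator st.z) (ztil - st.z) st.B)
  let Gtil := if st.γ ≤ 1 then G else G + max 0 (-(1 / st.γ) * frobInner G st.W) • st.S
  st.W - I.ρ • Gtil

lemma iterate_eq (st : State d) : I.iterate st = if I.rejections st = 0 then I.extragradientStep st
    else { I.extragradientStep st with
      t := st.t + 1
      W := (√d / max (√d) (frobNorm (I.jacobianStep st))) • I.jacobianStep st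
      pending := true } := rfl

lemma measurableState_refresh {ξ : Ω → ℕ → Sample d} (hξ : ∀ t, Measurable fun ω => ξ ω t)
    {st : Ω → State d} (h : MeasurableState st) :
    MeasurableState fun ω => I.refresh (ξ ω) (st ω) := by
  have hp : MeasurableSet {ω | (st ω).pending = true} := h.pending (MeasurableSet.singleton true)
  have hγ : Measurable fun ω => (I.separation (st ω).t (st ω).W (ξ ω (st ω).t)).γ :=
    measurable_apply_nat (g := fun t ω => (I.separation t (st ω).W (ξ ω t)).γ)
      (fun t => (I.measurable_separation h.W (hξ t) t).1) h.t
  have hS : Measurable fun ω => (I.separation (st ω).t (st ω).W (ξ ω (st ω).t)).S :=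
    measurable_apply_nat (g := fun t ω => (I.separation t (st ω).W (ξ ω t)).S)
      (fun t => (I.measurable_separation h.W (hξ t) t).2) h.t
  have hδ : Measurable fun ω => delta (st ω).t := (measurable_from_nat (f := delta)).comp h.t
  have hδ1 : Measurable fun ω => 1 + delta (st ω).t := hδ.const_add 1
  unfold refresh
  constructor <;> simp only [apply_ite]
  · exact Measurable.ite hp h.z h.z
  · exact Measurable.ite hp h.σ h.σ
  · exact Measurable.ite hp h.t h.t
  · exact Measurable.ite hp h.W h.W
  · exact Measurable.ite hp hγ h.γ
  · exact Measurable.ite hp hS h.S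
  · refine Measurable.ite hp ?_ h.B
    have h1 := measurable_ite_le (c := 1) hγ
      (((hδ1.const_div 1).smul h.W).const_smul I.L₁)
      ((((hδ1.mul hγ).const_div 1).smul h.W).const_smul I.L₁)
    exact h1.add measurable_const
  · exact Measurable.ite hp measurable_const h.pending

variable {I} (hF : Measurable I.problem.operator)

include hF

lemma measurable_trialPoint {B : Ω → Mat d} {z : Ω → Vec (Fin d)} {σ : Ω → ℝ}
    (hB : Measurable B) (hz : Measurable z) (hσ : Measurable σ) (i : ℕ) :
    Measurable fun ω => I.trialPoint (B ω) (z ω) (σ ω) i := by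
  have hs : Measurable fun ω => I.trialStep (σ ω) i := hσ.mul_const _
  refine hz.add (measurable_linearSolver ?_ ?_ I.α₁)
  · exact (hs.smul hB).const_add 1
  · exact (hs.smul (hF.comp hz)).neg

lemma measurable_backtracks {B : Ω → Mat d} {z : Ω → Vec (Fin d)} {σ : Ω → ℝ}
    (hB : Measurable B) (hz : Measurable z) (hσ : Measurable σ) :
    Measurable fun ω => (I.backtracks (B ω) (z ω) (σ ω)).toNat := by
  refine measurable_firstIndex fun i => ?_
  have hs : Measurable fun ω => I.trialStep (σ ω) i := hσ.mul_const _
  have hp := measurable_trialPoint hF hB hz hσ i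
  exact measurableSet_le ((hp.sub hz).add (hs.smul (hF.comp hp))).norm
    ((hp.sub hz).norm.const_mul _)

lemma measurableState_iterate {st : Ω → State d} (h : MeasurableState st) :
    MeasurableState fun ω => I.iterate (st ω) := by
  have hn := measurable_backtracks hF h.B h.z h.σ
  have hη : Measurable fun ω =>
      I.trialStep (st ω).σ (I.backtracks (st ω).B (st ω).z (st ω).σ).toNat :=
    measurable_apply_nat (g := fun n ω => I.trialStep (st ω).σ n) (fun n => h.σ.mul_const _) hn
  have hhat : Measurable fun ω => I.trialPoint (st ω).B (st ω).z (st ω).σ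
      (I.backtracks (st ω).B (st ω).z (st ω).σ).toNat :=
    measurable_apply_nat (g := fun n ω => I.trialPoint (st ω).B (st ω).z (st ω).σ n)
      (fun n => measurable_trialPoint hF h.B h.z h.σ n) hn
  have htil : Measurable fun ω => I.trialPoint (st ω).B (st ω).z (st ω).σ
      ((I.backtracks (st ω).B (st ω).z (st ω).σ).toNat - 1) :=
    measurable_apply_nat (g := fun n ω => I.trialPoint (st ω).B (st ω).z (st ω).σ (n - 1))
      (fun n => measurable_trialPoint hF h.B h.z h.σ (n - 1)) hn
  have h0 : MeasurableSet {ω | (I.backtracks (st ω).B (st ω).z (st ω).σ).toNat = 0} :=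
    hn (MeasurableSet.singleton 0)
  have hs := htil.sub h.z
  have hu := (hF.comp htil).sub (hF.comp h.z)
  have hloss := (((hs.norm.pow_const 2).const_div 2).neg).smul
    (measurable_outer (hu.sub (measurable_mulV h.B hs)) hs)
  have hG := ((measurable_frobProj I.L).comp hloss).const_smul (1 / I.L₁)
  have hGt := measurable_ite_le (c := 1) h.γ hG
    (hG.add (((measurable_const (a := (0 : ℝ))).max
      (((h.γ.const_div 1).neg).mul (measurable_frobInner hG h.W))).smul h.S))
  have hV := h.W.sub (hGt.const_smul I.ρ)
  have hW := (((measurable_const (a := √(d : ℝ))).max (measurable_frobNorm.comp hV)).const_div (√d)).smul hV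
  simp only [iterate_eq]
  constructor <;> simp only [apply_ite]
  · have := h.z.sub (hη.smul (hF.comp hhat))
    exact Measurable.ite h0 this this
  · have := hη.div_const I.β
    exact Measurable.ite h0 this this
  · exact Measurable.ite h0 h.t (h.t.add_const 1)
  · exact Measurable.ite h0 h.W hW
  · exact Measurable.ite h0 h.γ h.γ
  · exact Measurable.ite h0 h.S h.S
  · exact Measurable.ite h0 h.B h.B
  · exact Measurable.ite h0 h.pending measurable_const

lemma measurableState_run {ξ : Ω → ℕ → Sample d} (hξ : ∀ t, Measurable fun ω => ξ ω t) (k : ℕ) :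
    MeasurableState fun ω => I.run (ξ ω) k := by
  induction k with
  | zero =>
    constructor <;> exact measurable_const
  | succ k ih =>
    have : ∀ ω, I.run (ξ ω) (k + 1) = I.iterate (I.refresh (ξ ω) (I.run (ξ ω) k)) := fun ω =>
      Function.iterate_succ_apply' _ _ _
    simp only [this]
    exact measurableState_iterate hF (I.measurableState_refresh hξ ih)

end Input

end StateMeasurability


/-! ## The event that all oracle calls succeed -/

section Event

variable {d : ℕ}

namespace Input

variable (I : Input d)

lemma run_succ (ξ : ℕ → Sample d) (k : ℕ) :
    I.run ξ (k + 1) = I.iterate (I.refresh ξ (I.run ξ k)) :=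
  Function.iterate_succ_apply' _ _ _

lemma refresh_t (ξ : ℕ → Sample d) (st : State d) : (I.refresh ξ st).t = st.t := by
  unfold refresh; split_ifs <;> rfl

lemma refresh_pending (ξ : ℕ → Sample d) (st : State d) : (I.refresh ξ st).pending = false := by
  unfold refresh; split_ifs with h
  · rfl
  · simpa using h

lemma run_t_succ (ξ : ℕ → Sample d) (k : ℕ) :
    ((I.run ξ (k + 1)).t = (I.run ξ k).t ∧ (I.run ξ (k + 1)).pending = false) ∨
      ((I.run ξ (k + 1)).t = (I.run ξ k).t + 1 ∧ (I.run ξ (k + 1)).pending = true) := by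
  rw [run_succ, iterate_eq]
  split_ifs
  · exact Or.inl ⟨I.refresh_t ξ _, I.refresh_pending ξ _⟩
  · exact Or.inr ⟨congrArg (· + 1) (I.refresh_t ξ _), rfl⟩

lemma run_t_mono (ξ : ℕ → Sample d) : Monotone fun k => (I.run ξ k).t :=
  monotone_nat_of_le_succ fun k => by rcases I.run_t_succ ξ k with h | h <;> omega

lemma run_t_le (ξ : ℕ → Sample d) (k : ℕ) : (I.run ξ k).t ≤ k := by
  induction k with
  | zero => exact le_rfl
  | succ k ih => rcases I.run_t_succ ξ k with h | h <;> omega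

lemma run_t_lt_of_pending (ξ : ℕ → Sample d) {j k : ℕ} (hjk : j < k)
    (hk : (I.run ξ k).pending = true) : (I.run ξ j).t < (I.run ξ k).t := by
  obtain ⟨l, rfl⟩ : ∃ l, k = l + 1 := ⟨k - 1, by omega⟩
  have h1 : (I.run ξ j).t ≤ (I.run ξ l).t := I.run_t_mono ξ (by omega)
  rcases I.run_t_succ ξ l with h | h
  · rw [hk] at h; simp at h
  · omega

lemma run_t_pos_of_pending (ξ : ℕ → Sample d) {k : ℕ} (hk : (I.run ξ k).pending = true) :
    1 ≤ (I.run ξ k).t := by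
  rcases Nat.eq_zero_or_pos k with rfl | h
  · exact absurd hk (by simp [run, initState])
  · have := I.run_t_lt_of_pending ξ h hk
    omega

/-- At the beginning of round `t` the state depends on the samples of the preceding rounds only. -/
lemma run_congr {ξ ξ' : ℕ → Sample d} {t : ℕ} (h : ∀ i < t, ξ i = ξ' i) (k : ℕ)
    (hk : (I.run ξ k).t < t ∨ ((I.run ξ k).t = t ∧ (I.run ξ k).pending = true)) :
    I.run ξ k = I.run ξ' k := by
  induction k with
  | zero => simp only [run, Function.iterate_zero, id_eq]
  | succ k ih =>
    -- The state before must belong to a strictly earlier round, so its refresh reads no sample of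
    -- index `t` or later.
    have hlt : (I.run ξ k).t < t := by
      rcases I.run_t_succ ξ k with ⟨h1, h2⟩ | ⟨h1, h2⟩
      · rcases hk with hk | ⟨-, hk⟩
        · omega
        · rw [h2] at hk; simp at hk
      · omega
    have hkk := ih (Or.inl hlt)
    have hr : I.refresh ξ (I.run ξ k) = I.refresh ξ' (I.run ξ k) := by
      unfold refresh
      rw [h _ hlt]
    rw [run_succ, run_succ, ← hkk, hr]

/-- Extension of the samples of the rounds before `t ≥ 1` to all rounds. -/
def extendPast {t : ℕ} (ht : 0 < t) (p : Finset.range t → Sample d) (i : ℕ) : Sample d :=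
  -- The filler for later rounds is irrelevant: it is not read before the query of round `t`. The
  -- first sample serves, as `t ≥ 1`.
  if h : i ∈ Finset.range t then p ⟨i, h⟩ else p ⟨0, Finset.mem_range.mpr ht⟩

lemma measurable_extendPast {t : ℕ} (ht : 0 < t) (i : ℕ) :
    Measurable fun p : Finset.range t → Sample d => extendPast ht p i := by
  unfold extendPast
  split_ifs
  · exact measurable_pi_apply _
  · exact measurable_pi_apply _

/-- The oracle call of round `t` fails. -/
def failureSet {t : ℕ} (ht : 0 < t) : Set ((Finset.range t → Sample d) × Sample d) :=
  {y | ∃ k, (I.run (extendPast ht y.1) k).pending = true ∧ (I.run (extendPast ht y.1) k).t = t ∧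
    ¬ I.OracleGood t (I.run (extendPast ht y.1) k).W y.2}

lemma measurableSet_failureSet (hF : Measurable I.problem.operator) {t : ℕ} (ht : 0 < t) :
    MeasurableSet (I.failureSet ht) := by
  have hst : ∀ k, MeasurableState fun y : (Finset.range t → Sample d) × Sample d =>
      I.run (extendPast ht y.1) k := fun k =>
    measurableState_run hF (fun i => (measurable_extendPast ht i).comp measurable_fst) k
  unfold failureSet
  simp only [Set.ofPred_exists]
  refine MeasurableSet.iUnion fun k => ?_
  refine MeasurableSet.inter ((hst k).pending (MeasurableSet.singleton true))
    (MeasurableSet.inter ((hst k).t (MeasurableSet.singleton t)) ?_)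
  exact (I.measurableSet_oracleGood (hst k).W measurable_snd t).compl

/-- For a fixed past, at most one iteration opens round `t`, since the round index rises strictly
with each pending query. So a single matrix `W` is queried and the fixed-matrix bound applies. -/
lemma failureSet_section_le (hd : 0 < d) {t : ℕ} (ht : 0 < t) (hq : 0 < I.failureProb t)
    (hq1 : I.failureProb t ≤ 2) (p : Finset.range t → Sample d) :
    sampleLaw d (Prod.mk p ⁻¹' I.failureSet ht) ≤ ENNReal.ofReal (I.failureProb t) := by
  by_cases hex : ∃ k, (I.run (extendPast ht p) k).pending = true ∧ (I.run (extendPast ht p) k).t = t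
  · obtain ⟨k, hk1, hk2⟩ := hex
    refine (measure_mono ?_).trans
      (I.sampleLaw_not_oracleGood_le hd t hq hq1 (I.run (extendPast ht p) k).W)
    rintro x ⟨j, hj1, hj2, hx⟩
    simp only at hj1 hj2 hx
    have hjk : j = k := by
      rcases lt_trichotomy j k with h | h | h
      · have := I.run_t_lt_of_pending _ h hk1; omega
      · exact h
      · have := I.run_t_lt_of_pending _ h hj1; omega
    subst hjk
    exact hx
  · have : Prod.mk p ⁻¹' I.failureSet ht = ∅ := by
      ext x
      simp only [Set.mem_preimage, Set.mem_empty_iff_false, iff_false]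
      rintro ⟨k, h1, h2, -⟩
      exact hex ⟨k, h1, h2⟩
    rw [this, measure_empty]; exact zero_le

variable {Ω : Type*} [MeasurableSpace Ω] {μ : Measure Ω} [IsProbabilityMeasure μ]
  {ξ : ℕ → Ω → Sample d}

/-- By independence the joint law of the past and the new sample is a product, and Fubini integrates
the bound on sections. -/
lemma measure_failure_le (hd : 0 < d) (hF : Measurable I.problem.operator)
    (hξ : ∀ t, Measurable (ξ t)) (hind : iIndepFun ξ μ) (hlaw : ∀ t, μ.map (ξ t) = sampleLaw d)
    {t : ℕ} (ht : 0 < t) (hq : 0 < I.failureProb t) (hq1 : I.failureProb t ≤ 2) :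
    μ {ω | ((fun i : Finset.range t => ξ i ω), ξ t ω) ∈ I.failureSet ht} ≤
      ENNReal.ofReal (I.failureProb t) := by
  let past : Ω → Finset.range t → Sample d := fun ω i => ξ i ω
  have hpast : Measurable past := measurable_pi_iff.mpr fun i => hξ i
  have hi : IndepFun past (ξ t) μ := by
    have h1 := hind.indepFun_finset (Finset.range t) {t} (by simp) (fun i => hξ i)
    exact h1.comp (φ := id) (ψ := fun f : ({t} : Finset ℕ) → Sample d => f ⟨t, by simp⟩)
      measurable_id (measurable_pi_apply _)
  have hS := I.measurableSet_failureSet hF ht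
  have hprob : IsProbabilityMeasure (sampleLaw d) := by
    rw [← hlaw t]; exact Measure.isProbabilityMeasure_map (hξ t).aemeasurable
  have hprob' : IsProbabilityMeasure (μ.map past) :=
    Measure.isProbabilityMeasure_map hpast.aemeasurable
  have h2 := (indepFun_iff_map_prod_eq_prod_map_map hpast.aemeasurable (hξ t).aemeasurable).mp hi
  have h3 : μ {ω | (past ω, ξ t ω) ∈ I.failureSet ht} =
      ((μ.map past).prod (sampleLaw d)) (I.failureSet ht) := by
    rw [← hlaw t, ← h2, Measure.map_apply (hpast.prodMk (hξ t)) hS]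
    rfl
  change μ {ω | (past ω, ξ t ω) ∈ I.failureSet ht} ≤ _
  rw [h3, Measure.prod_apply hS]
  calc ∫⁻ p, sampleLaw d (Prod.mk p ⁻¹' I.failureSet ht) ∂(μ.map past)
      ≤ ∫⁻ _, ENNReal.ofReal (I.failureProb t) ∂(μ.map past) :=
        lintegral_mono fun p => I.failureSet_section_le hd ht hq hq1 p
    _ = ENNReal.ofReal (I.failureProb t) := by simp

/-- The terms after the first are dominated by the differences of `1 / log`, since `log (n + 1) -
log n ≥ 1 / (n + 1)`. The constant `5 / 2` comes from `1 / (2 log² 2) + 1 / log 2 < 2.5`. -/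
lemma sum_inv_mul_log_sq_le (T : ℕ) :
    ∑ t ∈ Finset.range T, 1 / (((t : ℝ) + 2) * Real.log (t + 2) ^ 2) ≤ 5 / 2 := by
  have hlog2 : (0.69 : ℝ) ≤ Real.log 2 := by have := Real.log_two_gt_d9; linarith
  have key : ∀ T : ℕ, ∑ t ∈ Finset.range (T + 1), 1 / (((t : ℝ) + 2) * Real.log (t + 2) ^ 2) ≤
      5 / 2 - 1 / Real.log (T + 2) := by
    intro T
    induction T with
    | zero =>
      simp only [zero_add, Finset.range_one, Finset.sum_singleton, Nat.cast_zero]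
      have hl := Real.log_two_gt_d9
      set l := Real.log 2
      have hl0 : 0 < l := by linarith
      rw [le_sub_iff_add_le]
      have : 1 / (2 * l ^ 2) + 1 / l = (1 + 2 * l) / (2 * l ^ 2) := by field_simp
      rw [this, div_le_iff₀ (by positivity)]
      nlinarith
    | succ T ih =>
      rw [Finset.sum_range_succ]
      push_cast
      set a := Real.log ((T : ℝ) + 2)
      have ha : 0 < a := Real.log_pos (by linarith [(Nat.cast_nonneg T : (0 : ℝ) ≤ T)])
      have hT : (0 : ℝ) < (T : ℝ) + 2 := by positivity
      have e1 : (T : ℝ) + 1 + 2 = (T : ℝ) + 2 + 1 := by ring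
      rw [e1]
      set b := Real.log ((T : ℝ) + 2 + 1)
      have hb : 0 < b := Real.log_pos (by linarith)
      have hab : 1 / ((T : ℝ) + 2 + 1) ≤ b - a := by
        have h1 : b - a = Real.log (((T : ℝ) + 2 + 1) / ((T : ℝ) + 2)) := by
          rw [Real.log_div (by positivity) (by positivity)]
        have h2 := Real.one_sub_inv_le_log_of_pos
          (show 0 < ((T : ℝ) + 2 + 1) / ((T : ℝ) + 2) by positivity)
        rw [h1]
        refine le_trans (le_of_eq ?_) h2
        field_simp; ring
      have hle : a ≤ b := by
        have : 0 < 1 / ((T : ℝ) + 2 + 1) := by positivity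
        linarith
      have h3 : 1 / (((T : ℝ) + 2 + 1) * b ^ 2) ≤ 1 / a - 1 / b := by
        have e2 : 1 / a - 1 / b = (b - a) / (a * b) := by field_simp
        have e3 : 1 / (((T : ℝ) + 2 + 1) * b ^ 2) = 1 / ((T : ℝ) + 2 + 1) / b ^ 2 := by field_simp
        rw [e2, e3]
        exact div_le_div₀ (by linarith [show 0 < 1 / ((T : ℝ) + 2 + 1) by positivity]) hab
          (by positivity) (by nlinarith)
      linarith
  rcases T with _ | T
  · norm_num
  · refine (key T).trans ?_
    have : 0 < Real.log ((T : ℝ) + 2) :=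
      Real.log_pos (by linarith [(Nat.cast_nonneg T : (0 : ℝ) ≤ T)])
    have : 0 < 1 / Real.log ((T : ℝ) + 2) := by positivity
    linarith

lemma failureProb_succ (t : ℕ) :
    I.failureProb (t + 1) = I.p * (2 / 5) * (1 / (((t : ℝ) + 2) * Real.log (t + 2) ^ 2)) := by
  unfold failureProb
  have : (((t + 1 : ℕ) : ℝ) + 1) = (t : ℝ) + 2 := by push_cast; ring
  rw [this]
  field_simp

lemma log_add_two_pos (t : ℕ) : 0 < Real.log ((t : ℝ) + 2) :=
  Real.log_pos (by linarith [(Nat.cast_nonneg t : (0 : ℝ) ≤ t)])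

variable {I} in
lemma Valid.failureProb_pos (hI : I.Valid) (t : ℕ) : 0 < I.failureProb (t + 1) := by
  have := log_add_two_pos t
  have := hI.p_mem.1
  rw [failureProb_succ]; positivity

variable {I} in
lemma Valid.sum_failureProb_le (hI : I.Valid) (T : ℕ) :
    ∑ t ∈ Finset.range T, I.failureProb (t + 1) ≤ I.p := by
  simp only [failureProb_succ]
  rw [← Finset.mul_sum]
  have := hI.p_mem.1
  have := sum_inv_mul_log_sq_le T
  nlinarith

variable {I} in
lemma Valid.failureProb_le (hI : I.Valid) (t : ℕ) : I.failureProb (t + 1) ≤ 1 :=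
  (Finset.single_le_sum (f := fun t => I.failureProb (t + 1))
    (fun i _ => (hI.failureProb_pos i).le) (Finset.self_mem_range_succ t)).trans
    ((hI.sum_failureProb_le _).trans hI.p_mem.2.le)

/-- With probability at least `1 - p`, all oracle calls succeed. -/
theorem exists_good_event (hd : 0 < d) (hI : I.Valid) (hξ : ∀ t, Measurable (ξ t))
    (hind : iIndepFun ξ μ) (hlaw : ∀ t, μ.map (ξ t) = sampleLaw d) :
    ∃ E : Set Ω, MeasurableSet E ∧ ENNReal.ofReal (1 - I.p) ≤ μ E ∧ ∀ ω ∈ E, ∀ k,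
      (I.run (fun t => ξ t ω) k).pending = true →
        I.OracleGood (I.run (fun t => ξ t ω) k).t (I.run (fun t => ξ t ω) k).W
          (ξ (I.run (fun t => ξ t ω) k).t ω) := by
  have hF : Measurable I.problem.operator := hI.contDiff.continuous.measurable
  -- The index is shifted by one because round `0` makes no query.
  let A : ℕ → Set Ω := fun t => {ω | ((fun i : Finset.range (t + 1) => ξ i ω), ξ (t + 1) ω) ∈
    I.failureSet (Nat.succ_pos t)}
  have hA : ∀ t, MeasurableSet (A t) := fun t =>
    ((measurable_pi_iff.mpr fun i : Finset.range (t + 1) => hξ i).prodMk (hξ (t + 1)) :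
      Measurable fun ω => ((fun i : Finset.range (t + 1) => ξ i ω), ξ (t + 1) ω))
      (I.measurableSet_failureSet hF (Nat.succ_pos t))
  have hAle : ∀ t, μ (A t) ≤ ENNReal.ofReal (I.failureProb (t + 1)) := fun t =>
    I.measure_failure_le hd hF hξ hind hlaw (Nat.succ_pos t) (hI.failureProb_pos t)
      ((hI.failureProb_le t).trans one_le_two)
  have hU : μ (⋃ t, A t) ≤ ENNReal.ofReal I.p := by
    refine (measure_iUnion_le A).trans (ENNReal.tsum_le_of_sum_range_le fun T => ?_)
    refine (Finset.sum_le_sum fun t _ => hAle t).trans ?_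
    rw [← ENNReal.ofReal_sum_of_nonneg fun t _ => (hI.failureProb_pos t).le]
    exact ENNReal.ofReal_le_ofReal (hI.sum_failureProb_le T)
  refine ⟨(⋃ t, A t)ᶜ, (MeasurableSet.iUnion hA).compl, ?_, fun ω hω k hk => ?_⟩
  · rw [prob_compl_eq_one_sub (MeasurableSet.iUnion hA), ENNReal.ofReal_sub _ hI.p_mem.1.le,
      ENNReal.ofReal_one]
    exact tsub_le_tsub_left hU 1
  · by_contra hbad
    refine hω (Set.mem_iUnion.mpr ?_)
    obtain ⟨t, ht⟩ : ∃ t, (I.run (fun t => ξ t ω) k).t = t + 1 :=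
      ⟨(I.run (fun t => ξ t ω) k).t - 1, by have := I.run_t_pos_of_pending _ hk; omega⟩
    have hcongr := I.run_congr (ξ := fun t => ξ t ω)
      (ξ' := extendPast (Nat.succ_pos t) fun i : Finset.range (t + 1) => ξ i ω) (t := t + 1)
      (fun i hi => by rw [extendPast, dif_pos (Finset.mem_range.mpr hi)]) k (Or.inr ⟨ht, hk⟩)
    refine ⟨t, k, ?_, ?_, ?_⟩
    · simp only; rw [← hcongr]; exact hk
    · simp only; rw [← hcongr]; exact ht
    · simp only; rw [← hcongr]
      rw [ht] at hbad
      exact hbad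

end Input

end Event


/-! ## The gap of the averaged iterate -/

section Gap

variable {E : Type*} [NormedAddCommGroup E] [InnerProductSpace ℝ E]

/-- One step of the hybrid proximal extragradient method. -/
lemma extragradient_step {z zh g w : E} {a : ℝ} (ha : a ≤ 1)
    (h : ‖zh - z + g‖ ≤ a * ‖zh - z‖) :
    2 * inner ℝ g (zh - w) ≤ ‖z - w‖ ^ 2 - ‖z - g - w‖ ^ 2 := by
  have h1 : ‖zh - z + g‖ ^ 2 ≤ ‖zh - z‖ ^ 2 := by
    refine pow_le_pow_left₀ (norm_nonneg _) (h.trans ?_) 2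
    nlinarith [norm_nonneg (zh - z)]
  have e1 : z - g - w = (z - w) - g := by abel
  have e2 : zh - w = (zh - z) + (z - w) := by abel
  rw [norm_add_sq_real] at h1
  rw [e1, norm_sub_sq_real (z - w) g, e2, inner_add_right, real_inner_comm (z - w) g,
    real_inner_comm (zh - z) g]
  linarith

lemma sum_weighted_sub_eq_zero {N : ℕ} {η : ℕ → ℝ} {u : ℕ → E} {zb : E}
    (hzb : (∑ k ∈ Finset.range N, η k) • zb = ∑ k ∈ Finset.range N, η k • u k) (φ : E →ₗ[ℝ] ℝ) :
    ∑ k ∈ Finset.range N, η k * φ (u k - zb) = 0 := by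
  have : ∑ k ∈ Finset.range N, η k * φ (u k - zb) =
      φ (∑ k ∈ Finset.range N, η k • u k - (∑ k ∈ Finset.range N, η k) • zb) := by
    rw [map_sub, map_sum, map_smul, Finset.sum_smul, ← Finset.sum_sub_distrib]
    refine Finset.sum_congr rfl fun k _ => ?_
    rw [map_smul, map_sub, smul_eq_mul, smul_eq_mul, mul_sub]
  rw [this, hzb, sub_self, map_zero]

/-- By the mean value theorem the increment is a directional derivative at an intermediate point.
Monotonicity is needed along `h` only, which permits use on one block of a minimax problem. -/
lemma inner_gradient_le_sub [CompleteSpace E] {f : E → ℝ} (hf : Differentiable ℝ f) {a h : E}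
    (hmono : ∀ s : ℝ, 0 < s → 0 ≤ inner ℝ (gradient f (a + s • h) - gradient f a) h) :
    inner ℝ (gradient f a) h ≤ f (a + h) - f a := by
  have hd : ∀ s : ℝ, HasDerivAt (fun s : ℝ => f (a + s • h)) (inner ℝ (gradient f (a + s • h)) h) s := by
    intro s
    have h1 := (hf (a + s • h)).hasGradientAt.hasFDerivAt
    have h2 : HasDerivAt (fun s : ℝ => a + s • h) h s := by
      simpa using ((hasDerivAt_id s).smul_const h).const_add a
    have h3 := h1.comp_hasDerivAt s h2
    exact h3
  obtain ⟨c, hc, hc'⟩ := exists_hasDerivAt_eq_slope (fun s : ℝ => f (a + s • h)) _ zero_lt_one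
    (fun s _ => (hd s).continuousAt.continuousWithinAt) (fun s _ => hd s)
  have h1 := hmono c hc.1
  rw [inner_sub_left] at h1
  simp only [one_smul, zero_smul, add_zero, sub_zero, div_one] at hc'
  linarith

variable {d : ℕ}

lemma signMatrix_isSymm (d m : ℕ) : (signMatrix d m).IsSymm := by
  unfold signMatrix Matrix.IsSymm
  rw [Matrix.diagonal_transpose]

lemma mulV_signMatrix_apply (m : ℕ) (v : Vec (Fin d)) (i : Fin d) :
    mulV (signMatrix d m) v i = if i.val < m then v i else -v i := by
  simp only [mulV, signMatrix, Matrix.mulVec_diagonal]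
  split_ifs <;> simp

lemma mulL_signMatrix_sq (m : ℕ) (v : Vec (Fin d)) :
    mulL (signMatrix d m) (mulL (signMatrix d m) v) = v := by
  ext i
  simp only [mulL_apply, mulV_signMatrix_apply]
  split_ifs <;> simp

lemma splice_eq (m : ℕ) (z w : Vec (Fin d)) :
    splice m z w = (1 / 2 : ℝ) • (z + mulL (signMatrix d m) z) +
      (1 / 2 : ℝ) • (w - mulL (signMatrix d m) w) := by
  ext i
  simp only [splice, PiLp.add_apply, PiLp.smul_apply, PiLp.sub_apply, mulL_apply,
    mulV_signMatrix_apply, smul_eq_mul]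
  split_ifs <;> ring

namespace Problem

/-- The function whose maximum over `z'` is the restricted gap. -/
noncomputable def gapAt (P : Problem d) (z z' : Vec (Fin d)) : ℝ :=
  match P with
  | equation F => inner ℝ (F z') (z - z')
  | minimization f => f z - f z'
  | minimax m f => f (splice m z z') - f (splice m z' z)

lemma gap_eq (P : Problem d) (D : Set (Vec (Fin d))) (z : Vec (Fin d)) :
    P.gap D z = sSup ((fun z' => P.gapAt z z') '' D) := by
  cases P <;> rfl

section Minimax

variable {m : ℕ} {f : Vec (Fin d) → ℝ}

/-- For `h` in the `x`-block, `J h = h`, so the sign matrix disappears from the monotonicity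
inequality and `f` is convex in that direction; in the `y`-block the sign is reversed and `-f` takes
its place. -/
lemma minimax_convex (hf : Differentiable ℝ f)
    (hmono : ∀ z z', 0 ≤ inner ℝ
      ((minimax m f).operator z - (minimax m f).operator z') (z - z')) {a h : Vec (Fin d)}
    (hh : mulL (signMatrix d m) h = h) : inner ℝ (gradient f a) h ≤ f (a + h) - f a := by
  refine inner_gradient_le_sub hf fun s hs => ?_
  have h1 := hmono (a + s • h) a
  simp only [operator, add_sub_cancel_left, real_inner_smul_right, ← mulL_apply, ← map_sub] at h1
  rw [mulL_isSymmetric (signMatrix_isSymm d m), hh] at h1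
  exact nonneg_of_mul_nonneg_right h1 hs

lemma minimax_concave (hf : Differentiable ℝ f)
    (hmono : ∀ z z', 0 ≤ inner ℝ
      ((minimax m f).operator z - (minimax m f).operator z') (z - z')) {a h : Vec (Fin d)}
    (hh : mulL (signMatrix d m) h = -h) : f (a + h) - f a ≤ inner ℝ (gradient f a) h := by
  have hg : ∀ z, gradient (fun z => -f z) z = -gradient f z := by
    intro z
    simp only [gradient]
    rw [fderiv_fun_neg, map_neg]
  have h2 := inner_gradient_le_sub (f := fun z => -f z) hf.neg (a := a) (h := h) (fun s hs => ?_)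
  · rw [hg, inner_neg_left] at h2
    linarith
  · have h1 := hmono (a + s • h) a
    simp only [operator, add_sub_cancel_left, real_inner_smul_right, ← mulL_apply,
      ← map_sub] at h1
    rw [mulL_isSymmetric (signMatrix_isSymm d m), hh] at h1
    have h3 := nonneg_of_mul_nonneg_right h1 hs
    rw [hg, hg, ← neg_sub', inner_neg_left]
    rwa [inner_neg_right] at h3

end Minimax

/-- The gap function of a weighted average is bounded by the weighted average of the linearized
gaps. -/
lemma gapAt_average_le {P : Problem d} (hP : P.WellPosed)
    (hmono : ∀ z z', 0 ≤ inner ℝ (P.operator z - P.operator z') (z - z'))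
    {N : ℕ} {η : ℕ → ℝ} (hη : ∀ k, 0 ≤ η k) {u : ℕ → Vec (Fin d)} {zb : Vec (Fin d)}
    (hzb : (∑ k ∈ Finset.range N, η k) • zb = ∑ k ∈ Finset.range N, η k • u k)
    (z' : Vec (Fin d)) :
    (∑ k ∈ Finset.range N, η k) * P.gapAt zb z' ≤
      ∑ k ∈ Finset.range N, η k * inner ℝ (P.operator (u k)) (u k - z') := by
  -- A linear functional of `u k - zb` has weighted sum zero, so any linear correction is free.
  suffices ∃ φ : Vec (Fin d) →ₗ[ℝ] ℝ, ∀ k, P.gapAt zb z' + φ (u k - zb) ≤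
      inner ℝ (P.operator (u k)) (u k - z') by
    obtain ⟨φ, hφ⟩ := this
    have h1 := sum_weighted_sub_eq_zero hzb φ
    calc (∑ k ∈ Finset.range N, η k) * P.gapAt zb z'
        = ∑ k ∈ Finset.range N, η k * (P.gapAt zb z' + φ (u k - zb)) := by
          simp only [mul_add, Finset.sum_add_distrib, h1, add_zero, Finset.sum_mul]
      _ ≤ _ := Finset.sum_le_sum fun k _ => mul_le_mul_of_nonneg_left (hφ k) (hη k)
  cases P with
  | equation F =>
    refine ⟨innerₛₗ ℝ (F z'), fun k => ?_⟩
    have h1 := hmono (u k) z'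
    have e : u k - z' = (zb - z') + (u k - zb) := by abel
    simp only [operator, inner_sub_left] at h1
    have h2 : inner ℝ (F z') (u k - z') = inner ℝ (F z') (zb - z') + inner ℝ (F z') (u k - zb) := by
      rw [e, inner_add_right]
    simp only [gapAt, operator, innerₛₗ_apply_apply]
    linarith
  | minimization f =>
    have hf : Differentiable ℝ f := hP
    have hconv : ∀ a b, inner ℝ (gradient f a) (b - a) ≤ f b - f a := by
      intro a b
      have := inner_gradient_le_sub hf (a := a) (h := b - a) fun s hs => by
        have h1 := hmono (a + s • (b - a)) a
        simp only [operator, add_sub_cancel_left, real_inner_smul_right] at h1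
        exact nonneg_of_mul_nonneg_right h1 hs
      rwa [add_sub_cancel] at this
    refine ⟨innerₛₗ ℝ (gradient f zb), fun k => ?_⟩
    have h1 := hconv zb (u k)
    have h2 := hconv (u k) z'
    rw [← neg_sub (u k) z', inner_neg_right] at h2
    simp only [gapAt, operator, innerₛₗ_apply_apply]
    linarith
  | minimax m f =>
    have hf : Differentiable ℝ f := hP.2
    set J := mulL (signMatrix d m) with hJ
    have hJJ : ∀ v, J (J v) = v := mulL_signMatrix_sq m
    have hJs : J.IsSymmetric := mulL_isSymmetric (signMatrix_isSymm d m)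
    -- The correction pairs the gradient at `(x̄, y')` with the `x`-part and the gradient at `(x',
    -- ȳ)` with the `y`-part. It linearizes `f(·, y')` at `x̄` and `f(x', ·)` at `ȳ`, the two terms
    -- of the gap.
    refine ⟨(innerₛₗ ℝ (gradient f (splice m zb z'))) ∘ₗ ((1 / 2 : ℝ) • (LinearMap.id + J)) -
      (innerₛₗ ℝ (gradient f (splice m z' zb))) ∘ₗ ((1 / 2 : ℝ) • (LinearMap.id - J)),
      fun k => ?_⟩
    have e : ∀ v w : Vec (Fin d), splice m v w = (1 / 2 : ℝ) • (v + J v) + (1 / 2 : ℝ) • (w - J w) :=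
      splice_eq m
    have a1 := minimax_convex hf hmono (a := splice m zb z')
      (h := (1 / 2 : ℝ) • ((u k - zb) + J (u k - zb))) (by
        rw [← hJ, map_smul, map_add, hJJ, add_comm])
    have a2 := minimax_concave hf hmono (a := splice m z' zb)
      (h := (1 / 2 : ℝ) • ((u k - zb) - J (u k - zb))) (by
        rw [← hJ, map_smul, map_sub, hJJ, ← smul_neg, neg_sub])
    have a3 := minimax_convex hf hmono (a := u k)
      (h := (1 / 2 : ℝ) • ((z' - u k) + J (z' - u k))) (by
        rw [← hJ, map_smul, map_add, hJJ, add_comm])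
    have a4 := minimax_concave hf hmono (a := u k)
      (h := (1 / 2 : ℝ) • ((z' - u k) - J (z' - u k))) (by
        rw [← hJ, map_smul, map_sub, hJJ, ← smul_neg, neg_sub])
    have e1 : splice m zb z' + (1 / 2 : ℝ) • ((u k - zb) + J (u k - zb)) = splice m (u k) z' := by
      rw [e, e, map_sub]; module
    have e2 : splice m z' zb + (1 / 2 : ℝ) • ((u k - zb) - J (u k - zb)) = splice m z' (u k) := by
      rw [e, e, map_sub]; module
    have e3 : u k + (1 / 2 : ℝ) • ((z' - u k) + J (z' - u k)) = splice m z' (u k) := by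
      rw [e, map_sub]; module
    have e4 : u k + (1 / 2 : ℝ) • ((z' - u k) - J (z' - u k)) = splice m (u k) z' := by
      rw [e, map_sub]; module
    rw [e1] at a1
    rw [e2] at a2
    rw [e3] at a3
    rw [e4] at a4
    have e5 : inner ℝ ((minimax m f).operator (u k)) (u k - z') =
        inner ℝ (gradient f (u k)) ((1 / 2 : ℝ) • ((z' - u k) - J (z' - u k))) -
          inner ℝ (gradient f (u k)) ((1 / 2 : ℝ) • ((z' - u k) + J (z' - u k))) := by
      rw [← inner_sub_right]
      have : (1 / 2 : ℝ) • ((z' - u k) - J (z' - u k)) - (1 / 2 : ℝ) • ((z' - u k) + J (z' - u k)) =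
          J (u k - z') := by
        rw [map_sub, map_sub]; module
      rw [this, ← hJs]
      rfl
    rw [e5]
    simp only [gapAt, LinearMap.sub_apply, LinearMap.comp_apply, LinearMap.smul_apply,
      LinearMap.add_apply, LinearMap.id_apply, innerₛₗ_apply_apply]
    linarith

end Problem

end Gap


/-! ## The Jacobian approximations and the line search -/

section LineSearch

variable {d : ℕ}

/-- A symmetric matrix is bounded by its quadratic form. -/
lemma norm_mulV_le_of_abs_inner_le {A : Mat d} (hA : A.IsSymm)
    (h : ∀ y, |inner ℝ (mulV A y) y| ≤ ‖y‖ ^ 2) (x : Vec (Fin d)) : ‖mulV A x‖ ≤ ‖x‖ := by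
  rcases eq_or_ne (mulV A x) 0 with h0 | h0
  · rw [h0, norm_zero]; exact norm_nonneg _
  have hpos : 0 < ‖mulV A x‖ := norm_pos_iff.mpr h0
  set c := ‖x‖ / ‖mulV A x‖ with hc
  -- Polarization with `y` parallel to `A x` and of norm `‖x‖`: the difference of the forms at `x +
  -- y` and `x - y` is `4 ‖x‖ ‖A x‖`, bounded by `4 ‖x‖²` through the parallelogram law.
  set y := c • mulL A x with hy
  have hyn : ‖y‖ = ‖x‖ := by
    rw [hy, norm_smul, mulL_apply, hc, Real.norm_of_nonneg (by positivity),
      div_mul_cancel₀ _ hpos.ne']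
  have hin : inner ℝ (mulL A x) y = ‖x‖ * ‖mulV A x‖ := by
    rw [hy, real_inner_smul_right, real_inner_self_eq_norm_sq, mulL_apply, hc]
    field_simp
  have hsym : inner ℝ (mulL A y) x = inner ℝ (mulL A x) y := by
    rw [mulL_isSymmetric hA, real_inner_comm]
  have h1 := (abs_le.mp (h (x + y))).2
  have h2 := (abs_le.mp (h (x - y))).1
  rw [← mulL_apply, map_add, inner_add_left, inner_add_right, inner_add_right, hsym] at h1
  rw [← mulL_apply, map_sub, inner_sub_left, inner_sub_right, inner_sub_right, hsym] at h2
  have h3 := parallelogram_law_with_norm ℝ x y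
  rw [hin] at h1 h2
  rw [hyn] at h3
  have h4 : ‖x‖ * ‖mulV A x‖ ≤ ‖x‖ * ‖x‖ := by nlinarith
  rcases (norm_nonneg x).eq_or_lt with hx | hx
  · have : x = 0 := norm_eq_zero.mp hx.symm
    rw [this, ← mulL_apply, map_zero]
  · exact le_of_mul_le_mul_left h4 hx

lemma frobProj_mem (L : Submodule ℝ (Mat d)) (A : Mat d) : frobProj L A ∈ L := by
  have h := (L.map (vecEquiv d).toLinearMap).starProjection_apply_mem (vecEquiv d A)
  obtain ⟨B, hB, hBe⟩ := h
  have : frobProj L A = B := by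
    unfold frobProj
    rw [LinearEquiv.symm_apply_eq]
    exact hBe.symm
  rwa [this]

namespace Input

variable (I : Input d)

/-- A Jacobian approximation that is accretive and of the size of the Lipschitz constant. -/
structure Admissible (B : Mat d) : Prop where
  inner_nonneg : ∀ x, 0 ≤ inner ℝ (mulV B x) x
  norm_le : ∀ x, ‖mulV B x‖ ≤ 4 * I.L₁ * ‖x‖
  isSymm : I.problem.IsMinimization → B.IsSymm

variable {I}

lemma Valid.isSymm_of_mem (hI : I.Valid) (hmin : I.problem.IsMinimization) {B : Mat d}
    (hB : B ∈ I.L) : B.IsSymm := by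
  have h := hI.structured
  unfold Problem.IsMinimization at hmin
  unfold Problem.Structured at h
  split at h
  · simp_all
  · exact h B hB
  · simp_all

lemma Valid.B₀_mem_L (hI : I.Valid) : I.B₀ ∈ I.L := by
  have h := hI.B₀_mem
  unfold Problem.feasibleSet at h
  split at h
  · exact h.2.2
  · exact h.2.2.2

lemma Valid.admissible_B₀ (hI : I.Valid) : I.Admissible I.B₀ := by
  have hL := hI.L₁_pos
  have h := hI.B₀_mem
  refine ⟨?_, ?_, fun hmin => hI.isSymm_of_mem hmin hI.B₀_mem_L⟩
  · unfold Problem.feasibleSet at h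
    intro x
    split at h
    · exact posSemidef_inner_nonneg h.1 x
    · rw [← inner_mulV_symPart]
      exact posSemidef_inner_nonneg h.1 x
  · intro x
    have hsuff : ‖mulV I.B₀ x‖ ≤ I.L₁ * ‖x‖ := by
      by_cases hmin : I.problem.IsMinimization
      · have hS := hI.isSymm_of_mem hmin hI.B₀_mem_L
        have hb : I.B₀.PosSemidef ∧ (I.L₁ • (1 : Mat d) - I.B₀).PosSemidef := by
          unfold Problem.feasibleSet at h
          unfold Problem.IsMinimization at hmin
          split at h
          · exact ⟨h.1, h.2.1⟩
          · split at hmin <;> simp_all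
        have := norm_mulV_le_of_abs_inner_le (A := I.L₁⁻¹ • I.B₀) (by
          unfold Matrix.IsSymm; rw [Matrix.transpose_smul, hS.eq]) (fun y => ?_) x
        · rw [mulV_smul, norm_smul, Real.norm_of_nonneg (by positivity)] at this
          rwa [inv_mul_le_iff₀ hL] at this
        · have h1 := posSemidef_inner_nonneg hb.1 y
          have h2 := posSemidef_inner_nonneg hb.2 y
          rw [mulV_sub, mulV_smul, mulV_one, inner_sub_left, real_inner_smul_left,
            real_inner_self_eq_norm_sq] at h2
          rw [mulV_smul, real_inner_smul_left, abs_of_nonneg (by positivity),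
            inv_mul_le_iff₀ hL]
          linarith
      · refine (norm_mulV_le _ _).trans ?_
        gcongr
        unfold Problem.feasibleSet at h
        unfold Problem.IsMinimization at hmin
        split at h
        · simp_all
        · exact h.2.2.1
    nlinarith [norm_nonneg x]

/-- After a successful query, the new Jacobian approximation is admissible. -/
lemma Valid.admissible_of_oracleGood (hI : I.Valid) {t : ℕ} {W : Mat d} {x : Sample d}
    (hW : W ∈ I.L) (h : I.OracleGood t W x) {Bhat : Mat d}
    (hB : Bhat = ((1 + delta t) * max 1 (I.separation t W x).γ)⁻¹ • W) :
    I.Admissible (I.L₁ • Bhat + I.L₁ • (1 : Mat d)) := by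
  have hL := hI.L₁_pos
  have hδ := delta_pos t
  set c := (1 + delta t) * max 1 (I.separation t W x).γ with hc
  have hc0 : 0 < c := by positivity
  have hq : ∀ y, |inner ℝ (mulV Bhat y) y| ≤ ‖y‖ ^ 2 := by
    intro y
    rw [hB, mulV_smul, real_inner_smul_left, abs_mul, abs_of_pos (inv_pos.mpr hc0),
      inv_mul_le_iff₀ hc0]
    exact h.1 y
  have hBs : I.problem.IsMinimization → Bhat.IsSymm := fun hmin => by
    unfold Matrix.IsSymm
    rw [hB, Matrix.transpose_smul, (hI.isSymm_of_mem hmin hW).eq]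
  -- The bound `3`, with `1` for the added identity, gives the `4 L₁` of admissibility. In the
  -- symmetric case the quadratic form alone gives norm at most `1`.
  have hn : ∀ y, ‖mulV Bhat y‖ ≤ 3 * ‖y‖ := by
    intro y
    by_cases hmin : I.problem.IsMinimization
    · have := norm_mulV_le_of_abs_inner_le (hBs hmin) hq y
      linarith [norm_nonneg y]
    · have := h.2 hmin y
      rw [hB, mulV_smul, norm_smul, Real.norm_of_nonneg (inv_pos.mpr hc0).le,
        inv_mul_le_iff₀ hc0]
      linarith
  refine ⟨fun y => ?_, fun y => ?_, fun hmin => ?_⟩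
  · rw [mulV_add, mulV_smul, mulV_smul, mulV_one, inner_add_left, real_inner_smul_left,
      real_inner_smul_left, real_inner_self_eq_norm_sq, ← mul_add]
    have := (abs_le.mp (hq y)).1
    exact mul_nonneg hL.le (by linarith)
  · rw [mulV_add, mulV_smul, mulV_smul, mulV_one, ← smul_add, norm_smul,
      Real.norm_of_nonneg hL.le]
    have := (norm_add_le (mulV Bhat y) y).trans (add_le_add (hn y) le_rfl)
    nlinarith
  · unfold Matrix.IsSymm
    rw [Matrix.transpose_add, Matrix.transpose_smul, Matrix.transpose_smul, (hBs hmin).eq,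
      Matrix.transpose_one]

/-- The linear solver on an admissible trial matrix. -/
lemma Valid.trial_spec (hI : I.Valid) {B : Mat d} (hB : I.Admissible B) {σ : ℝ} (hσ : 0 < σ)
    (b : Vec (Fin d)) (i : ℕ) :
    ‖b - mulV (I.trialMatrix B σ i) (linearSolver (I.trialMatrix B σ i) b I.α₁)‖ ≤
        I.α₁ * ‖linearSolver (I.trialMatrix B σ i) b I.α₁‖ ∧
      ∃ K : ℕ, solverCost (I.trialMatrix B σ i) b I.α₁ = K ∧
        (K : ℝ) ≤ 3 + 2 * ((1 + 4 * I.L₁ * I.trialStep σ i) / I.α₁) ∧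
        (I.problem.IsMinimization →
          (K : ℝ) ≤ 3 + 2 * √((1 + 4 * I.L₁ * I.trialStep σ i) / I.α₁)) := by
  have hL := hI.L₁_pos
  have hη : 0 < I.trialStep σ i := mul_pos hσ (pow_pos hI.β_mem.1 i)
  have hA : ∀ x, mulV (I.trialMatrix B σ i) x = x + I.trialStep σ i • mulV B x := fun x => by
    rw [trialMatrix, mulV_add, mulV_one, mulV_smul]
  have hκ : 1 ≤ 1 + 4 * I.L₁ * I.trialStep σ i := by
    have : 0 < 4 * I.L₁ * I.trialStep σ i := by positivity
    linarith
  have hlow : ∀ x, ‖x‖ ^ 2 ≤ inner ℝ (mulV (I.trialMatrix B σ i) x) x := fun x => by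
    rw [hA, inner_add_left, real_inner_self_eq_norm_sq, real_inner_smul_left]
    have := mul_nonneg hη.le (hB.inner_nonneg x)
    linarith
  have hup : ∀ x, ‖mulV (I.trialMatrix B σ i) x‖ ≤ (1 + 4 * I.L₁ * I.trialStep σ i) * ‖x‖ :=
    fun x => by
      rw [hA]
      refine (norm_add_le _ _).trans ?_
      rw [norm_smul, Real.norm_of_nonneg hη.le]
      have := mul_le_mul_of_nonneg_left (hB.norm_le x) hη.le
      linarith
  obtain ⟨h1, K, h2, h3, h4⟩ := solver_spec hlow hup hκ hI.α₁_mem.1 hI.α₁_mem.2 b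
  refine ⟨h1, K, h2, h3, fun hmin => h4 ?_⟩
  unfold Matrix.IsSymm trialMatrix
  rw [Matrix.transpose_add, Matrix.transpose_smul, Matrix.transpose_one, (hB.isSymm hmin).eq]

/-- A trial with a small step size is accepted. -/
lemma Valid.accepted_of_le (hI : I.Valid) {B : Mat d} (hB : I.Admissible B) {σ : ℝ} (hσ : 0 < σ)
    (z : Vec (Fin d)) {i : ℕ} (hi : 5 * I.L₁ * I.trialStep σ i ≤ I.α₂) : I.Accepted B z σ i := by
  have hη : 0 < I.trialStep σ i := mul_pos hσ (pow_pos hI.β_mem.1 i)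
  have h := (hI.trial_spec hB hσ (I.trialRhs z σ i) i).1
  unfold Accepted
  set s := linearSolver (I.trialMatrix B σ i) (I.trialRhs z σ i) I.α₁ with hs
  have hz : I.trialPoint B z σ i = z + s := rfl
  set η := I.trialStep σ i with hη'
  set F := I.problem.operator
  -- The error is the solver residual, at most `α₁ ‖s‖`, plus the linearization error `η (F (z + s)
  -- - F z - B s)`. The latter is at most `5 L₁ η ‖s‖`: one `L₁` from `F`, four from `B`.
  have e : I.trialPoint B z σ i - z + η • F (I.trialPoint B z σ i) =
      -(I.trialRhs z σ i - mulV (I.trialMatrix B σ i) s) +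
        (η • (F (z + s) - F z) - η • mulV B s) := by
    rw [hz, trialMatrix, trialRhs, mulV_add, mulV_one, mulV_smul, ← hη']
    module
  have hF : ‖F (z + s) - F z‖ ≤ I.L₁ * ‖s‖ := by
    simpa using hI.lipschitz (z + s) z
  rw [e]
  have h1 : ‖η • (F (z + s) - F z) - η • mulV B s‖ ≤ η * (5 * I.L₁ * ‖s‖) := by
    rw [← smul_sub, norm_smul, Real.norm_of_nonneg hη.le]
    gcongr
    refine (norm_sub_le _ _).trans ?_
    linarith [hB.norm_le s]
  have h2 : η * (5 * I.L₁ * ‖s‖) ≤ I.α₂ * ‖s‖ := by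
    have := mul_le_mul_of_nonneg_right hi (norm_nonneg s)
    linarith
  have h3 : I.trialPoint B z σ i - z = s := by rw [hz, add_sub_cancel_left]
  refine (norm_add_le _ _).trans ?_
  rw [norm_neg, h3]
  linarith

/-- The line search terminates, and its step size is not too small. -/
lemma Valid.lineSearch_spec (hI : I.Valid) {B : Mat d} (hB : I.Admissible B) {σ : ℝ}
    (hσ : I.α₂ * I.β / (5 * I.L₁) ≤ σ) (z : Vec (Fin d)) :
    I.backtracks B z σ = ((I.backtracks B z σ).toNat : ℕ∞) ∧
      I.Accepted B z σ (I.backtracks B z σ).toNat ∧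
      I.α₂ * I.β / (5 * I.L₁) ≤ I.trialStep σ (I.backtracks B z σ).toNat := by
  have hL := hI.L₁_pos
  have hα := hI.α₂_mem.1
  have hβ := hI.β_mem.1
  have hσ0 : 0 < σ := lt_of_lt_of_le (by positivity) hσ
  obtain ⟨k, hk⟩ : ∃ k, I.β ^ k < I.α₂ / (5 * I.L₁ * σ) :=
    exists_pow_lt_of_lt_one (by positivity) hI.β_mem.2
  have hacc : I.Accepted B z σ k := by
    refine hI.accepted_of_le hB hσ0 z ?_
    rw [lt_div_iff₀ (by positivity)] at hk
    unfold trialStep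
    linarith
  obtain ⟨n, hn, h1, -, h3⟩ := exists_firstIndex_eq hacc
  have hn' : I.backtracks B z σ = n := hn
  rw [hn', ENat.toNat_natCast]
  refine ⟨rfl, h1, ?_⟩
  -- Without rejection the step is `σ` itself; otherwise the preceding trial was rejected, so its
  -- step exceeds `α₂ / (5 L₁)`.
  rcases n with _ | n
  · simpa [trialStep] using hσ
  · have h4 : I.α₂ < 5 * I.L₁ * I.trialStep σ n := by
      by_contra! hle
      exact h3 n (Nat.lt_succ_self n) (hI.accepted_of_le hB hσ0 z hle)
    rw [div_le_iff₀ (by positivity)]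
    have e : I.trialStep σ (n + 1) = I.trialStep σ n * I.β := by
      unfold trialStep; rw [pow_succ]; ring
    rw [e]
    nlinarith

lemma sum_pow_le {β : ℝ} (h0 : 0 ≤ β) (h1 : β < 1) (n : ℕ) :
    ∑ i ∈ Finset.range n, β ^ i ≤ 1 / (1 - β) := by
  rw [geom_sum_eq h1.ne, ← neg_div_neg_eq]
  have : 0 < 1 - β := by linarith
  rw [neg_sub, neg_sub]
  gcongr
  linarith [pow_nonneg h0 n]

/-- The cost of the linear solver in one line search. -/
lemma Valid.lineSearchCost_spec (hI : I.Valid) {B : Mat d} (hB : I.Admissible B) {σ : ℝ}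
    (hσ : I.α₂ * I.β / (5 * I.L₁) ≤ σ) (z : Vec (Fin d)) :
    ∃ K : ℕ, I.lineSearchCost B z σ = K ∧
      (K : ℝ) ≤ (3 + 2 / I.α₁) * ((I.backtracks B z σ).toNat + 1) +
        8 / (I.α₁ * (1 - I.β)) * (I.L₁ * σ) ∧
      (I.problem.IsMinimization →
        (K : ℝ) ≤ (3 + 2 / √I.α₁) * ((I.backtracks B z σ).toNat + 1) +
          4 / (√I.α₁ * (1 - √I.β)) * √(I.L₁ * σ)) := by
  have hL := hI.L₁_pos
  have hα := hI.α₂_mem.1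
  have hα1 := hI.α₁_mem.1
  have hβ := hI.β_mem.1
  have hβ1 : 0 < 1 - I.β := by linarith [hI.β_mem.2]
  have hsβ : √I.β < 1 := by
    rw [Real.sqrt_lt' one_pos]; simpa using hI.β_mem.2
  have hσ0 : 0 < σ := lt_of_lt_of_le (by positivity) hσ
  obtain ⟨hn, -, -⟩ := hI.lineSearch_spec hB hσ z
  set n := (I.backtracks B z σ).toNat
  choose K hK1 hK2 hK3 using fun i => (hI.trial_spec hB hσ0 (I.trialRhs z σ i) i).2
  refine ⟨∑ i ∈ Finset.range (n + 1), K i, ?_, ?_, fun hmin => ?_⟩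
  · have hne : I.backtracks B z σ ≠ ⊤ := by rw [hn]; exact ENat.natCast_ne_top n
    rw [lineSearchCost, if_neg hne, Nat.cast_sum]
    exact Finset.sum_congr rfl fun i _ => hK1 i
  · rw [Nat.cast_sum]
    calc ∑ i ∈ Finset.range (n + 1), (K i : ℝ)
        ≤ ∑ i ∈ Finset.range (n + 1), ((3 + 2 / I.α₁) + 8 / I.α₁ * (I.L₁ * σ) * I.β ^ i) := by
          refine Finset.sum_le_sum fun i _ => (hK2 i).trans (le_of_eq ?_)
          unfold trialStep
          field_simp
          ring
      _ = (3 + 2 / I.α₁) * (n + 1) +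
          8 / I.α₁ * (I.L₁ * σ) * ∑ i ∈ Finset.range (n + 1), I.β ^ i := by
          rw [Finset.sum_add_distrib, Finset.mul_sum, Finset.sum_const, Finset.card_range,
            nsmul_eq_mul]
          push_cast
          ring
      _ ≤ (3 + 2 / I.α₁) * (n + 1) + 8 / I.α₁ * (I.L₁ * σ) * (1 / (1 - I.β)) := by
          gcongr
          exact sum_pow_le hβ.le hI.β_mem.2 _
      _ = _ := by field_simp
  · have hs1 : 0 < 1 - √I.β := by linarith
    rw [Nat.cast_sum]
    calc ∑ i ∈ Finset.range (n + 1), (K i : ℝ)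
        ≤ ∑ i ∈ Finset.range (n + 1),
            ((3 + 2 / √I.α₁) + 4 / √I.α₁ * √(I.L₁ * σ) * √I.β ^ i) := by
          refine Finset.sum_le_sum fun i _ => (hK3 i hmin).trans ?_
          -- Splitting the root leaves a geometric series with ratio `√β` for symmetric matrices.
          have e1 : √(1 + 4 * I.L₁ * I.trialStep σ i) ≤ 1 + 2 * (√(I.L₁ * σ) * √I.β ^ i) := by
            refine Real.sqrt_le_iff.mpr ⟨by positivity, ?_⟩
            have e2 : √(I.L₁ * σ) ^ 2 = I.L₁ * σ := Real.sq_sqrt (by positivity)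
            have e3 : (√I.β ^ i) ^ 2 = I.β ^ i := by
              rw [← pow_mul, mul_comm i 2, pow_mul, Real.sq_sqrt hβ.le]
            have e4 : (√(I.L₁ * σ) * √I.β ^ i) ^ 2 = I.L₁ * σ * I.β ^ i := by
              rw [mul_pow, e2, e3]
            have e5 : 0 ≤ √(I.L₁ * σ) * √I.β ^ i := by positivity
            unfold trialStep
            nlinarith
          rw [Real.sqrt_div' _ hα1.le]
          have h2 : √(1 + 4 * I.L₁ * I.trialStep σ i) / √I.α₁ ≤
              (1 + 2 * (√(I.L₁ * σ) * √I.β ^ i)) / √I.α₁ := by gcongr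
          have e : (3 + 2 / √I.α₁) + 4 / √I.α₁ * √(I.L₁ * σ) * √I.β ^ i =
              3 + 2 * ((1 + 2 * (√(I.L₁ * σ) * √I.β ^ i)) / √I.α₁) := by ring
          rw [e]
          linarith
      _ = (3 + 2 / √I.α₁) * (n + 1) +
          4 / √I.α₁ * √(I.L₁ * σ) * ∑ i ∈ Finset.range (n + 1), √I.β ^ i := by
          rw [Finset.sum_add_distrib, Finset.mul_sum, Finset.sum_const, Finset.card_range,
            nsmul_eq_mul]
          push_cast
          ring
      _ ≤ (3 + 2 / √I.α₁) * (n + 1) + 4 / √I.α₁ * √(I.L₁ * σ) * (1 / (1 - √I.β)) := by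
          gcongr
          exact sum_pow_le (Real.sqrt_nonneg _) hsβ _
      _ = _ := by field_simp

/-! ### The run of the method -/

variable (I)

/-- The sample sequence gives correct oracle answers in every round of the run. -/
def GoodRun (ξ : ℕ → Sample d) : Prop := ∀ k, (I.run ξ k).pending = true →
  I.OracleGood (I.run ξ k).t (I.run ξ k).W (ξ (I.run ξ k).t)

/-- The state in which the line search of iteration `k` is carried out. -/
noncomputable def searchState (ξ : ℕ → Sample d) (k : ℕ) : State d := I.refresh ξ (I.run ξ k)

/-- The invariants of the method. -/
structure Invariant (st : State d) : Prop where
  W_mem : st.W ∈ I.L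
  S_mem : st.S ∈ I.L
  σ_ge : I.α₂ * I.β / (5 * I.L₁) ≤ st.σ
  admissible : st.pending = false → I.Admissible st.B

variable {I}

lemma Valid.invariant_initState (hI : I.Valid) : I.Invariant I.initState where
  W_mem := I.L.smul_mem _ (I.L.sub_mem hI.B₀_mem_L (I.L.smul_mem _ hI.one_mem))
  S_mem := I.L.zero_mem
  σ_ge := hI.σ₀_ge
  admissible _ := hI.admissible_B₀

lemma separation_S_mem (t : ℕ) (W : Mat d) (x : Sample d) : (I.separation t W x).S ∈ I.L := by
  unfold separation
  dsimp only
  split <;> exact frobProj_mem _ _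

lemma Valid.invariant_refresh (hI : I.Valid) {ξ : ℕ → Sample d} {st : State d}
    (h : I.Invariant st)
    (hgood : st.pending = true → I.OracleGood st.t st.W (ξ st.t)) :
    I.Invariant (I.refresh ξ st) := by
  unfold refresh
  split_ifs with hp
  · refine ⟨h.W_mem, separation_S_mem _ _ _, h.σ_ge, fun _ => ?_⟩
    refine hI.admissible_of_oracleGood h.W_mem (hgood hp) ?_
    split_ifs with hγ
    · rw [max_eq_left hγ, mul_one, one_div]
    · rw [max_eq_right (not_le.mp hγ).le, one_div]
  · exact h

/-- Of the Jacobian update only its staying in `L` matters, and every ingredient is a combination of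
elements of `L`. The lower bound on `σ` persists since the accepted step is enlarged by `1 / β`. -/
lemma Valid.invariant_iterate (hI : I.Valid) {st : State d} (h : I.Invariant st)
    (hp : st.pending = false) : I.Invariant (I.iterate st) := by
  have hβ := hI.β_mem
  have hb := h.admissible hp
  have hη := (hI.lineSearch_spec hb h.σ_ge st.z).2.2
  have hσ : I.α₂ * I.β / (5 * I.L₁) ≤ I.trialStep st.σ (I.rejections st) / I.β := by
    rw [le_div_iff₀ hβ.1]
    refine le_trans ?_ hη
    have : 0 ≤ I.α₂ * I.β / (5 * I.L₁) := by
      have := hI.L₁_pos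
      have := hI.α₂_mem.1
      have := hβ.1
      positivity
    nlinarith [hβ.2]
  rw [iterate_eq]
  split_ifs
  · exact ⟨h.W_mem, h.S_mem, hσ, fun _ => hb⟩
  · refine ⟨?_, h.S_mem, hσ, fun h => by simp at h⟩
    refine I.L.smul_mem _ ?_
    unfold jacobianStep
    refine I.L.sub_mem h.W_mem (I.L.smul_mem _ ?_)
    split_ifs
    · exact I.L.smul_mem _ (frobProj_mem _ _)
    · exact I.L.add_mem (I.L.smul_mem _ (frobProj_mem _ _)) (I.L.smul_mem _ h.S_mem)

lemma Valid.invariant_run (hI : I.Valid) {ξ : ℕ → Sample d} (hξ : I.GoodRun ξ) (k : ℕ) :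
    I.Invariant (I.run ξ k) := by
  induction k with
  | zero => exact hI.invariant_initState
  | succ k ih =>
    rw [run_succ]
    exact hI.invariant_iterate (hI.invariant_refresh ih (hξ k)) (I.refresh_pending ξ _)

lemma Valid.invariant_searchState (hI : I.Valid) {ξ : ℕ → Sample d} (hξ : I.GoodRun ξ) (k : ℕ) :
    I.Invariant (I.searchState ξ k) :=
  hI.invariant_refresh (hI.invariant_run hξ k) (hξ k)

end Input

end LineSearch


/-! ## Convergence of the averaged iterate -/

section Convergence

variable {d : ℕ}

namespace Input

variable {I : Input d} {ξ : ℕ → Sample d}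

lemma refresh_z (st : State d) : (I.refresh ξ st).z = st.z := by
  unfold refresh; split_ifs <;> rfl

lemma refresh_σ (st : State d) : (I.refresh ξ st).σ = st.σ := by
  unfold refresh; split_ifs <;> rfl

lemma refresh_evals (st : State d) : (I.refresh ξ st).evals = st.evals := by
  unfold refresh; split_ifs <;> rfl

lemma refresh_solverMv (st : State d) : (I.refresh ξ st).solverMv = st.solverMv := by
  unfold refresh; split_ifs <;> rfl

variable (I ξ) in
/-- The number of rejected trials in iteration `k`. -/
noncomputable def runRejections (k : ℕ) : ℕ := I.rejections (I.searchState ξ k)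

lemma stepSize_eq (k : ℕ) :
    I.stepSize ξ k = I.trialStep (I.run ξ k).σ (I.runRejections ξ k) := by
  rw [← refresh_σ (ξ := ξ) (I.run ξ k)]
  rfl

lemma run_z_succ (k : ℕ) : (I.run ξ (k + 1)).z =
    (I.run ξ k).z - I.stepSize ξ k • I.problem.operator (I.midpoint ξ k) := by
  rw [run_succ, iterate_eq, ← refresh_z (ξ := ξ) (I.run ξ k)]
  split_ifs <;> rfl

lemma run_σ_succ (k : ℕ) : (I.run ξ (k + 1)).σ = I.stepSize ξ k / I.β := by
  rw [run_succ, iterate_eq]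
  split_ifs <;> rfl

lemma run_evals_succ (k : ℕ) : (I.run ξ (k + 1)).evals = (I.run ξ k).evals +
    (1 + (I.backtracks (I.searchState ξ k).B (I.searchState ξ k).z (I.searchState ξ k).σ + 1)) := by
  rw [run_succ, iterate_eq, ← refresh_evals (ξ := ξ) (I.run ξ k)]
  split_ifs <;> rfl

lemma run_solverMv_succ (k : ℕ) : (I.run ξ (k + 1)).solverMv = (I.run ξ k).solverMv +
    I.lineSearchCost (I.searchState ξ k).B (I.searchState ξ k).z (I.searchState ξ k).σ := by
  rw [run_succ, iterate_eq, ← refresh_solverMv (ξ := ξ) (I.run ξ k)]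
  split_ifs <;> rfl

lemma run_oracleMv_succ (k : ℕ) : (I.run ξ (k + 1)).oracleMv = (I.run ξ k).oracleMv +
    if (I.run ξ k).pending then
      (I.separation (I.run ξ k).t (I.run ξ k).W (ξ (I.run ξ k).t)).mv else 0 := by
  have h : (I.refresh ξ (I.run ξ k)).oracleMv = (I.run ξ k).oracleMv +
      if (I.run ξ k).pending then
        (I.separation (I.run ξ k).t (I.run ξ k).W (ξ (I.run ξ k).t)).mv else 0 := by
    unfold refresh
    split_ifs <;> rfl
  rw [run_succ, iterate_eq, ← h]
  split_ifs <;> rfl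

variable (I) in
/-- The smallest step size that the line search can produce. -/
noncomputable def minStep : ℝ := I.α₂ * I.β / (5 * I.L₁)

lemma Valid.minStep_pos (hI : I.Valid) : 0 < I.minStep := by
  have := hI.L₁_pos
  have := hI.α₂_mem.1
  have := hI.β_mem.1
  unfold minStep
  positivity

lemma Valid.searchState_spec (hI : I.Valid) (hξ : I.GoodRun ξ) (k : ℕ) :
    I.backtracks (I.searchState ξ k).B (I.searchState ξ k).z (I.searchState ξ k).σ =
        (I.runRejections ξ k : ℕ∞) ∧
      I.Accepted (I.searchState ξ k).B (I.searchState ξ k).z (I.searchState ξ k).σ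
        (I.runRejections ξ k) ∧
      I.minStep ≤ I.stepSize ξ k :=
  have h := hI.invariant_searchState hξ k
  hI.lineSearch_spec (h.admissible (I.refresh_pending ξ _)) h.σ_ge _

lemma Valid.stepSize_pos (hI : I.Valid) (hξ : I.GoodRun ξ) (k : ℕ) : 0 < I.stepSize ξ k :=
  hI.minStep_pos.trans_le (hI.searchState_spec hξ k).2.2

lemma Valid.weighted_inner_le (hI : I.Valid) (hξ : I.GoodRun ξ) (w : Vec (Fin d)) (k : ℕ) :
    2 * (I.stepSize ξ k * inner ℝ (I.problem.operator (I.midpoint ξ k)) (I.midpoint ξ k - w)) ≤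
      ‖(I.run ξ k).z - w‖ ^ 2 - ‖(I.run ξ (k + 1)).z - w‖ ^ 2 := by
  have h := (hI.searchState_spec hξ k).2.1
  have h' : ‖I.midpoint ξ k - (I.run ξ k).z +
      I.stepSize ξ k • I.problem.operator (I.midpoint ξ k)‖ ≤
      (I.α₁ + I.α₂) * ‖I.midpoint ξ k - (I.run ξ k).z‖ := by
    rw [← refresh_z (ξ := ξ) (I.run ξ k)]
    exact h
  have h1 := extragradient_step (w := w) (by linarith [hI.α₁_mem.2, hI.α₂_mem.2]) h'
  rwa [real_inner_smul_left, ← run_z_succ] at h1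

/-- The squared distances to `w` telescope and the last one is dropped. -/
lemma Valid.sum_weighted_inner_le (hI : I.Valid) (hξ : I.GoodRun ξ) (w : Vec (Fin d)) (N : ℕ) :
    ∑ k ∈ Finset.range N,
      I.stepSize ξ k * inner ℝ (I.problem.operator (I.midpoint ξ k)) (I.midpoint ξ k - w) ≤
      ‖I.z₀ - w‖ ^ 2 / 2 := by
  have h := Finset.sum_le_sum fun k (_ : k ∈ Finset.range N) => hI.weighted_inner_le hξ w k
  rw [← Finset.mul_sum, Finset.sum_range_sub'] at h
  have h0 : (I.run ξ 0).z = I.z₀ := rfl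
  rw [h0] at h
  linarith [sq_nonneg ‖(I.run ξ N).z - w‖]

lemma norm_sq_le_maxDistSq {D : Set (Vec (Fin d))} (hD : IsCompact D) {w : Vec (Fin d)}
    (hw : w ∈ D) : ‖I.z₀ - w‖ ^ 2 ≤ I.maxDistSq D :=
  le_csSup (hD.bddAbove_image (by fun_prop)) ⟨w, hw, rfl⟩

lemma maxDistSq_nonneg {D : Set (Vec (Fin d))} (hD : IsCompact D) (hne : D.Nonempty) :
    0 ≤ I.maxDistSq D := by
  obtain ⟨w, hw⟩ := hne
  exact (sq_nonneg _).trans (norm_sq_le_maxDistSq hD hw)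

lemma Valid.gap_average_le (hI : I.Valid) (hξ : I.GoodRun ξ) {D : Set (Vec (Fin d))}
    (hD : IsCompact D) (hne : D.Nonempty) {N : ℕ} (hN : 1 ≤ N) :
    I.problem.gap D (I.average ξ N) ≤
      I.maxDistSq D / (2 * ∑ k ∈ Finset.range N, I.stepSize ξ k) := by
  have hpos : 0 < ∑ k ∈ Finset.range N, I.stepSize ξ k :=
    Finset.sum_pos (fun k _ => hI.stepSize_pos hξ k) ⟨0, Finset.mem_range.mpr hN⟩
  rw [Problem.gap_eq]
  refine csSup_le (hne.image _) ?_
  rintro _ ⟨w, hw, rfl⟩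
  have h1 := Problem.gapAt_average_le hI.wellPosed hI.monotone
    (fun k => (hI.stepSize_pos hξ k).le) (u := I.midpoint ξ) (zb := I.average ξ N) (N := N) (by
      rw [average, smul_smul, mul_inv_cancel₀ hpos.ne', one_smul]) w
  have h2 := hI.sum_weighted_inner_le hξ w N
  have h3 := norm_sq_le_maxDistSq (I := I) hD hw
  dsimp only
  rw [le_div_iff₀ (by positivity)]
  linarith

lemma Valid.minStep_mul_le_sum (hI : I.Valid) (hξ : I.GoodRun ξ) (N : ℕ) :
    N * I.minStep ≤ ∑ k ∈ Finset.range N, I.stepSize ξ k := by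
  have h := Finset.card_nsmul_le_sum (Finset.range N) (I.stepSize ξ) I.minStep
    fun k _ => (hI.searchState_spec hξ k).2.2
  rwa [Finset.card_range, nsmul_eq_mul] at h

/-- The complexity is finite, and the step sizes before the last iteration have a small sum. -/
lemma Valid.exists_isComplexity (hI : I.Valid) (hξ : I.GoodRun ξ) {D : Set (Vec (Fin d))}
    (hD : IsCompact D) (hne : D.Nonempty) {ε : ℝ} (hε : 0 < ε) :
    ∃ N, I.IsComplexity ξ D ε (N + 1) ∧
      ∑ k ∈ Finset.range N, I.stepSize ξ k ≤ I.maxDistSq D / (2 * ε) := by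
  classical
  have hM := maxDistSq_nonneg (I := I) hD hne
  have hm := hI.minStep_pos
  have hex : ∃ N, 1 ≤ N ∧ I.problem.gap D (I.average ξ N) ≤ ε := by
    obtain ⟨n, hn⟩ := exists_nat_ge (I.maxDistSq D / (2 * ε) / I.minStep)
    refine ⟨n + 1, by omega, (hI.gap_average_le hξ hD hne (by omega)).trans ?_⟩
    have h1 := hI.minStep_mul_le_sum hξ (n + 1)
    rw [div_le_iff₀ hm, div_le_iff₀ (by positivity)] at hn
    push_cast at h1
    have hS : 0 < ∑ k ∈ Finset.range (n + 1), I.stepSize ξ k :=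
      lt_of_lt_of_le (by positivity) h1
    rw [div_le_iff₀ (by positivity)]
    nlinarith
  obtain ⟨N, hN⟩ : ∃ N, Nat.find hex = N + 1 :=
    ⟨Nat.find hex - 1, by have := (Nat.find_spec hex).1; omega⟩
  refine ⟨N, ⟨hN ▸ Nat.find_spec hex, fun n hn => hN ▸ Nat.find_min' hex hn⟩, ?_⟩
  -- For `N ≥ 1`, minimality says that `N` iterations are not enough, so `ε` is below the gap bound
  -- for `N`, which limits the step sizes; for `N = 0` the sum is empty.
  rcases Nat.eq_zero_or_pos N with rfl | hpos
  · simp only [Finset.range_zero, Finset.sum_empty]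
    positivity
  · have h1 := Nat.find_min hex (m := N) (by omega)
    have h2 : ε < I.problem.gap D (I.average ξ N) := by
      by_contra! hle
      exact h1 ⟨hpos, hle⟩
    have hS : 0 < ∑ k ∈ Finset.range N, I.stepSize ξ k :=
      Finset.sum_pos (fun k _ => hI.stepSize_pos hξ k) ⟨0, Finset.mem_range.mpr hpos⟩
    have h3 := h2.trans_le (hI.gap_average_le hξ hD hne hpos)
    rw [lt_div_iff₀ (by positivity)] at h3
    rw [le_div_iff₀ (by positivity)]
    linarith

/-! ### Operator evaluations -/

/-- An iteration evaluates at `z_k`, at each rejected trial and at the accepted one. -/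
lemma Valid.run_evals (hI : I.Valid) (hξ : I.GoodRun ξ) (N : ℕ) :
    (I.run ξ N).evals = ((2 * N + ∑ k ∈ Finset.range N, I.runRejections ξ k : ℕ) : ℕ∞) := by
  induction N with
  | zero => rfl
  | succ N ih =>
    rw [run_evals_succ, ih, (hI.searchState_spec hξ N).1, Finset.sum_range_succ]
    norm_cast
    ring

/-- Each iteration multiplies `σ` by `β` to the number of rejections minus one. -/
lemma Valid.run_σ_mul_pow (hI : I.Valid) (N : ℕ) :
    (I.run ξ N).σ * I.β ^ N = I.σ₀ * I.β ^ ∑ k ∈ Finset.range N, I.runRejections ξ k := by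
  have hβ := hI.β_mem.1.ne'
  induction N with
  | zero => rfl
  | succ N ih =>
    rw [run_σ_succ, stepSize_eq, trialStep, Finset.sum_range_succ,
      pow_add (a := I.β) (m := ∑ k ∈ Finset.range N, I.runRejections ξ k), ← mul_assoc, ← ih, pow_succ]
    field_simp

lemma Valid.σ₀_pos (hI : I.Valid) : 0 < I.σ₀ := hI.minStep_pos.trans_le hI.σ₀_ge

/-- Inserting `σ ≥ α₂ / (5 L₁)` after the last iteration into the product formula and taking
logarithms bounds the exponent. -/
lemma Valid.sum_runRejections_le (hI : I.Valid) (hξ : I.GoodRun ξ) (N : ℕ) :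
    ((∑ k ∈ Finset.range (N + 1), I.runRejections ξ k : ℕ) : ℝ) ≤
      (N + 1 : ℕ) + Real.logb (1 / I.β) (5 * I.σ₀ * I.L₁ / I.α₂) := by
  have hL := hI.L₁_pos
  have hα := hI.α₂_mem.1
  have hβ := hI.β_mem.1
  have hσ := hI.σ₀_pos
  have hβ1 : 1 < 1 / I.β := by rw [lt_div_iff₀ hβ]; linarith [hI.β_mem.2]
  set R := ∑ k ∈ Finset.range (N + 1), I.runRejections ξ k with hR
  have h1 : I.α₂ / (5 * I.L₁) ≤ (I.run ξ (N + 1)).σ := by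
    rw [run_σ_succ, le_div_iff₀ hβ]
    refine le_trans (le_of_eq ?_) (hI.searchState_spec hξ N).2.2
    unfold minStep
    ring
  have h2 := hI.run_σ_mul_pow (ξ := ξ) (N + 1)
  rw [← hR] at h2
  have h3 : (1 / I.β) ^ R ≤ (1 / I.β) ^ (N + 1) * (5 * I.σ₀ * I.L₁ / I.α₂) := by
    rw [one_div, inv_pow, inv_pow]
    have h4 := mul_le_mul_of_nonneg_right h1 (pow_pos hβ (N + 1)).le
    rw [h2, div_mul_eq_mul_div, div_le_iff₀ (by positivity)] at h4
    rw [inv_le_iff_one_le_mul₀ (by positivity), ← div_eq_inv_mul, div_mul_eq_mul_div,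
      le_div_iff₀ (by positivity), one_mul, div_mul_eq_mul_div, le_div_iff₀ hα]
    linarith
  have h5 := Real.logb_le_logb_of_le hβ1 (by positivity) h3
  rw [Real.logb_mul (by positivity) (by positivity), Real.logb_pow, Real.logb_pow,
    Real.logb_self_eq_one hβ1, mul_one, mul_one] at h5
  exact h5

/-! ### Matrix-vector products of the linear solver -/

lemma Valid.run_solverMv (hI : I.Valid) (hξ : I.GoodRun ξ) (N : ℕ) :
    ∃ K : ℕ, (I.run ξ N).solverMv = K ∧
      (K : ℝ) ≤ ∑ k ∈ Finset.range N, ((3 + 2 / I.α₁) * ((I.runRejections ξ k : ℝ) + 1) +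
        8 / (I.α₁ * (1 - I.β)) * (I.L₁ * (I.run ξ k).σ)) ∧
      (I.problem.IsMinimization →
        (K : ℝ) ≤ ∑ k ∈ Finset.range N, ((3 + 2 / √I.α₁) * ((I.runRejections ξ k : ℝ) + 1) +
          4 / (√I.α₁ * (1 - √I.β)) * √(I.L₁ * (I.run ξ k).σ))) := by
  induction N with
  | zero => exact ⟨0, rfl, by simp, by simp⟩
  | succ N ih =>
    obtain ⟨K, h1, h2, h3⟩ := ih
    have h := hI.invariant_searchState hξ N
    obtain ⟨K', h1', h2', h3'⟩ := hI.lineSearchCost_spec (h.admissible (I.refresh_pending ξ _))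
      h.σ_ge (I.searchState ξ N).z
    have hσ : (I.searchState ξ N).σ = (I.run ξ N).σ := refresh_σ _
    change (K' : ℝ) ≤ (3 + 2 / I.α₁) * ((I.runRejections ξ N : ℝ) + 1) + _ at h2'
    change I.problem.IsMinimization →
      (K' : ℝ) ≤ (3 + 2 / √I.α₁) * ((I.runRejections ξ N : ℝ) + 1) + _ at h3'
    rw [hσ] at h2' h3'
    refine ⟨K + K', ?_, ?_, fun hmin => ?_⟩
    · rw [run_solverMv_succ, h1, h1', Nat.cast_add]
    · rw [Finset.sum_range_succ, Nat.cast_add]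
      exact add_le_add h2 h2'
    · rw [Finset.sum_range_succ, Nat.cast_add]
      exact add_le_add (h3 hmin) (h3' hmin)

lemma sum_sqrt_le {x : ℕ → ℝ} (hx : ∀ k, 0 ≤ x k) (n : ℕ) :
    ∑ k ∈ Finset.range n, √(x k) ≤ √(n * ∑ k ∈ Finset.range n, x k) := by
  refine Real.le_sqrt_of_sq_le ?_
  have h := sq_sum_le_card_mul_sum_sq (s := Finset.range n) (f := fun k => √(x k))
  simpa only [Finset.card_range, Real.sq_sqrt (hx _)] using h

lemma Valid.log_inv_β_pos (hI : I.Valid) : 0 < Real.log (1 / I.β) := by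
  have hβ := hI.β_mem.1
  refine Real.log_pos ?_
  rw [lt_div_iff₀ hβ]
  linarith [hI.β_mem.2]

end Input

/-- The constant in the bound for the linear solver, for equations and minimax problems. -/
noncomputable def solverConst (α₁ α₂ β : ℝ) : ℝ :=
  2 * (3 + 2 / α₁) + (3 + 2 / α₁) * (5 / (α₂ * Real.log (1 / β))) +
    8 / (α₁ * (1 - β)) + 8 / (α₁ * (1 - β)) * (1 / (2 * β))

/-- The constant in the bound for the linear solver, for minimization problems. -/
noncomputable def solverConstMin (α₁ α₂ β : ℝ) : ℝ :=
  2 * (3 + 2 / √α₁) + (3 + 2 / √α₁) * (2 * √(5 / α₂) / Real.log (1 / β)) +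
    4 / (√α₁ * (1 - √β)) + 4 / (√α₁ * (1 - √β)) * (1 / √β)

namespace Input

variable {I : Input d} {ξ : ℕ → Sample d}

lemma Valid.solverConst_nonneg (hI : I.Valid) : 0 ≤ solverConst I.α₁ I.α₂ I.β := by
  have h1 := hI.α₁_mem.1
  have h2 := hI.α₂_mem.1
  have h3 := hI.β_mem.1
  have h4 : 0 < 1 - I.β := by linarith [hI.β_mem.2]
  have h5 := hI.log_inv_β_pos
  unfold solverConst
  positivity

lemma Valid.one_sub_sqrt_β_pos (hI : I.Valid) : 0 < 1 - √I.β := by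
  have : √I.β < 1 := by rw [Real.sqrt_lt' one_pos]; simpa using hI.β_mem.2
  linarith

lemma Valid.solverConstMin_nonneg (hI : I.Valid) : 0 ≤ solverConstMin I.α₁ I.α₂ I.β := by
  have h1 := hI.α₁_mem.1
  have h2 := hI.α₂_mem.1
  have h3 := hI.β_mem.1
  have h4 := hI.one_sub_sqrt_β_pos
  have h5 := hI.log_inv_β_pos
  unfold solverConstMin
  positivity

lemma Valid.solver_sum_le (hI : I.Valid) (hξ : I.GoodRun ξ) {N : ℕ} {M : ℝ}
    (hM : ∑ k ∈ Finset.range N, I.stepSize ξ k ≤ M / 2) :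
    ∑ k ∈ Finset.range (N + 1), ((3 + 2 / I.α₁) * ((I.runRejections ξ k : ℝ) + 1) +
        8 / (I.α₁ * (1 - I.β)) * (I.L₁ * (I.run ξ k).σ)) ≤
      solverConst I.α₁ I.α₂ I.β * ((N + 1 : ℕ) + I.L₁ * M + I.σ₀ * I.L₁) := by
  have hL := hI.L₁_pos
  have hα1 := hI.α₁_mem.1
  have hα2 := hI.α₂_mem.1
  have hβ := hI.β_mem.1
  have hβ1 : 0 < 1 - I.β := by linarith [hI.β_mem.2]
  have hσ := hI.σ₀_pos
  have hlog := hI.log_inv_β_pos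
  have hM0 : 0 ≤ M := by
    have := Finset.sum_nonneg fun k (_ : k ∈ Finset.range N) => (hI.stepSize_pos hξ k).le
    linarith
  have h1 := hI.sum_runRejections_le hξ N
  -- The logarithm is absorbed into the `σ₀ L₁` term by `log x ≤ x`.
  have h2 : Real.logb (1 / I.β) (5 * I.σ₀ * I.L₁ / I.α₂) ≤
      5 / (I.α₂ * Real.log (1 / I.β)) * (I.σ₀ * I.L₁) := by
    rw [Real.logb, div_le_iff₀ hlog]
    refine (Real.log_le_self (by positivity)).trans (le_of_eq ?_)
    field_simp
  -- The trial sizes are `σ₀` and `η_k / β` for `k < N`; the last step size does not occur, so the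
  -- bound from minimality applies.
  have h3 : ∑ k ∈ Finset.range (N + 1), (I.run ξ k).σ ≤ I.σ₀ + 1 / (2 * I.β) * M := by
    rw [Finset.sum_range_succ', add_comm]
    refine add_le_add le_rfl ?_
    simp only [run_σ_succ]
    rw [← Finset.sum_div, div_le_iff₀ hβ]
    refine hM.trans (le_of_eq ?_)
    field_simp
  rw [Finset.sum_add_distrib, ← Finset.mul_sum, ← Finset.mul_sum, ← Finset.mul_sum,
    Finset.sum_add_distrib, Finset.sum_const, Finset.card_range, nsmul_eq_mul, mul_one]
  set a := 3 + 2 / I.α₁ with ha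
  set c := 8 / (I.α₁ * (1 - I.β)) with hc
  set l := 5 / (I.α₂ * Real.log (1 / I.β)) with hl
  have ha0 : 0 ≤ a := by positivity
  have hc0 : 0 ≤ c := by positivity
  have hl0 : 0 ≤ l := by positivity
  have hb0 : 0 ≤ 1 / (2 * I.β) := by positivity
  push_cast at h1 ⊢
  have h4 : a * (∑ k ∈ Finset.range (N + 1), (I.runRejections ξ k : ℝ) + (N + 1)) ≤
      a * (2 * (N + 1) + l * (I.σ₀ * I.L₁)) :=
    mul_le_mul_of_nonneg_left (by linarith) ha0
  have h5 : c * (I.L₁ * ∑ k ∈ Finset.range (N + 1), (I.run ξ k).σ) ≤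
      c * (I.L₁ * (I.σ₀ + 1 / (2 * I.β) * M)) := by gcongr
  refine (add_le_add h4 h5).trans ?_
  unfold solverConst
  rw [← ha, ← hc, ← hl]
  set b := 1 / (2 * I.β)
  have p1 : 0 ≤ I.L₁ * M := by positivity
  have p2 : 0 ≤ I.σ₀ * I.L₁ := by positivity
  have p3 : (0 : ℝ) ≤ (N : ℝ) + 1 := by positivity
  have e : (2 * a + a * l + c + c * b) * ((N + 1 : ℝ) + I.L₁ * M + I.σ₀ * I.L₁) -
      (a * (2 * (N + 1) + l * (I.σ₀ * I.L₁)) + c * (I.L₁ * (I.σ₀ + b * M))) =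
      (a * l + c + c * b) * (N + 1) + (2 * a + a * l + c) * (I.L₁ * M) +
        (2 * a + c * b) * (I.σ₀ * I.L₁) := by ring
  have : 0 ≤ (a * l + c + c * b) * ((N : ℝ) + 1) + (2 * a + a * l + c) * (I.L₁ * M) +
        (2 * a + c * b) * (I.σ₀ * I.L₁) := by positivity
  linarith

lemma Valid.solver_sum_le_min (hI : I.Valid) (hξ : I.GoodRun ξ) {N : ℕ} {M : ℝ}
    (hM : ∑ k ∈ Finset.range N, I.stepSize ξ k ≤ M) :
    ∑ k ∈ Finset.range (N + 1), ((3 + 2 / √I.α₁) * ((I.runRejections ξ k : ℝ) + 1) +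
        4 / (√I.α₁ * (1 - √I.β)) * √(I.L₁ * (I.run ξ k).σ)) ≤
      solverConstMin I.α₁ I.α₂ I.β *
        ((N + 1 : ℕ) + √((N + 1 : ℕ) * (I.L₁ * M)) + √(I.σ₀ * I.L₁)) := by
  have hL := hI.L₁_pos
  have hα1 := hI.α₁_mem.1
  have hα2 := hI.α₂_mem.1
  have hβ := hI.β_mem.1
  have hβ1 := hI.one_sub_sqrt_β_pos
  have hσ := hI.σ₀_pos
  have hlog := hI.log_inv_β_pos
  have hη := hI.stepSize_pos hξ
  have hM0 : 0 ≤ M := (Finset.sum_nonneg fun k (_ : k ∈ Finset.range N) => (hη k).le).trans hM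
  have h1 := hI.sum_runRejections_le hξ N
  -- Here `log x = 2 log √x ≤ 2 √x`, as only `√(σ₀ L₁)` is allowed.
  have h2 : Real.logb (1 / I.β) (5 * I.σ₀ * I.L₁ / I.α₂) ≤
      2 * √(5 / I.α₂) / Real.log (1 / I.β) * √(I.σ₀ * I.L₁) := by
    rw [Real.logb, div_mul_eq_mul_div]
    gcongr
    have e : 5 * I.σ₀ * I.L₁ / I.α₂ = 5 / I.α₂ * (I.σ₀ * I.L₁) := by ring
    rw [mul_assoc 2, ← Real.sqrt_mul (by positivity), e]
    set x := 5 / I.α₂ * (I.σ₀ * I.L₁) with hx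
    have hx0 : 0 < x := by positivity
    have := Real.log_le_self (Real.sqrt_nonneg x)
    rw [Real.log_sqrt hx0.le] at this
    linarith
  have h3 : ∑ k ∈ Finset.range (N + 1), √(I.L₁ * (I.run ξ k).σ) ≤
      √(I.σ₀ * I.L₁) + 1 / √I.β * √((N + 1 : ℕ) * (I.L₁ * M)) := by
    rw [Finset.sum_range_succ', add_comm]
    refine add_le_add (le_of_eq (by rw [mul_comm]; rfl)) ?_
    simp only [run_σ_succ, ← mul_div_assoc]
    refine (sum_sqrt_le (fun k => by have := hη k; positivity) N).trans ?_
    rw [← Finset.sum_div, ← Finset.mul_sum, one_div, ← Real.sqrt_inv,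
      ← Real.sqrt_mul (by positivity)]
    refine Real.sqrt_le_sqrt ?_
    rw [mul_div_assoc', div_eq_inv_mul]
    push_cast
    have hsum : 0 ≤ ∑ k ∈ Finset.range N, I.stepSize ξ k := Finset.sum_nonneg fun k _ => (hη k).le
    gcongr
    linarith
  rw [Finset.sum_add_distrib, ← Finset.mul_sum, ← Finset.mul_sum,
    Finset.sum_add_distrib, Finset.sum_const, Finset.card_range, nsmul_eq_mul, mul_one]
  set a := 3 + 2 / √I.α₁ with ha
  set c := 4 / (√I.α₁ * (1 - √I.β)) with hc
  set l := 2 * √(5 / I.α₂) / Real.log (1 / I.β) with hl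
  have ha0 : 0 ≤ a := by positivity
  have hc0 : 0 ≤ c := by positivity
  have hl0 : 0 ≤ l := by positivity
  have hb0 : 0 ≤ 1 / √I.β := by positivity
  set y := √((N + 1 : ℕ) * (I.L₁ * M))
  set x := √(I.σ₀ * I.L₁)
  have hy : 0 ≤ y := Real.sqrt_nonneg _
  have hx : 0 ≤ x := Real.sqrt_nonneg _
  push_cast at h1 ⊢
  have h4 : a * (∑ k ∈ Finset.range (N + 1), (I.runRejections ξ k : ℝ) + (N + 1)) ≤
      a * (2 * (N + 1) + l * x) :=
    mul_le_mul_of_nonneg_left (by linarith) ha0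
  have h5 := mul_le_mul_of_nonneg_left h3 hc0
  refine (add_le_add h4 h5).trans ?_
  unfold solverConstMin
  rw [← ha, ← hc, ← hl]
  set b := 1 / √I.β
  have e : (2 * a + a * l + c + c * b) * ((N + 1 : ℝ) + y + x) -
      (a * (2 * (N + 1) + l * x) + c * (x + b * y)) =
      (a * l + c + c * b) * (N + 1) + (2 * a + a * l + c) * y + (2 * a + c * b) * x := by ring
  have : 0 ≤ (a * l + c + c * b) * ((N : ℝ) + 1) + (2 * a + a * l + c) * y +
      (2 * a + c * b) * x := by positivity
  linarith

end Input

end Convergence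


/-! ## Matrix-vector products of the oracles -/

section OracleCost

variable {d : ℕ}

/-- With `y = (t + 1)^{1/8}` the radicand is `2 + 4 y² ≤ 9 y²`; this is the origin of the exponent
`1.125`. -/
lemma sqrt_inv_delta_le (t : ℕ) :
    √(2 * (1 + 1 / delta t)) ≤ 3 * ((t : ℝ) + 1) ^ (1 / 8 : ℝ) := by
  have ht : (0 : ℝ) ≤ (t : ℝ) := Nat.cast_nonneg t
  set y := ((t : ℝ) + 1) ^ (1 / 8 : ℝ) with hy
  have hy1 : 1 ≤ y := Real.one_le_rpow (by linarith) (by norm_num)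
  have hy2 : ((t : ℝ) + 1) ^ (1 / 4 : ℝ) = y ^ 2 := by
    rw [hy, ← Real.rpow_mul_natCast (by positivity)]
    norm_num
  refine Real.sqrt_le_iff.mpr ⟨by positivity, ?_⟩
  unfold delta
  rw [hy2, one_div_one_div]
  nlinarith

namespace Input

variable {I : Input d} {ξ : ℕ → Sample d}

/-- The argument is at most `550 d N⁶ / p²`, which is below the eighth power of `X = d N² / p²`
because `X ≥ 4` and `4⁵ > 550`. Allowing `n ≤ 2 d` covers both oracles. -/
lemma Valid.log_failureProb_le (hI : I.Valid) {n t N : ℕ} (hn : 0 < n) (hnd : n ≤ 2 * d)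
    (ht : 1 ≤ t) (htN : t + 1 ≤ N) :
    Real.log (11 * n / (I.failureProb t / 2) ^ 2) ≤
      8 * Real.log (d * (N : ℝ) ^ 2 / I.p ^ 2) := by
  have hp := hI.p_mem.1
  have hp1 := hI.p_mem.2
  have hd : (1 : ℝ) ≤ d := by exact_mod_cast (by omega : 1 ≤ d)
  have hn' : (0 : ℝ) < n := by exact_mod_cast hn
  have hnd' : (n : ℝ) ≤ 2 * d := by exact_mod_cast hnd
  have htN' : (t : ℝ) + 1 ≤ N := by exact_mod_cast htN
  have ht' : (1 : ℝ) ≤ t := by exact_mod_cast ht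
  have hN : (2 : ℝ) ≤ N := by linarith
  have hl0 : 0 < Real.log ((t : ℝ) + 1) := Real.log_pos (by linarith)
  have hl1 : Real.log ((t : ℝ) + 1) ≤ N := (Real.log_le_self (by linarith)).trans htN'
  set X := d * (N : ℝ) ^ 2 / I.p ^ 2 with hX
  have hX4 : 4 ≤ X := by
    rw [hX, le_div_iff₀ (by positivity)]
    have : I.p ^ 2 ≤ 1 := by nlinarith
    nlinarith
  have e : 11 * (n : ℝ) / (I.failureProb t / 2) ^ 2 =
      275 * n * ((t : ℝ) + 1) ^ 2 * Real.log ((t : ℝ) + 1) ^ 4 / I.p ^ 2 := by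
    unfold failureProb
    field_simp
    ring
  have h1 : 11 * (n : ℝ) / (I.failureProb t / 2) ^ 2 ≤ 550 * d * (N : ℝ) ^ 6 / I.p ^ 2 := by
    rw [e]
    have : 275 * n * ((t : ℝ) + 1) ^ 2 * Real.log ((t : ℝ) + 1) ^ 4 ≤
        275 * (2 * d) * (N : ℝ) ^ 2 * (N : ℝ) ^ 4 := by gcongr
    exact div_le_div_of_nonneg_right (by linarith) (by positivity)
  have h2 : 550 * d * (N : ℝ) ^ 6 / I.p ^ 2 ≤ X ^ 8 := by
    have h3 : (550 : ℝ) ≤ X ^ 5 := by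
      have : (4 : ℝ) ^ 5 ≤ X ^ 5 := by gcongr
      linarith
    have h4 : d * (N : ℝ) ^ 6 / I.p ^ 2 ≤ X ^ 3 := by
      have hd3 : (d : ℝ) ≤ (d : ℝ) ^ 3 := le_self_pow₀ hd (by norm_num)
      have hp6 : I.p ^ 6 ≤ I.p ^ 2 := pow_le_pow_of_le_one hp.le hp1.le (by norm_num)
      have e3 : X ^ 3 = (d : ℝ) ^ 3 * (N : ℝ) ^ 6 / I.p ^ 6 := by
        rw [hX, div_pow, mul_pow, ← pow_mul, ← pow_mul]
      rw [e3]
      gcongr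
    calc 550 * d * (N : ℝ) ^ 6 / I.p ^ 2 = 550 * (d * (N : ℝ) ^ 6 / I.p ^ 2) := by ring
      _ ≤ X ^ 5 * X ^ 3 := by gcongr
      _ = X ^ 8 := by ring
  have hpos : 0 < 11 * (n : ℝ) / (I.failureProb t / 2) ^ 2 := by
    rw [e]; positivity
  have h5 := Real.log_le_log hpos (h1.trans h2)
  rw [Real.log_pow] at h5
  exact_mod_cast h5

lemma Valid.one_le_log (hI : I.Valid) (hd : 0 < d) {N : ℕ} (hN : 2 ≤ N) :
    1 ≤ Real.log (d * (N : ℝ) ^ 2 / I.p ^ 2) := by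
  have hp := hI.p_mem.1
  have hp1 := hI.p_mem.2
  have hd : (1 : ℝ) ≤ d := by exact_mod_cast hd
  have hN : (2 : ℝ) ≤ N := by exact_mod_cast hN
  have h4 : 4 ≤ d * (N : ℝ) ^ 2 / I.p ^ 2 := by
    rw [le_div_iff₀ (by positivity)]
    have : I.p ^ 2 ≤ 1 := by nlinarith
    nlinarith
  rw [Real.le_log_iff_exp_le (by linarith)]
  have := Real.exp_one_lt_d9
  linarith

lemma Valid.lanczosCount_le (hI : I.Valid) (hd : 0 < d) {n t N : ℕ} (hn : 0 < n)
    (hnd : n ≤ 2 * d) (ht : 1 ≤ t) (htN : t + 1 ≤ N) :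
    (lanczosCount n (delta t) (I.failureProb t / 2) : ℝ) ≤
      8 * ((N : ℝ) ^ (1 / 8 : ℝ) * Real.log (d * (N : ℝ) ^ 2 / I.p ^ 2)) := by
  have htN' : (t : ℝ) + 1 ≤ N := by exact_mod_cast htN
  have hN : (1 : ℝ) ≤ N := by exact_mod_cast (by omega : 1 ≤ N)
  have h1 := sqrt_inv_delta_le t
  have h2 := hI.log_failureProb_le hn hnd ht htN
  have h3 := hI.one_le_log hd (by omega : 2 ≤ N)
  set Λ := Real.log (d * (N : ℝ) ^ 2 / I.p ^ 2)
  set y := (N : ℝ) ^ (1 / 8 : ℝ) with hy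
  have hy1 : 1 ≤ y := Real.one_le_rpow hN (by norm_num)
  have h4 : ((t : ℝ) + 1) ^ (1 / 8 : ℝ) ≤ y :=
    Real.rpow_le_rpow (by positivity) htN' (by norm_num)
  have h5 : √(2 * (1 + 1 / delta t)) * Real.log (11 * n / (I.failureProb t / 2) ^ 2) ≤
      (3 * y) * (8 * Λ) := by
    refine (mul_le_mul_of_nonneg_left h2 (Real.sqrt_nonneg _)).trans ?_
    gcongr
    linarith
  have h6 : lanczosCount n (delta t) (I.failureProb t / 2) ≤ ⌈6 * (y * Λ) + 1 / 2⌉₊ := by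
    unfold lanczosCount
    refine Nat.ceil_mono ?_
    linarith
  have h7 : 1 ≤ y * Λ := one_le_mul_of_one_le_of_one_le hy1 h3
  have h8 := Nat.ceil_lt_add_one (R := ℝ) (a := 6 * (y * Λ) + 1 / 2) (by linarith)
  have h9 : (lanczosCount n (delta t) (I.failureProb t / 2) : ℝ) ≤
      (⌈6 * (y * Λ) + 1 / 2⌉₊ : ℝ) := by exact_mod_cast h6
  linarith

lemma separation_mv_le (t : ℕ) (W : Mat d) (x : Sample d) :
    (I.separation t W x).mv ≤ lanczosCount d (delta t) (I.failureProb t / 2) +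
      2 * lanczosCount (2 * d) (delta t) (I.failureProb t / 2) := by
  unfold separation
  dsimp only
  split
  · simp [extEvec]
  · simp [extEvec, maxSvec]

/-- An iteration makes at most one query, in a round `t ≤ k`. The factor is `24 = 8 + 2 · 8`, as a
product with the block matrix counts twice. -/
lemma Valid.run_oracleMv_le (hI : I.Valid) (hd : 0 < d) {N : ℕ} {k : ℕ} (hk : k ≤ N) :
    ((I.run ξ k).oracleMv : ℝ) ≤
      k * (24 * ((N : ℝ) ^ (1 / 8 : ℝ) * Real.log (d * (N : ℝ) ^ 2 / I.p ^ 2))) := by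
  induction k with
  | zero => simp [run, initState]
  | succ k ih =>
    have hih := ih (by omega)
    have hp := hI.p_mem.1
    have hlog : 0 ≤ Real.log (d * (N : ℝ) ^ 2 / I.p ^ 2) := by
      refine Real.log_nonneg ?_
      have hd' : (1 : ℝ) ≤ d := by exact_mod_cast hd
      have hN : (1 : ℝ) ≤ N := by exact_mod_cast (by omega : 1 ≤ N)
      rw [le_div_iff₀ (by positivity)]
      have : I.p ^ 2 ≤ 1 := by nlinarith [hI.p_mem.2]
      nlinarith
    have hnn : 0 ≤ (N : ℝ) ^ (1 / 8 : ℝ) * Real.log (d * (N : ℝ) ^ 2 / I.p ^ 2) := by positivity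
    rw [run_oracleMv_succ]
    split_ifs with hpend
    · have ht := I.run_t_pos_of_pending ξ hpend
      have htk := I.run_t_le ξ k
      set t := (I.run ξ k).t
      have h1 : ((I.separation t (I.run ξ k).W (ξ t)).mv : ℝ) ≤
          lanczosCount d (delta t) (I.failureProb t / 2) +
            2 * lanczosCount (2 * d) (delta t) (I.failureProb t / 2) := by
        exact_mod_cast separation_mv_le t (I.run ξ k).W (ξ t)
      have h2 := hI.lanczosCount_le hd hd (by omega) ht (by omega : t + 1 ≤ N)
      have h3 := hI.lanczosCount_le hd (by omega : 0 < 2 * d) le_rfl ht (by omega : t + 1 ≤ N)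
      push_cast
      linarith
    · push_cast
      linarith

end Input

end OracleCost

end QNPE

/-! ### The theorem -/

theorem theorem6p19 :
    ∃ (C₀ : ℝ) (C : ℝ → ℝ → ℝ → ℝ), ∀ (d : ℕ) (I : QNPE.Input d), 0 < d → I.Valid →
      ∀ (Ω : Type*) [MeasurableSpace Ω] (μ : MeasureTheory.Measure Ω)
        [MeasureTheory.IsProbabilityMeasure μ] (ξ : ℕ → Ω → QNPE.Sample d),
        (∀ t, Measurable (ξ t)) → ProbabilityTheory.iIndepFun ξ μ →
        (∀ t, μ.map (ξ t) = QNPE.sampleLaw d) →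
        ∃ E : Set Ω, MeasurableSet E ∧ ENNReal.ofReal (1 - I.p) ≤ μ E ∧
          ∀ ω ∈ E, ∀ (D : Set (QNPE.Vec (Fin d))) (ε : ℝ), IsCompact D → D.Nonempty → 0 < ε →
            ∃ N evals solverMv oracleMv : ℕ,
              I.IsComplexity (fun t => ξ t ω) D ε N ∧
              (I.run (fun t => ξ t ω) N).evals = evals ∧
              (I.run (fun t => ξ t ω) N).solverMv = solverMv ∧
              (I.run (fun t => ξ t ω) N).oracleMv = oracleMv ∧
              (evals : ℝ) ≤ 3 * N + Real.logb (1 / I.β) (5 * I.σ₀ * I.L₁ / I.α₂) ∧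
              (¬ I.problem.IsMinimization →
                (solverMv : ℝ) ≤ C I.α₁ I.α₂ I.β *
                  (N + I.L₁ * I.maxDistSq D / ε + I.σ₀ * I.L₁)) ∧
              (I.problem.IsMinimization →
                (solverMv : ℝ) ≤ C I.α₁ I.α₂ I.β *
                  (N + Real.sqrt (N * (I.L₁ * I.maxDistSq D / (2 * ε)))
                    + Real.sqrt (I.σ₀ * I.L₁))) ∧
              (oracleMv : ℝ) ≤ C₀ * ((N : ℝ) ^ (1.125 : ℝ) *
                Real.log (d * (N : ℝ) ^ 2 / I.p ^ 2)) := by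
  -- The sum of the two nonnegative solver constants serves all problem classes.
  refine ⟨24, fun a b c => QNPE.solverConst a b c + QNPE.solverConstMin a b c,
    fun d I hd hI Ω _ μ _ ξ hξ hind hlaw => ?_⟩
  obtain ⟨E, hE, hμ, hgood⟩ := I.exists_good_event hd hI hξ hind hlaw
  refine ⟨E, hE, hμ, fun ω hω D ε hD hne hε => ?_⟩
  have hrun : I.GoodRun fun t => ξ t ω := hgood ω hω
  have hM := QNPE.Input.maxDistSq_nonneg (I := I) hD hne
  have hL := hI.L₁_pos
  have hσ := hI.σ₀_pos
  have hc1 := hI.solverConst_nonneg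
  have hc2 := hI.solverConstMin_nonneg
  obtain ⟨N, hN, hsum⟩ := hI.exists_isComplexity hrun hD hne hε
  obtain ⟨K, hK, hK1, hK2⟩ := hI.run_solverMv hrun (N + 1)
  refine ⟨N + 1, _, K, _, hN, hI.run_evals hrun (N + 1), hK, rfl, ?_, fun _ => ?_, fun hmin => ?_,
    ?_⟩
  · have := hI.sum_runRejections_le hrun N
    push_cast at this ⊢
    linarith
  · have h1 := hI.solver_sum_le hrun (M := I.maxDistSq D / ε) (N := N)
      (hsum.trans (le_of_eq (by field_simp)))
    refine (hK1.trans h1).trans ?_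
    rw [← mul_div_assoc]
    refine mul_le_mul_of_nonneg_right (le_add_of_nonneg_right hc2) ?_
    positivity
  · have h1 := hI.solver_sum_le_min hrun hsum
    refine ((hK2 hmin).trans h1).trans ?_
    rw [← mul_div_assoc]
    refine mul_le_mul_of_nonneg_right (le_add_of_nonneg_left hc1) ?_
    positivity
  · refine (hI.run_oracleMv_le hd le_rfl).trans (le_of_eq ?_)
    have e : ((N + 1 : ℕ) : ℝ) ^ (1.125 : ℝ) =
        ((N + 1 : ℕ) : ℝ) * ((N + 1 : ℕ) : ℝ) ^ (1 / 8 : ℝ) := by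
      rw [← Real.rpow_one_add' (by positivity) (by norm_num)]
      norm_num
    rw [e]
    ring
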